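/- Let $1\le k\le l$. Let $\alpha_j=\epsilon_j-\epsilon_{j+1}$ ($j<l$), $\alpha_l=2\epsilon_l$ be the simple roots of $C_l$ in $V_{\mathbb C}=\mathbb C^l$, $\alpha_j^\vee$ the coroots, $\omega_k=\epsilon_1+\dots+\epsilon_k$, and let $\widetilde W=\widetilde W^{(k)}(C_l)$ be the group of transformations of $V_{\mathbb C}\oplus\mathbb C$ generated by the Weyl group acting on $V_{\mathbb C}$, the translations of $V_{\mathbb C}$ by coroots, and $(\mathbf x,x_{l+1})\mapsto(\mathbf x+\omega_k,x_{l+1}-1)$. Write $\mathbf x=x_1\alpha_1^\vee+\dots+x_l\alpha_l^\vee$, $x_0=0$, $\xi_j=e^{2\pi i(x_j-x_{j-1})}+e^{-2\pi i(x_j-x_{j-1})}$, and put $$y^j=e^{2\pi i\min(j,k)x_{l+1}}\sigma_j(\xi_1,\dots,\xi_l)\quad(1\le j\le l),\qquad y^{l+1}=2\pi i\,x_{l+1},$$ $\sigma_j$ the elementary symmetric polynomials. Let $(dx_s,dx_n)=\frac{s}{4\pi^2}$ for $1\le s\le n\le l$, $(dx_s,dx_{l+1})=0$ for $s\le l$,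 and $(dx_{l+1},dx_{l+1})=-\frac1{4k\pi^2}$, and let $$g^{ij}(y)=\sum_{a,b=1}^{l+1}\frac{\partial y^i}{\partial x_a}\frac{\partial y^j}{\partial x_b}(dx_a,dx_b).$$ Let $\theta^0=e^{k y^{l+1}}$, $\theta^j=y^je^{(k-j)y^{l+1}}$ for $1\le j<k$, and $\theta^j=y^j$ for $k\le j\le l$. The contravariant Levi-Civita components of a metric are $\Gamma^{ij}_r=-\sum_s g^{is}\Gamma^j_{sr}$. A pair of symmetric holomorphic contravariant tensors $(g^{ij}),(\eta^{ij})$ is a *flat pencil of metrics* on a nonempty open set $\mathcal U$ if $\eta$ and all $g+\lambda\eta$ ($\lambda\in\mathbb C$) are nondegenerate on dense subsets of $\mathcal U$, are flat wherever they are nondegenerate, and the contravariant Levi-Civita components of $g+\lambda\eta$ are there $\Gamma^{ij}_r+\lambda\gamma^{ij}_r$, where $\Gamma,\gamma$ are the holomorphic extensions to $\mathcal U$ of those of $g$ and of $\eta$. **Theorem.** 1. The map $x\mapsto y$ is onto $\mathbb C^{l+1}$; two points $x$, $x'$ lie in the same $\widetilde W$-orbit if and only if they have the same $y^1,\dots,y^l,e^{y^{l+1}}$.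 The functions $g^{ij}$ are well-defined functions of $y\in\mathbb C^{l+1}$, and are $2\pi i$-periodic in $y^{l+1}$. 2. Let $0\le m\le l-k$ be an integer, let $$P_0(u)=\sum_{j=k}^l c_ju^{l-j}=(u+2)^m(u-2)^{l-k-m},$$ that is, $c_j=(-2)^{j-k}\sum_{s=0}^m(-1)^{m-s}\binom ms\binom{l-k-m}{l-j-s}$ (a binomial coefficient with negative lower index being $0$), let $e=\sum_{j=k}^l c_j\frac{\partial}{\partial y^j}$, which is also $\sum_{j=k}^lc_j\frac{\partial}{\partial\theta^j}$, and let $\eta^{ij}=\mathcal L_eg^{ij}$. Then $(g^{ij})$, $(\eta^{ij})$ form a flat pencil of metrics on $\mathcal U=\{y:\det(\eta^{ij}(y))\ne0\}$; the preimage of $\mathcal U$ in $V_{\mathbb C}\oplus\mathbb C$ is $\widetilde W$-invariant. 3. Let $m$ be as in 2. There are global coordinates $\tau^1,\dots,\tau^{l+1}$ on $\mathbb C^{l+1}$ (biholomorphic in $y$), uniquely determined by $\tau^{l+1}=y^{l+1}$ and $$\sum_{j=0}^l\theta^ju^{l-j}=\sum_{j=0}^{l-m}\varpi^j(u+2)^m(u-2)^{l-m-j}-\sum_{j=l-m+1}^l\varpi^j(u+2)^{l-j}(u-2)^{j-k-1},$$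 where $\varpi^0=e^{k\tau^{l+1}}$, $\varpi^j=\tau^je^{(k-j)\tau^{l+1}}$ for $1\le j<k$, $\varpi^j=\tau^j$ for $k\le j\le l$. In these coordinates, with $n=l-k-m$ and $0^0=1$, $$\det(\eta^{ij}(\tau))=(-1)^{1+\binom{k-1}2+\binom n2+\binom m2}\,k^{k-1}\,4^{l-k}\,m^m\,n^n\,(\tau^{l-m})^n(\tau^l)^m .$$ 4. In the coordinates $\theta^0,\dots,\theta^l$ the components $g^{ij}$ of the metric and its contravariant Levi-Civita components $\Gamma^{ij}_r$ are polynomials in $\theta$. For constants $c=(c_0,\dots,c_l)\in\mathbb C^{l+1}$, all the functions $\lambda\mapsto g^{ij}(\theta+\lambda c)$ and $\lambda\mapsto\Gamma^{ij}_r(\theta+\lambda c)$ are polynomials of degree at most one for every $\theta$ if and only if $\sum_{j=0}^lc_ju^{l-j}=a\,(u+2)^m(u-2)^{l-k-m}$ for some integer $0\le m\le l-k$ and some $a\in\mathbb C$. -/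

import Mathlib

open Polynomial

noncomputable section

/-! ### Contravariant metrics on open subsets of `ℂⁿ`

A contravariant metric is a matrix-valued function `g`, with `g y i j = g^{ij}(y)`. -/

namespace FlatPencil

variable {n : ℕ}

/-- The holomorphic partial derivative `∂f/∂yᵃ`. -/
def pd (f : (Fin n → ℂ) → ℂ) (a : Fin n) (y : Fin n → ℂ) : ℂ :=
  fderiv ℂ f y (Pi.single a 1)

/-- The Jacobian matrix `∂Fⁱ/∂xᵃ`. -/
def jacobian (F : (Fin n → ℂ) → (Fin n → ℂ)) (x : Fin n → ℂ) : Matrix (Fin n) (Fin n) ℂ :=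
  Matrix.of fun i a => pd (fun z => F z i) a x

/-- The Christoffel symbols `Γ^i_{ab}` of the Levi-Civita connection of the metric
`(g_{ij}) = (g^{ij})⁻¹`. -/
def christoffel (g : (Fin n → ℂ) → Matrix (Fin n) (Fin n) ℂ) (y : Fin n → ℂ)
    (i a b : Fin n) : ℂ :=
  (1 / 2) * ∑ s, g y i s *
    (pd (fun z => (g z)⁻¹ s b) a y + pd (fun z => (g z)⁻¹ a s) b y - pd (fun z => (g z)⁻¹ a b) s y)

/-- The contravariant components `Γ^{ij}_r = - ∑ₛ g^{is} Γ^j_{sr}`. -/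
def contraChristoffel (g : (Fin n → ℂ) → Matrix (Fin n) (Fin n) ℂ) (y : Fin n → ℂ)
    (i j r : Fin n) : ℂ :=
  -∑ s, g y i s * christoffel g y j s r

/-- The Riemann curvature tensor `R^i_{jab}` of the Levi-Civita connection. -/
def curvature (g : (Fin n → ℂ) → Matrix (Fin n) (Fin n) ℂ) (y : Fin n → ℂ)
    (i j a b : Fin n) : ℂ :=
  pd (fun z => christoffel g z i b j) a y - pd (fun z => christoffel g z i a j) b y
    + ∑ p, (christoffel g y i a p * christoffel g y p b j
      - christoffel g y i b p * christoffel g y p a j)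

/-- The Lie derivative of a contravariant two-tensor along the vector field `e`. -/
def lieDeriv (e : (Fin n → ℂ) → (Fin n → ℂ)) (g : (Fin n → ℂ) → Matrix (Fin n) (Fin n) ℂ)
    (y : Fin n → ℂ) : Matrix (Fin n) (Fin n) ℂ :=
  Matrix.of fun i j => ∑ s, (e y s * pd (fun z => g z i j) s y
    - g y s j * pd (fun z => e z i) s y - g y i s * pd (fun z => e z j) s y)

/-- The contravariant metrics `g` and `η` form a flat pencil on `U`: `g + c η` is a flat metric
wherever it is nondegenerate, and its contravariant Levi-Civita components are `Γ + c γ`, where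
`Γ` and `γ` are those of `g` and of `η`. As `g` and `η` may degenerate at points of `U`, `Γ` and `γ`
are holomorphic on all of `U` and are the Levi-Civita components at the nondegenerate points,
which are dense. -/
structure IsFlatPencil (U : Set (Fin n → ℂ))
    (g η : (Fin n → ℂ) → Matrix (Fin n) (Fin n) ℂ) : Prop where
  isOpen : IsOpen U
  nonempty : U.Nonempty
  symm_left : ∀ y ∈ U, (g y).IsSymm
  symm_right : ∀ y ∈ U, (η y).IsSymm
  holo_left : ∀ i j, DifferentiableOn ℂ (fun y => g y i j) U
  holo_right : ∀ i j, DifferentiableOn ℂ (fun y => η y i j) U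
  nondeg : ∀ c : ℂ, U ⊆ closure {y ∈ U | (g y + c • η y).det ≠ 0}
  nondeg_right : U ⊆ closure {y ∈ U | (η y).det ≠ 0}
  flat : ∀ c : ℂ, ∀ y ∈ U, (g y + c • η y).det ≠ 0 →
    ∀ i j a b, curvature (fun z => g z + c • η z) y i j a b = 0
  flat_right : ∀ y ∈ U, (η y).det ≠ 0 → ∀ i j a b, curvature η y i j a b = 0
  connection : ∃ Γ γ : (Fin n → ℂ) → Fin n → Fin n → Fin n → ℂ,
    (∀ i j r, DifferentiableOn ℂ (fun y => Γ y i j r) U) ∧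
    (∀ i j r, DifferentiableOn ℂ (fun y => γ y i j r) U) ∧
    (∀ y ∈ U, (g y).det ≠ 0 → ∀ i j r, contraChristoffel g y i j r = Γ y i j r) ∧
    (∀ y ∈ U, (η y).det ≠ 0 → ∀ i j r, contraChristoffel η y i j r = γ y i j r) ∧
    ∀ c : ℂ, ∀ y ∈ U, (g y + c • η y).det ≠ 0 → ∀ i j r,
      contraChristoffel (fun z => g z + c • η z) y i j r = Γ y i j r + c * γ y i j r

end FlatPencil

/-! ### The extended affine Weyl group of type `C_l` and its orbit space

Points of `V_ℂ ⊕ ℂ` are given by their coordinates `x = (x₁, …, x_{l+1})` where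
`𝐱 = x₁ α₁^∨ + ⋯ + x_l α_l^∨`; the index `j : Fin (l + 1)` stands for `x_{j+1}`, and likewise for
the coordinates `y` and `τ`. -/

namespace OrbitC

open FlatPencil

/-- The simple roots `α_j = e_j - e_{j+1}` for `j < l`, `α_l = 2 e_l`. -/
def simpleRoot (l : ℕ) (j : Fin l) : Fin l → ℂ := fun i =>
  if i = j then (if (j : ℕ) + 1 = l then 2 else 1)
  else if (i : ℕ) = (j : ℕ) + 1 then -1 else 0

/-- The coroot `2 α_j / (α_j, α_j)`. -/
def simpleCoroot (l : ℕ) (j : Fin l) : Fin l → ℂ :=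
  (2 / (simpleRoot l j ⬝ᵥ simpleRoot l j)) • simpleRoot l j

/-- The fundamental weight `ω_k = e_1 + ⋯ + e_k`. -/
def fundWeight (l k : ℕ) : Fin l → ℂ := fun i => if (i : ℕ) < k then 1 else 0

/-- The vector `𝐱 = x₁ α₁^∨ + ⋯ + x_l α_l^∨` in the basis `e_1, …, e_l`. -/
def vec (l : ℕ) (x : Fin (l + 1) → ℂ) : Fin l → ℂ :=
  ∑ j : Fin l, x j.castSucc • simpleCoroot l j

/-- The reflection in the simple root `α_j`. -/
def simpleReflection (l : ℕ) (j : Fin l) (v : Fin l → ℂ) : Fin l → ℂ :=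
  v - (v ⬝ᵥ simpleCoroot l j) • simpleRoot l j

/-- The extended affine Weyl group, acting on `V_ℂ ⊕ ℂ`: it is generated by the simple reflections,
the translations by the simple coroots, and `(𝐱, x_{l+1}) ↦ (𝐱 + ω_k, x_{l+1} - 1)`. -/
def extAffineWeyl (l k : ℕ) : Subgroup (Equiv.Perm (Fin (l + 1) → ℂ)) :=
  Subgroup.closure
    ({σ | ∃ j, ∀ x, vec l (σ x) = simpleReflection l j (vec l x) ∧ σ x (Fin.last l) = x (Fin.last l)} ∪
     {σ | ∃ j, ∀ x, vec l (σ x) = vec l x + simpleCoroot l j ∧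
        σ x (Fin.last l) = x (Fin.last l)} ∪
     {σ | ∀ x, vec l (σ x) = vec l x + fundWeight l k ∧
        σ x (Fin.last l) = x (Fin.last l) - 1})

/-- `ξ_j = exp (2πi (x_j - x_{j-1})) + exp (-2πi (x_j - x_{j-1}))` with `x_0 = 0`. -/
def xi (l : ℕ) (x : Fin (l + 1) → ℂ) (j : Fin l) : ℂ :=
  Complex.exp (2 * Real.pi * Complex.I *
      (x j.castSucc - if h : (j : ℕ) = 0 then 0 else x ⟨(j : ℕ) - 1, by omega⟩)) +
  Complex.exp (-(2 * Real.pi * Complex.I *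
      (x j.castSucc - if h : (j : ℕ) = 0 then 0 else x ⟨(j : ℕ) - 1, by omega⟩)))

/-- The coordinates `y^j = exp (2πi d_j x_{l+1}) σ_j(ξ)` for `j ≤ l`, with `d_j = min j k`, and
`y^{l+1} = 2πi x_{l+1}`. -/
def yCoord (l k : ℕ) (x : Fin (l + 1) → ℂ) : Fin (l + 1) → ℂ := fun j =>
  if j = Fin.last l then 2 * Real.pi * Complex.I * x (Fin.last l)
  else Complex.exp (2 * Real.pi * Complex.I * (min ((j : ℕ) + 1) k : ℕ) * x (Fin.last l)) *
    MvPolynomial.aeval (xi l x) (MvPolynomial.esymm (Fin l) ℂ ((j : ℕ) + 1))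

/-- The form `(dx_s, dx_n) = s / (4π²)` for `s ≤ n ≤ l`, `(dx_s, dx_{l+1}) = 0`,
`(dx_{l+1}, dx_{l+1}) = -1 / (4kπ²)`. -/
def dualForm (l k : ℕ) : Matrix (Fin (l + 1)) (Fin (l + 1)) ℂ := Matrix.of fun a b =>
  if a = Fin.last l ∧ b = Fin.last l then -1 / (4 * k * (Real.pi : ℂ) ^ 2)
  else if a = Fin.last l ∨ b = Fin.last l then 0
  else (((min (a : ℕ) (b : ℕ) : ℕ) : ℂ) + 1) / (4 * (Real.pi : ℂ) ^ 2)

/-- `∑_{a,b} (∂Fⁱ/∂x_a) (∂Fʲ/∂x_b) (dx_a, dx_b)` at the point `x`. -/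
def pushForm (l k : ℕ) (F : (Fin (l + 1) → ℂ) → (Fin (l + 1) → ℂ)) (x : Fin (l + 1) → ℂ) :
    Matrix (Fin (l + 1)) (Fin (l + 1)) ℂ :=
  jacobian F x * dualForm l k * (jacobian F x).transpose

/-- The components `g^{ij}(y)` of the metric on the orbit space, at any preimage `x` of `y`. -/
def orbitMetric (l k : ℕ) (y : Fin (l + 1) → ℂ) : Matrix (Fin (l + 1)) (Fin (l + 1)) ℂ :=
  pushForm l k (yCoord l k) (Function.invFun (yCoord l k) y)

/-- `P₀(u) = (u + 2)^m (u - 2)^{l-k-m}`. -/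
def shiftPoly (l k m : ℕ) : ℂ[X] := (X + C 2) ^ m * (X - C 2) ^ (l - k - m)

/-- The constant vector field `e = ∑_{j=k}^l c_j ∂/∂y^j`, `c_j` the coefficient of `u^{l-j}` in
`P₀`. -/
def unityField (l k m : ℕ) : Fin (l + 1) → ℂ := fun j =>
  if k ≤ (j : ℕ) + 1 ∧ (j : ℕ) + 1 ≤ l then (shiftPoly l k m).coeff (l - ((j : ℕ) + 1)) else 0

/-- The tensor `η^{ij} = (L_e g)^{ij}`. -/
def orbitEta (l k m : ℕ) : (Fin (l + 1) → ℂ) → Matrix (Fin (l + 1)) (Fin (l + 1)) ℂ :=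
  lieDeriv (fun _ => unityField l k m) (orbitMetric l k)

/-- The functions `θ^0 = exp (k y^{l+1})`, `θ^j = y^j exp ((k - j) y^{l+1})` for `1 ≤ j < k`, and
`θ^j = y^j` for `k ≤ j ≤ l` (the truncated difference `k - j` covers both cases); here the index
`j : Fin (l + 1)` stands for `θ^j` itself. -/
def theta (l k : ℕ) (y : Fin (l + 1) → ℂ) : Fin (l + 1) → ℂ :=
  Fin.cases (Complex.exp (k * y (Fin.last l)))
    (fun j : Fin l => y j.castSucc * Complex.exp ((k - ((j : ℕ) + 1) : ℕ) * y (Fin.last l)))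

/-- `P(u) = ∑_{j=0}^l θ^j u^{l-j}`. -/
def polyOf (l : ℕ) (θ : Fin (l + 1) → ℂ) : ℂ[X] :=
  ∑ j : Fin (l + 1), C (θ j) * X ^ (l - (j : ℕ))

/-- `∑_{j=0}^{l-m} ϖ^j (u+2)^m (u-2)^{l-m-j} - ∑_{j=l-m+1}^l ϖ^j (u+2)^{l-j} (u-2)^{j-k-1}`. -/
def polyTau (l k m : ℕ) (ϖ : Fin (l + 1) → ℂ) : ℂ[X] :=
  ∑ j : Fin (l + 1),
    if (j : ℕ) ≤ l - m then C (ϖ j) * (X + C 2) ^ m * (X - C 2) ^ (l - m - (j : ℕ))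
    else -(C (ϖ j) * (X + C 2) ^ (l - (j : ℕ)) * (X - C 2) ^ ((j : ℕ) - k - 1))

end OrbitC

end

/-! ### Differential calculus of matrix-valued functions on `ℂⁿ`. -/

noncomputable section

open Polynomial
open scoped ContDiff Topology Matrix

namespace FlatPencil

variable {n : ℕ}

/-! ### Partial derivatives -/

/-! Everything is read off the generating polynomial `P(u) = ∑ θ^j u^{l-j}`. With `φ_j = 2πi (x_j -
x_{j-1})` and `φ_{l+1} = 2πi x_{l+1}` it factors as `e^{k φ_{l+1}} ∏ (u + 2 cosh φ_j)`
(`polyOf_theta_phiChart`), and in the coordinates `φ` the metric is the constant matrix `diag(-1, …,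
-1, 1/k)`. Surjectivity and the description of the orbits come from this factorization: `P`
determines the numbers `2 cosh φ_j` up to order, and each of them determines `φ_j / 2πi` up to sign
and integers.

The bilinear generating function of the metric is the pairing `⟨dP(u), dP(v)⟩`. Partial fractions of
the logarithmic derivatives of `P`, together with `4 sinh² = (2 cosh)² - 4`, express it through `P`
and `P'` only. The same computation with Hessians treats the contravariant connection. The result is
`kernel`, divided by `(v - u)²`: the components `Γ` are linear and the components of `g` quadratic
in `θ` (`isFlatChart_theta`).

Consequently, along a line `θ + λ c` the connection is always affine in `λ`, and the only
obstruction for the metric is its `λ²` coefficient, the metric evaluated at `c`. For the polynomial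
`Q` of `c` this vanishes exactly if `(4 - u²) Q'/Q` is affine with slope `k - l` (or `Q = 0`), that
is, if `Q` has no roots besides `±2` and has degree `l - k` (`thetaMetric_eq_zero_iff`). When `Q =
P₀`, the pencil `g + λ η` is just `g` translated along `e`, so flatness and the Levi-Civita property
are inherited from `g`; for `η` itself they follow by letting `ε → 0` in `η + ε g`
(`isFlatPencil_of_translation`).

For the determinant, put `F = (4 - u²) (P/P₀)'`. Then the generating function of `η` is `P₀(u) P₀(v)
(F(u) - F(v)) / (v - u)`. The coordinates `ϖ` expand `P/P₀` in powers of `u - 2`, of `1/(u - 2)`,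
and in terms `-(u + 2)⁻¹ ((u - 2)/(u + 2))^i`. Divided differences of powers are Hankel, so `η`
splits into three Hankel blocks vanishing below the antidiagonal (`thetaEta_tauMatrix_mulVec`),
whose determinants are immediate. The Jacobian between `θ` and `y` accounts for the remaining
factors. -/

theorem pd_eq_of_hasDerivAt {f : (Fin n → ℂ) → ℂ} {y : Fin n → ℂ} {a : Fin n} {d : ℂ}
    (hf : DifferentiableAt ℂ f y)
    (hd : HasDerivAt (fun t => f (Function.update y a t)) d (y a)) : pd f a y = d := by
  have h1 : HasFDerivAt f (fderiv ℂ f y) (Function.update y a (y a)) := by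
    rw [Function.update_eq_self]; exact hf.hasFDerivAt
  exact (h1.comp_hasDerivAt (y a) (hasDerivAt_update y a (y a))).unique hd

theorem pd_const (c : ℂ) (a : Fin n) (y : Fin n → ℂ) : pd (fun _ => c) a y = 0 := by
  simp [pd]

theorem pd_add {f g : (Fin n → ℂ) → ℂ} {y : Fin n → ℂ} (hf : DifferentiableAt ℂ f y)
    (hg : DifferentiableAt ℂ g y) (a : Fin n) :
    pd (fun z => f z + g z) a y = pd f a y + pd g a y := by
  unfold pd; rw [fderiv_fun_add hf hg]; rfl

theorem pd_mul {f g : (Fin n → ℂ) → ℂ} {y : Fin n → ℂ} (hf : DifferentiableAt ℂ f y)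
    (hg : DifferentiableAt ℂ g y) (a : Fin n) :
    pd (fun z => f z * g z) a y = pd f a y * g y + f y * pd g a y := by
  unfold pd; rw [fderiv_fun_mul hf hg]
  simp [smul_eq_mul]; ring

theorem pd_sum {ι : Type*} (s : Finset ι) {f : ι → (Fin n → ℂ) → ℂ} {y : Fin n → ℂ}
    (hf : ∀ i ∈ s, DifferentiableAt ℂ (f i) y) (a : Fin n) :
    pd (fun z => ∑ i ∈ s, f i z) a y = ∑ i ∈ s, pd (f i) a y := by
  unfold pd; rw [fderiv_fun_sum hf]; simp

theorem pd_const_mul {f : (Fin n → ℂ) → ℂ} {y : Fin n → ℂ} (hf : DifferentiableAt ℂ f y)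
    (c : ℂ) (a : Fin n) : pd (fun z => c * f z) a y = c * pd f a y := by
  rw [pd_mul (differentiableAt_const c) hf, pd_const]; ring

theorem pd_congr {f g : (Fin n → ℂ) → ℂ} {y : Fin n → ℂ} (h : f =ᶠ[𝓝 y] g) (a : Fin n) :
    pd f a y = pd g a y := by
  unfold pd; rw [h.fderiv_eq]

theorem pd_add_right (f : (Fin n → ℂ) → ℂ) (v : Fin n → ℂ) (a : Fin n) (y : Fin n → ℂ) :
    pd (fun z => f (z + v)) a y = pd f a (y + v) := by
  unfold pd; rw [fderiv_comp_add_right]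

theorem fderiv_eq_sum_pd (f : (Fin n → ℂ) → ℂ) (y v : Fin n → ℂ) :
    fderiv ℂ f y v = ∑ r, pd f r y * v r := by
  have hv : v = ∑ i, v i • (Pi.single i 1 : Fin n → ℂ) := by
    ext j; simp [Pi.single_apply]
  conv_lhs => rw [hv, map_sum]
  exact Finset.sum_congr rfl fun r _ => by rw [map_smul, smul_eq_mul, mul_comm, pd]

theorem pd_comp {m : ℕ} {f : (Fin m → ℂ) → ℂ} {F : (Fin n → ℂ) → (Fin m → ℂ)} {x : Fin n → ℂ}
    (hf : DifferentiableAt ℂ f (F x)) (hF : DifferentiableAt ℂ F x) (a : Fin n) :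
    pd (fun z => f (F z)) a x = ∑ r, pd f r (F x) * pd (fun z => F z r) a x := by
  have h1 : fderiv ℂ (fun z => f (F z)) x = (fderiv ℂ f (F x)).comp (fderiv ℂ F x) :=
    fderiv_comp x hf hF
  have h2 : ∀ r, pd (fun z => F z r) a x = fderiv ℂ F x (Pi.single a 1) r := by
    intro r
    unfold pd
    rw [show fderiv ℂ (fun z => F z r) x = (ContinuousLinearMap.proj r).comp (fderiv ℂ F x) from
      ((ContinuousLinearMap.proj (R := ℂ) (φ := fun _ : Fin m => ℂ) r).hasFDerivAt.comp x
        hF.hasFDerivAt).fderiv]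
    rfl
  simp only [h2]
  rw [← fderiv_eq_sum_pd, pd, h1]; rfl

theorem contDiffAt_pd {f : (Fin n → ℂ) → ℂ} {y : Fin n → ℂ} (hf : ContDiffAt ℂ ∞ f y)
    (a : Fin n) : ContDiffAt ℂ ∞ (pd f a) y :=
  (hf.fderiv_right (m := ∞) (by simp)).clm_apply contDiffAt_const

theorem pd_comm {f : (Fin n → ℂ) → ℂ} {y : Fin n → ℂ} (hf : ContDiffAt ℂ ∞ f y) (a b : Fin n) :
    pd (pd f a) b y = pd (pd f b) a y := by
  have hs : IsSymmSndFDerivAt ℂ f y := hf.isSymmSndFDerivAt (by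
    rw [minSmoothness_of_isRCLikeNormedField]; exact WithTop.coe_le_coe.mpr le_top)
  have hd : DifferentiableAt ℂ (fderiv ℂ f) y :=
    (hf.fderiv_right (m := ∞) (by simp)).differentiableAt (by simp)
  have key : ∀ a b, pd (pd f a) b y = fderiv ℂ (fderiv ℂ f) y (Pi.single b 1) (Pi.single a 1) := by
    intro a b
    show fderiv ℂ (fun z => fderiv ℂ f z (Pi.single a 1)) y (Pi.single b 1) = _
    rw [fderiv_clm_apply hd (differentiableAt_const _)]
    simp
  rw [key, key]; exact hs.eq _ _

/-! ### Matrix-valued functions -/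

/-- The entrywise partial derivative of a matrix-valued function. -/
def mpd {p q : Type*} (A : (Fin n → ℂ) → Matrix p q ℂ) (a : Fin n) (y : Fin n → ℂ) : Matrix p q ℂ :=
  Matrix.of fun i j => pd (fun z => A z i j) a y

/-- All entries are smooth at the point `y`. -/
def SmoothAt {p q : Type*} (A : (Fin n → ℂ) → Matrix p q ℂ) (y : Fin n → ℂ) : Prop :=
  ∀ i j, ContDiffAt ℂ ∞ (fun z => A z i j) y

section
variable {p q r : Type*}

theorem SmoothAt.diff {A : (Fin n → ℂ) → Matrix p q ℂ} {y : Fin n → ℂ} (h : SmoothAt A y) (i j) :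
    DifferentiableAt ℂ (fun z => A z i j) y := (h i j).differentiableAt (by simp)

theorem smoothAt_const (A : Matrix p q ℂ) (y : Fin n → ℂ) : SmoothAt (fun _ => A) y :=
  fun _ _ => contDiffAt_const

theorem SmoothAt.transpose {A : (Fin n → ℂ) → Matrix p q ℂ} {y : Fin n → ℂ} (h : SmoothAt A y) :
    SmoothAt (fun z => (A z)ᵀ) y := fun i j => h j i

theorem SmoothAt.mul [Fintype q] {A : (Fin n → ℂ) → Matrix p q ℂ} {B : (Fin n → ℂ) → Matrix q r ℂ}
    {y : Fin n → ℂ} (hA : SmoothAt A y) (hB : SmoothAt B y) : SmoothAt (fun z => A z * B z) y := by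
  intro i j
  simp only [Matrix.mul_apply]
  exact ContDiffAt.sum fun s _ => (hA i s).mul (hB s j)

theorem SmoothAt.add {A B : (Fin n → ℂ) → Matrix p q ℂ} {y : Fin n → ℂ} (hA : SmoothAt A y)
    (hB : SmoothAt B y) : SmoothAt (fun z => A z + B z) y := fun i j => (hA i j).add (hB i j)

theorem SmoothAt.sub {A B : (Fin n → ℂ) → Matrix p q ℂ} {y : Fin n → ℂ} (hA : SmoothAt A y)
    (hB : SmoothAt B y) : SmoothAt (fun z => A z - B z) y := fun i j => (hA i j).sub (hB i j)

theorem SmoothAt.smul {f : (Fin n → ℂ) → ℂ} {B : (Fin n → ℂ) → Matrix p q ℂ} {y : Fin n → ℂ}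
    (hA : ContDiffAt ℂ ∞ f y) (hB : SmoothAt B y) : SmoothAt (fun z => f z • B z) y :=
  fun i j => hA.mul (hB i j)

theorem SmoothAt.sum {ι : Type*} (s : Finset ι) {A : ι → (Fin n → ℂ) → Matrix p q ℂ}
    {y : Fin n → ℂ} (hA : ∀ i, SmoothAt (A i) y) : SmoothAt (fun z => ∑ i ∈ s, A i z) y := by
  intro i j
  simp only [Matrix.sum_apply]
  exact ContDiffAt.sum fun s _ => hA s i j

theorem SmoothAt.mpd {A : (Fin n → ℂ) → Matrix p q ℂ} {y : Fin n → ℂ} (h : SmoothAt A y)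
    (a : Fin n) : SmoothAt (mpd A a) y := fun i j => contDiffAt_pd (h i j) a

theorem SmoothAt.comp {m : ℕ} {A : (Fin m → ℂ) → Matrix p q ℂ} {F : (Fin n → ℂ) → (Fin m → ℂ)}
    {x : Fin n → ℂ} (h : SmoothAt A (F x)) (hF : ContDiffAt ℂ ∞ F x) :
    SmoothAt (fun z => A (F z)) x := fun i j => (h i j).comp x hF

theorem SmoothAt.det [Fintype p] [DecidableEq p] {A : (Fin n → ℂ) → Matrix p p ℂ} {y : Fin n → ℂ}
    (h : SmoothAt A y) : ContDiffAt ℂ ∞ (fun z => (A z).det) y := by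
  simp only [Matrix.det_apply']
  exact ContDiffAt.sum fun σ _ => contDiffAt_const.mul (contDiffAt_prod fun i _ => h _ _)

theorem SmoothAt.inv [Fintype p] [DecidableEq p] {A : (Fin n → ℂ) → Matrix p p ℂ} {y : Fin n → ℂ}
    (h : SmoothAt A y) (hd : (A y).det ≠ 0) : SmoothAt (fun z => (A z)⁻¹) y := by
  intro i j
  simp only [Matrix.inv_def, Ring.inverse_eq_inv', Matrix.smul_apply, smul_eq_mul,
    Matrix.adjugate_apply]
  refine (h.det.inv hd).mul (SmoothAt.det fun a b => ?_)
  by_cases haj : a = j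
  · subst haj; simpa using contDiffAt_const
  · simpa [Matrix.updateRow_ne haj] using h a b

theorem mpd_transpose (A : (Fin n → ℂ) → Matrix p q ℂ) (a : Fin n) (y : Fin n → ℂ) :
    mpd (fun z => (A z)ᵀ) a y = (mpd A a y)ᵀ := rfl

theorem mpd_mul [Fintype q] {A : (Fin n → ℂ) → Matrix p q ℂ} {B : (Fin n → ℂ) → Matrix q r ℂ}
    {y : Fin n → ℂ} (hA : SmoothAt A y) (hB : SmoothAt B y) (a : Fin n) :
    mpd (fun z => A z * B z) a y = mpd A a y * B y + A y * mpd B a y := by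
  ext i j
  simp only [mpd, Matrix.of_apply, Matrix.mul_apply, Matrix.add_apply]
  rw [pd_sum (f := fun s z => A z i s * B z s j) _ fun s _ => (hA.diff i s).fun_mul (hB.diff s j),
    ← Finset.sum_add_distrib]
  exact Finset.sum_congr rfl fun s _ => pd_mul (hA.diff i s) (hB.diff s j) a

theorem mpd_const (A : Matrix p q ℂ) (a : Fin n) (y : Fin n → ℂ) : mpd (fun _ => A) a y = 0 := by
  ext i j; simp [mpd, pd_const]

theorem mpd_add {A B : (Fin n → ℂ) → Matrix p q ℂ} {y : Fin n → ℂ} (hA : SmoothAt A y)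
    (hB : SmoothAt B y) (a : Fin n) : mpd (fun z => A z + B z) a y = mpd A a y + mpd B a y := by
  ext i j; exact pd_add (hA.diff i j) (hB.diff i j) a

theorem mpd_const_smul {A : (Fin n → ℂ) → Matrix p q ℂ} {y : Fin n → ℂ} (hA : SmoothAt A y) (c : ℂ)
    (a : Fin n) : mpd (fun z => c • A z) a y = c • mpd A a y := by
  ext i j; exact pd_const_mul (hA.diff i j) c a

theorem mpd_smul {f : (Fin n → ℂ) → ℂ} {A : (Fin n → ℂ) → Matrix p q ℂ} {y : Fin n → ℂ}
    (hf : ContDiffAt ℂ ∞ f y) (hA : SmoothAt A y) (a : Fin n) :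
    mpd (fun z => f z • A z) a y = pd f a y • A y + f y • mpd A a y := by
  ext i j; exact pd_mul (hf.differentiableAt (by simp)) (hA.diff i j) a

theorem mpd_sum {ι : Type*} (s : Finset ι) {A : ι → (Fin n → ℂ) → Matrix p q ℂ}
    {y : Fin n → ℂ} (hA : ∀ i, SmoothAt (A i) y) (a : Fin n) :
    mpd (fun z => ∑ i ∈ s, A i z) a y = ∑ i ∈ s, mpd (A i) a y := by
  ext i j
  simp only [mpd, Matrix.of_apply, Matrix.sum_apply]
  exact pd_sum s (fun t _ => (hA t).diff i j) a

theorem mpd_congr {A B : (Fin n → ℂ) → Matrix p q ℂ} {y : Fin n → ℂ} (h : A =ᶠ[𝓝 y] B)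
    (a : Fin n) : mpd A a y = mpd B a y := by
  ext i j; exact pd_congr (h.mono fun z hz => by simp only [hz]) a

theorem mpd_add_right (A : (Fin n → ℂ) → Matrix p q ℂ) (v : Fin n → ℂ) (a : Fin n)
    (y : Fin n → ℂ) : mpd (fun z => A (z + v)) a y = mpd A a (y + v) := by
  ext i j; exact pd_add_right (fun z => A z i j) v a y

theorem mpd_comp {A : (Fin n → ℂ) → Matrix p q ℂ} {F : (Fin n → ℂ) → (Fin n → ℂ)}
    {x : Fin n → ℂ} (hA : SmoothAt A (F x)) (hF : DifferentiableAt ℂ F x) (a : Fin n) :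
    mpd (fun z => A (F z)) a x = ∑ r, jacobian F x r a • mpd A r (F x) := by
  ext i j
  simp only [mpd, Matrix.of_apply, Matrix.sum_apply, Matrix.smul_apply, smul_eq_mul, jacobian]
  rw [pd_comp (f := fun z => A z i j) (hA.diff i j) hF]
  exact Finset.sum_congr rfl fun s _ => mul_comm _ _

theorem eventually_det_ne_zero [Fintype p] [DecidableEq p] {A : (Fin n → ℂ) → Matrix p p ℂ}
    {y : Fin n → ℂ} (h : SmoothAt A y) (hd : (A y).det ≠ 0) : ∀ᶠ z in 𝓝 y, (A z).det ≠ 0 :=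
  h.det.continuousAt.eventually_ne hd

theorem mpd_inv [Fintype p] [DecidableEq p] {A : (Fin n → ℂ) → Matrix p p ℂ} {y : Fin n → ℂ}
    (h : SmoothAt A y) (hd : (A y).det ≠ 0) (a : Fin n) :
    mpd (fun z => (A z)⁻¹) a y = -((A y)⁻¹ * mpd A a y * (A y)⁻¹) := by
  -- The inverse takes the value `0` where the determinant vanishes, so `A A⁻¹ = 1` is available
  -- only near `y`; this is enough for the derivative.
  have h1 : mpd (fun z => A z * (A z)⁻¹) a y = 0 := by
    rw [mpd_congr (B := fun _ => 1), mpd_const]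
    filter_upwards [eventually_det_ne_zero h hd] with z hz
    exact Matrix.mul_nonsing_inv _ (isUnit_iff_ne_zero.mpr hz)
  rw [mpd_mul h (h.inv hd)] at h1
  have hu := isUnit_iff_ne_zero.mpr hd
  have h2 : A y * mpd (fun z => (A z)⁻¹) a y = -(mpd A a y * (A y)⁻¹) :=
    eq_neg_of_add_eq_zero_right h1
  calc mpd (fun z => (A z)⁻¹) a y = (A y)⁻¹ * (A y * mpd (fun z => (A z)⁻¹) a y) := by
        rw [← Matrix.mul_assoc, Matrix.nonsing_inv_mul _ hu, Matrix.one_mul]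
    _ = _ := by rw [h2, Matrix.mul_neg, Matrix.mul_assoc]

end

theorem smoothAt_jacobian {F : (Fin n → ℂ) → (Fin n → ℂ)} (hF : ContDiff ℂ ∞ F) (x : Fin n → ℂ) :
    SmoothAt (jacobian F) x := fun i a =>
  contDiffAt_pd (f := fun z => F z i) ((contDiff_pi.mp hF i).contDiffAt) a

theorem jacobian_comp {F G : (Fin n → ℂ) → (Fin n → ℂ)} {x : Fin n → ℂ}
    (hG : DifferentiableAt ℂ G (F x)) (hF : DifferentiableAt ℂ F x) :
    jacobian (fun z => G (F z)) x = jacobian G (F x) * jacobian F x := by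
  ext i a
  exact pd_comp (f := fun z => G z i) (differentiableAt_pi.mp hG i) hF a

end FlatPencil

end

/-! ### A matrix form of the flat Levi-Civita equations, and pencils obtained by translation. -/

noncomputable section

open Polynomial
open scoped ContDiff Topology Matrix

namespace FlatPencil

variable {n : ℕ}

/-! ### Contravariant Levi-Civita connections -/

/-- The matrices `Γ_r = (Γ^{ij}_r)` satisfy at `y` the equations characterizing the contravariant
Levi-Civita components of `g`, and the curvature of this connection vanishes at `y`. -/
structure FlatAt (g : (Fin n → ℂ) → Matrix (Fin n) (Fin n) ℂ)
    (Γ : (Fin n → ℂ) → Fin n → Matrix (Fin n) (Fin n) ℂ) (y : Fin n → ℂ) : Prop where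
  symm : (g y).IsSymm
  deriv : ∀ r, mpd g r y = Γ y r + (Γ y r)ᵀ
  torsion : ∀ i j p, ∑ s, g y i s * Γ y s j p = ∑ s, g y j s * Γ y s i p
  flat : ∀ a b, mpd (fun z => Γ z b) a y - mpd (fun z => Γ z a) b y =
    (Γ y a)ᵀ * (g y)⁻¹ * Γ y b - (Γ y b)ᵀ * (g y)⁻¹ * Γ y a

section
variable {g : (Fin n → ℂ) → Matrix (Fin n) (Fin n) ℂ}
  {Γ : (Fin n → ℂ) → Fin n → Matrix (Fin n) (Fin n) ℂ} {y : Fin n → ℂ}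

theorem FlatAt.inv_symm (h : FlatAt g Γ y) : ((g y)⁻¹)ᵀ = (g y)⁻¹ := by
  rw [Matrix.transpose_nonsing_inv, h.symm.eq]

/-- For fixed `i` let `T` be the matrix with entries `Γ^{ti}_a`. The torsion equation says that `T
g` is symmetric, hence so is `g⁻¹ T = g⁻¹ (T g) g⁻¹`. This is the symmetry of the Christoffel
symbols in their lower indices. -/
theorem FlatAt.inv_mul_symm (h : FlatAt g Γ y) (hd : (g y).det ≠ 0) (a b i : Fin n) :
    ((g y)⁻¹ * Γ y a) b i = ((g y)⁻¹ * Γ y b) a i := by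
  have hu := isUnit_iff_ne_zero.mpr hd
  set T : Matrix (Fin n) (Fin n) ℂ := Matrix.of fun t a => Γ y a t i with hT
  have h1 : T * g y = g y * Tᵀ := by
    ext p q
    have := h.torsion q p i
    simp only [Matrix.mul_apply, Matrix.transpose_apply, hT, Matrix.of_apply]
    rw [← this]
    refine Finset.sum_congr rfl fun s _ => ?_
    rw [← h.symm.apply q s, mul_comm]
  have h2 : (g y)⁻¹ * T = ((g y)⁻¹ * T)ᵀ := by
    rw [Matrix.transpose_mul, h.inv_symm]
    calc (g y)⁻¹ * T = (g y)⁻¹ * (T * g y) * (g y)⁻¹ := by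
          rw [Matrix.mul_assoc, Matrix.mul_assoc T, Matrix.mul_nonsing_inv _ hu, Matrix.mul_one]
      _ = _ := by rw [h1, ← Matrix.mul_assoc, Matrix.nonsing_inv_mul _ hu, Matrix.one_mul]
  have := congrFun (congrFun h2 b) a
  simpa [Matrix.mul_apply, hT] using this

/-- With `L_a = g⁻¹ Γ_a g⁻¹` the derivative of the covariant metric is `-(L_a + L_aᵀ)`, and `L_a` is
symmetric under exchanging `a` with its first index. In the Koszul combination four of the six terms
cancel and the other two agree. -/
theorem FlatAt.christoffel_eq (hg : SmoothAt g y) (h : FlatAt g Γ y) (hd : (g y).det ≠ 0)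
    (i a b : Fin n) : christoffel g y i a b = -((g y)⁻¹ * Γ y b) a i := by
  have hu := isUnit_iff_ne_zero.mpr hd
  set L : Fin n → Matrix (Fin n) (Fin n) ℂ := fun a => (g y)⁻¹ * Γ y a * (g y)⁻¹ with hL
  have hsym : ∀ a s b, L a s b = L s a b := by
    intro a s b
    simp only [hL, Matrix.mul_apply (N := (g y)⁻¹)]
    exact Finset.sum_congr rfl fun t _ => by rw [h.inv_mul_symm hd]
  have hpd : ∀ a s b, pd (fun z => (g z)⁻¹ s b) a y = -(L a s b + L a b s) := by
    intro a s b
    have h1 := congrFun (congrFun (mpd_inv hg hd a) s) b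
    rw [h.deriv, Matrix.mul_add, Matrix.add_mul] at h1
    have h2 : (g y)⁻¹ * (Γ y a)ᵀ * (g y)⁻¹ = (L a)ᵀ := by
      simp only [hL, Matrix.transpose_mul, h.inv_symm, Matrix.mul_assoc]
    rw [h2] at h1
    exact h1
  unfold christoffel
  simp only [hpd]
  have h3 : ∀ s, g y i s * (-(L a s b + L a b s) + -(L b a s + L b s a) - -(L s a b + L s b a)) =
      -2 * (L b a s * g y s i) := by
    intro s
    rw [hsym s a b, hsym s b a, hsym a b s, ← h.symm.apply i s]; ring
  rw [Finset.sum_congr rfl fun s _ => h3 s, ← Finset.mul_sum, ← Matrix.mul_apply, hL]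
  simp only [Matrix.mul_assoc, Matrix.nonsing_inv_mul _ hu, Matrix.mul_one]
  ring

theorem FlatAt.contraChristoffel_eq (hg : SmoothAt g y) (h : FlatAt g Γ y) (hd : (g y).det ≠ 0)
    (i j r : Fin n) : contraChristoffel g y i j r = Γ y r i j := by
  have hu := isUnit_iff_ne_zero.mpr hd
  unfold contraChristoffel
  simp only [h.christoffel_eq hg hd, mul_neg, Finset.sum_neg_distrib, neg_neg]
  rw [← Matrix.mul_apply, Matrix.mul_nonsing_inv_cancel_left _ _ hu]

/-- Near `y` the Christoffel symbols are the entries of `-g⁻¹ Γ_b`. Differentiating this product and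
inserting `∂g = Γ + Γᵀ` turns the curvature into `g⁻¹` times the difference of the two sides of the
field `flat`. -/
theorem curvature_eq_zero (hg : SmoothAt g y) (hΓ : ∀ r, SmoothAt (fun z => Γ z r) y)
    (hgs : ∀ᶠ z in 𝓝 y, SmoothAt g z) (h : ∀ᶠ z in 𝓝 y, FlatAt g Γ z) (hd : (g y).det ≠ 0)
    (i j a b : Fin n) : curvature g y i j a b = 0 := by
  have hy := h.self_of_nhds
  have hchr : ∀ i a b, (fun z => christoffel g z i b a) =ᶠ[𝓝 y]
      fun z => (-((g z)⁻¹ * Γ z b)) a i := by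
    intro i a b
    filter_upwards [h, hgs, eventually_det_ne_zero hg hd] with z h1 h2 h3
    rw [h1.christoffel_eq h2 h3, h1.inv_mul_symm h3]; rfl
  have hN : ∀ a b, mpd (fun z => -((g z)⁻¹ * Γ z b)) a y =
      (g y)⁻¹ * (Γ y a + (Γ y a)ᵀ) * (g y)⁻¹ * Γ y b - (g y)⁻¹ * mpd (fun z => Γ z b) a y := by
    intro a b
    have hs : SmoothAt (fun z => (g z)⁻¹ * Γ z b) y := (hg.inv hd).mul (hΓ b)
    have h1 := mpd_const_smul hs (-1) a
    simp only [neg_one_smul] at h1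
    rw [h1, mpd_mul (hg.inv hd) (hΓ b), mpd_inv hg hd, hy.deriv, Matrix.neg_mul, neg_add, neg_neg,
      sub_eq_add_neg]
  have hc : ∀ i a b, christoffel g y i a b = (-((g y)⁻¹ * Γ y a)) b i := by
    intro i a b
    rw [hy.christoffel_eq hg hd, hy.inv_mul_symm hd]; rfl
  have e1 : pd (fun z => christoffel g z i b j) a y =
      mpd (fun z => -((g z)⁻¹ * Γ z b)) a y j i := pd_congr (hchr i j b) a
  have e2 : pd (fun z => christoffel g z i a j) b y =
      mpd (fun z => -((g z)⁻¹ * Γ z a)) b y j i := pd_congr (hchr i j a) b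
  have e3 : ∀ a b : Fin n, ∑ p, christoffel g y i a p * christoffel g y p b j =
      ((g y)⁻¹ * Γ y b * ((g y)⁻¹ * Γ y a)) j i := by
    intro a b
    simp only [hc, Matrix.mul_apply (M := (g y)⁻¹ * Γ y b), Matrix.neg_apply, neg_mul_neg]
    exact Finset.sum_congr rfl fun p _ => mul_comm _ _
  unfold curvature
  rw [Finset.sum_sub_distrib, e1, e2, e3, e3, ← Matrix.sub_apply, ← Matrix.sub_apply,
    ← Matrix.add_apply, hN, hN]
  have key : (g y)⁻¹ * (mpd (fun z => Γ z b) a y - mpd (fun z => Γ z a) b y) =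
    (g y)⁻¹ * ((Γ y a)ᵀ * (g y)⁻¹ * Γ y b - (Γ y b)ᵀ * (g y)⁻¹ * Γ y a) := by rw [hy.flat]
  rw [show (g y)⁻¹ * (Γ y a + (Γ y a)ᵀ) * (g y)⁻¹ * Γ y b - (g y)⁻¹ * mpd (fun z => Γ z b) a y -
      ((g y)⁻¹ * (Γ y b + (Γ y b)ᵀ) * (g y)⁻¹ * Γ y a - (g y)⁻¹ * mpd (fun z => Γ z a) b y) +
      ((g y)⁻¹ * Γ y b * ((g y)⁻¹ * Γ y a) - (g y)⁻¹ * Γ y a * ((g y)⁻¹ * Γ y b)) = 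
      (g y)⁻¹ * ((Γ y a)ᵀ * (g y)⁻¹ * Γ y b - (Γ y b)ᵀ * (g y)⁻¹ * Γ y a) -
      (g y)⁻¹ * (mpd (fun z => Γ z b) a y - mpd (fun z => Γ z a) b y) by noncomm_ring, key, sub_self]
  rfl

theorem FlatAt.add_right {v : Fin n → ℂ} (h : FlatAt g Γ (y + v)) :
    FlatAt (fun z => g (z + v)) (fun z => Γ (z + v)) y where
  symm := h.symm
  deriv r := by rw [mpd_add_right, h.deriv]
  torsion := h.torsion
  flat a b := by
    rw [mpd_add_right (fun z => Γ z b), mpd_add_right (fun z => Γ z a), h.flat]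

theorem FlatAt.smul (hg : SmoothAt g y) (hΓ : ∀ r, SmoothAt (fun z => Γ z r) y)
    (h : FlatAt g Γ y) {c : ℂ} (hc : c ≠ 0) :
    FlatAt (fun z => c • g z) (fun z => c • Γ z) y where
  symm := by rw [Matrix.IsSymm, Matrix.transpose_smul, h.symm.eq]
  deriv r := by rw [mpd_const_smul hg, h.deriv, smul_add]; rfl
  torsion i j p := by
    have h2 : ∀ i j, ∑ s, (c • g y) i s * (c • Γ y) s j p = c * c * ∑ s, g y i s * Γ y s j p := by
      intro i j
      rw [Finset.mul_sum]
      exact Finset.sum_congr rfl fun s _ => by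
        simp only [Matrix.smul_apply, Pi.smul_apply, smul_eq_mul]; ring
    rw [h2, h2, h.torsion]
  flat a b := by
    have h1 : (c • g y)⁻¹ = c⁻¹ • (g y)⁻¹ := by
      -- `FlatAt` does not include nondegeneracy, so the scaling of the inverse is also needed when
      -- `det g = 0`, where both inverses are `0` by convention.
      rcases eq_or_ne (g y).det 0 with h0 | h0
      · rw [Matrix.nonsing_inv_apply_not_isUnit _ (by simp [h0]),
          Matrix.nonsing_inv_apply_not_isUnit _ (by simp [h0]), smul_zero]
      · let _ := invertibleOfNonzero hc
        rw [Matrix.inv_smul _ _ (isUnit_iff_ne_zero.mpr h0), invOf_eq_inv]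
    have h2 := mpd_const_smul (hΓ b) c a
    have h3 := mpd_const_smul (hΓ a) c b
    simp only [Pi.smul_apply]
    rw [h2, h3, ← smul_sub, h.flat, h1]
    simp only [Matrix.transpose_smul, Matrix.smul_mul, Matrix.mul_smul, smul_smul, smul_sub]
    congr 2 <;> field_simp

end

/-! ### Flat pencils from translations -/

/-- The determinant is a polynomial in `t` whose coefficient of degree `n` is `det B`, so it has
finitely many roots. -/
theorem eventually_det_add_smul_ne_zero (A B : Matrix (Fin n) (Fin n) ℂ) (hB : B.det ≠ 0) :
    ∀ᶠ t in 𝓝[≠] (0 : ℂ), (A + t • B).det ≠ 0 := by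
  set p : ℂ[X] := ((X : ℂ[X]) • B.map C + A.map C).det with hp
  have hp0 : p ≠ 0 := by
    intro h
    have := Polynomial.coeff_det_X_add_C_card B A
    rw [← hp, h, coeff_zero] at this
    exact hB this.symm
  have hev : ∀ t, p.eval t = (A + t • B).det := by
    intro t
    rw [hp, ← Polynomial.coe_evalRingHom, RingHom.map_det]
    congr 1
    ext i j
    simp [add_comm]
    ring
  have hfin : ((p.roots.toFinset : Set ℂ) \ {0}).Finite := (Finset.finite_toSet _).subset
    Set.sdiff_subset
  have hmem : ((p.roots.toFinset : Set ℂ) \ {0})ᶜ ∈ 𝓝 (0 : ℂ) :=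
    hfin.isClosed.isOpen_compl.mem_nhds (by simp)
  filter_upwards [nhdsWithin_le_nhds hmem, self_mem_nhdsWithin] with t ht h0
  rw [← hev]
  intro h
  exact ht ⟨by simp [hp0, h], h0⟩

section
variable {g η : (Fin n → ℂ) → Matrix (Fin n) (Fin n) ℂ}
  {Γ γ : (Fin n → ℂ) → Fin n → Matrix (Fin n) (Fin n) ℂ} {e : Fin n → ℂ}

/-- Both sides of each of the four equations are continuous in `ε` at `0`; for the curvature
equation this uses that the inverse is continuous at the nondegenerate matrix `η y`. An identity on
a punctured neighbourhood therefore extends to `ε = 0`. -/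
theorem FlatAt.of_limit {y : Fin n → ℂ} (hg : SmoothAt g y) (hη : SmoothAt η y)
    (hΓ : ∀ r, SmoothAt (fun z => Γ z r) y) (hγ : ∀ r, SmoothAt (fun z => γ z r) y)
    (hd : (η y).det ≠ 0)
    (h : ∀ᶠ ε in 𝓝[≠] (0 : ℂ), FlatAt (fun z => η z + ε • g z) (fun z => γ z + ε • Γ z) y) :
    FlatAt η γ y := by
  have lim : ∀ {f k : ℂ → ℂ}, ContinuousAt f 0 → ContinuousAt k 0 →
      (∀ᶠ ε in 𝓝[≠] (0 : ℂ), f ε = k ε) → f 0 = k 0 := by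
    intro f k hf hk he
    exact ((hf.eventuallyEq_nhds_iff_eventuallyEq_nhdsNE hk).mp he).self_of_nhds
  have hdc : ContinuousAt (fun ε : ℂ => (η y + ε • g y)) 0 := by fun_prop
  have hinv : ∀ i j, ContinuousAt (fun ε : ℂ => (η y + ε • g y)⁻¹ i j) 0 := by
    intro i j
    simp only [Matrix.inv_def, Ring.inverse_eq_inv', Matrix.smul_apply, smul_eq_mul]
    refine ContinuousAt.mul (ContinuousAt.inv₀ ?_ (by simpa using hd)) ?_
    · exact Continuous.continuousAt (by fun_prop)
    · exact Continuous.continuousAt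
        (((Continuous.matrix_adjugate (by fun_prop))).matrix_elem i j)
  have hsg : ∀ ε : ℂ, ∀ r, mpd (fun z => η z + ε • g z) r y = mpd η r y + ε • mpd g r y := by
    intro ε r
    rw [mpd_add hη (SmoothAt.smul contDiffAt_const hg), mpd_const_smul hg]
  have hsΓ : ∀ ε : ℂ, ∀ b r, mpd (fun z => (γ z + ε • Γ z) b) r y =
      mpd (fun z => γ z b) r y + ε • mpd (fun z => Γ z b) r y := by
    intro ε b r
    simp only [Pi.add_apply, Pi.smul_apply]
    rw [mpd_add (hγ b) (SmoothAt.smul contDiffAt_const (hΓ b)), mpd_const_smul (hΓ b)]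
  refine ⟨?_, ?_, ?_, ?_⟩
  · ext i j
    have := lim (f := fun ε => (η y + ε • g y)ᵀ i j) (k := fun ε => (η y + ε • g y) i j)
      (by simp only [Matrix.transpose_apply, Matrix.add_apply, Matrix.smul_apply]; fun_prop)
      (by simp only [Matrix.add_apply, Matrix.smul_apply]; fun_prop)
      (h.mono fun ε hε => congrFun (congrFun hε.symm i) j)
    simpa using this
  · intro r
    ext i j
    have := lim (f := fun ε => (mpd η r y + ε • mpd g r y) i j)
      (k := fun ε => ((γ y + ε • Γ y) r + ((γ y + ε • Γ y) r)ᵀ) i j)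
      (by simp only [Matrix.add_apply, Matrix.smul_apply]; fun_prop)
      (by simp only [Matrix.add_apply, Matrix.transpose_apply, Pi.add_apply, Pi.smul_apply,
            Matrix.smul_apply]; fun_prop)
      (h.mono fun ε hε => by simp only [← hsg]; exact congrFun (congrFun (hε.deriv r) i) j)
    simpa using this
  · intro i j p
    have := lim (f := fun ε => ∑ s, (η y + ε • g y) i s * (γ y + ε • Γ y) s j p)
      (k := fun ε => ∑ s, (η y + ε • g y) j s * (γ y + ε • Γ y) s i p)
      (by simp only [Matrix.add_apply, Pi.add_apply, Pi.smul_apply, Matrix.smul_apply]; fun_prop)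
      (by simp only [Matrix.add_apply, Pi.add_apply, Pi.smul_apply, Matrix.smul_apply]; fun_prop)
      (h.mono fun ε hε => hε.torsion i j p)
    simpa using this
  · intro a b
    ext i j
    have hk : ∀ a b : Fin n, ContinuousAt (fun ε : ℂ => (((γ y + ε • Γ y) a)ᵀ * (η y + ε • g y)⁻¹ *
        (γ y + ε • Γ y) b) i j) 0 := by
      intro a b
      simp only [Matrix.mul_apply, Matrix.transpose_apply, Pi.add_apply, Pi.smul_apply,
        Matrix.add_apply, Matrix.smul_apply (β := ℂ)]
      exact tendsto_finsetSum _ fun s _ => ContinuousAt.mul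
        (tendsto_finsetSum _ fun t _ => ContinuousAt.mul (by fun_prop) (hinv t s)) (by fun_prop)
    have := lim (f := fun ε => (mpd (fun z => γ z b) a y + ε • mpd (fun z => Γ z b) a y -
        (mpd (fun z => γ z a) b y + ε • mpd (fun z => Γ z a) b y)) i j)
      (k := fun ε => (((γ y + ε • Γ y) a)ᵀ * (η y + ε • g y)⁻¹ * (γ y + ε • Γ y) b -
        ((γ y + ε • Γ y) b)ᵀ * (η y + ε • g y)⁻¹ * (γ y + ε • Γ y) a) i j)
      (by simp only [Matrix.sub_apply, Matrix.add_apply, Matrix.smul_apply]; fun_prop)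
      (by simp only [Matrix.sub_apply]; exact (hk a b).sub (hk b a))
      (h.mono fun ε hε => by simp only [← hsΓ]; exact congrFun (congrFun (hε.flat a b) i) j)
    simpa using this

/-- A flat metric `g` on `ℂⁿ` such that `g` and its contravariant Levi-Civita components are
polynomials of degree at most one along the constant vector field `e` forms a flat pencil with its
derivative along `e`. -/
theorem isFlatPencil_of_translation (hg : ∀ y, SmoothAt g y)
    (hΓ : ∀ y r, SmoothAt (fun z => Γ z r) y) (hsymm : ∀ y, (g y).IsSymm)
    (hflat : ∀ y, (g y).det ≠ 0 → FlatAt g Γ y)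
    (hη : ∀ y (t : ℂ), g (y + t • e) = g y + t • η y)
    (hγ : ∀ y (t : ℂ), Γ (y + t • e) = Γ y + t • γ y)
    (hne : ∃ y, (η y).det ≠ 0) :
    IsFlatPencil {y | (η y).det ≠ 0} g η := by
  -- As finite differences of `g` and `Γ` along `e`, the tensors `η` and `γ` inherit smoothness and
  -- symmetry.
  have hη1 : η = fun y => g (y + e) - g y := by
    ext1 y; have := hη y 1; simp only [one_smul] at this; rw [this]; abel
  have hγ1 : ∀ r, (fun y => γ y r) = fun y => Γ (y + e) r - Γ y r := by
    intro r; ext1 y; have := hγ y 1; simp only [one_smul] at this; rw [this]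
    simp
  have hηs : ∀ y, SmoothAt η y := by
    intro y; rw [hη1]
    exact ((hg (y + e)).comp (F := fun z => z + e) (contDiffAt_id.add contDiffAt_const)).sub (hg y)
  have hγs : ∀ y r, SmoothAt (fun z => γ z r) y := by
    intro y r; rw [hγ1]
    exact ((hΓ (y + e) r).comp (F := fun z => z + e)
      (contDiffAt_id.add contDiffAt_const)).sub (hΓ y r)
  have hpg : ∀ c : ℂ, (fun z => g z + c • η z) = fun z => g (z + c • e) := by
    intro c; ext1 z; rw [hη]
  have hpΓ : ∀ c : ℂ, (fun z => Γ z + c • γ z) = fun z => Γ (z + c • e) := by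
    intro c; ext1 z; rw [hγ]
  have hps : ∀ (c : ℂ) y, SmoothAt (fun z => g z + c • η z) y := fun c y =>
    (hg y).add (SmoothAt.smul contDiffAt_const (hηs y))
  have hpΓs : ∀ (c : ℂ) y r, SmoothAt (fun z => (Γ z + c • γ z) r) y := fun c y r =>
    (hΓ y r).add (SmoothAt.smul contDiffAt_const (hγs y r))
  have hpencil : ∀ (c : ℂ) y, (g y + c • η y).det ≠ 0 →
      FlatAt (fun z => g z + c • η z) (fun z => Γ z + c • γ z) y := by
    intro c y hd
    rw [← hη] at hd
    rw [hpg, hpΓ]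
    exact (hflat _ hd).add_right
  have hηflat : ∀ y, (η y).det ≠ 0 → FlatAt η γ y := by
    intro y hd
    refine FlatAt.of_limit (hg y) (hηs y) (hΓ y) (hγs y) hd ?_
    have hc : ContinuousAt (fun ε : ℂ => (η y + ε • g y).det) 0 :=
      Continuous.continuousAt (by fun_prop)
    have h1 : ∀ᶠ ε in 𝓝[≠] (0 : ℂ), (η y + ε • g y).det ≠ 0 :=
      (hc.eventually_ne (by simpa using hd)).filter_mono nhdsWithin_le_nhds
    filter_upwards [h1, self_mem_nhdsWithin] with ε hε h0
    have h0' : ε ≠ 0 := h0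
    -- For `ε ≠ 0` the perturbation of `η` is a multiple of a member of the pencil already known to
    -- be flat.
    have e1 : ∀ z, η z + ε • g z = ε • (g z + ε⁻¹ • η z) := by
      intro z; rw [smul_add, smul_smul, mul_inv_cancel₀ h0', one_smul, add_comm]
    have e2 : ∀ z, γ z + ε • Γ z = ε • (Γ z + ε⁻¹ • γ z) := by
      intro z; rw [smul_add, smul_smul, mul_inv_cancel₀ h0', one_smul, add_comm]
    simp only [e1, e2] at hε ⊢
    refine FlatAt.smul (hps _ y) (hpΓs _ y) (hpencil _ y fun h => hε ?_) h0'
    rw [Matrix.det_smul, h, mul_zero]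
  refine ⟨?_, hne, fun y _ => hsymm y, ?_, ?_, ?_, ?_, ?_, ?_, ?_, ?_⟩
  · rw [isOpen_iff_mem_nhds]
    exact fun y hy => eventually_det_ne_zero (hηs y) hy
  · intro y _
    rw [hη1]; exact (hsymm _).sub (hsymm _)
  · exact fun i j y _ => ((hg y).diff i j).differentiableWithinAt
  · exact fun i j y _ => ((hηs y).diff i j).differentiableWithinAt
  · intro c y hy
    have hlim : Filter.Tendsto (fun t : ℂ => y + t • e) (𝓝[≠] 0) (𝓝 y) := by
      have : ContinuousAt (fun t : ℂ => y + t • e) 0 := by fun_prop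
      simpa [ContinuousAt] using this.tendsto.mono_left nhdsWithin_le_nhds
    have hU : ∀ᶠ t in 𝓝[≠] (0 : ℂ), (η (y + t • e)).det ≠ 0 :=
      hlim.eventually (eventually_det_ne_zero (hηs y) hy)
    refine mem_closure_of_tendsto hlim (hU.and ?_)
    filter_upwards [eventually_det_add_smul_ne_zero (g y + c • η y) (η y) hy, hU] with t ht _
    -- Moving along `e` only changes the pencil parameter: `η` is constant in that direction. The
    -- determinant along the line is thus a nonzero polynomial in `t`, which gives nondegenerate
    -- points arbitrarily close to `y`.
    have h1 : ∀ s : ℂ, g (y + t • e) + s • η (y + t • e) = g y + (t + s) • η y := by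
      intro s
      rw [← hη, ← hη, add_assoc, ← add_smul]
    rw [h1, add_comm t, add_smul, ← add_assoc]
    exact ht
  · exact fun y hy => subset_closure ⟨hy, hy⟩
  · intro c y _ hd
    refine curvature_eq_zero (Γ := fun z => Γ z + c • γ z) (hps c y) (hpΓs c y)
      (Filter.Eventually.of_forall fun z => hps c z) ?_ hd
    filter_upwards [eventually_det_ne_zero (hps c y) hd] with z hz using hpencil c z hz
  · intro y hd _
    refine curvature_eq_zero (Γ := γ) (hηs y) (hγs y) (Filter.Eventually.of_forall hηs) ?_ hd
    filter_upwards [eventually_det_ne_zero (hηs y) hd] with z hz using hηflat z hz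
  · refine ⟨fun y i j r => Γ y r i j, fun y i j r => γ y r i j, ?_, ?_, ?_, ?_, ?_⟩
    · exact fun i j r y _ => ((hΓ y r).diff i j).differentiableWithinAt
    · exact fun i j r y _ => ((hγs y r).diff i j).differentiableWithinAt
    · exact fun y _ hd i j r => (hflat y hd).contraChristoffel_eq (hg y) hd i j r
    · exact fun y _ hd i j r => (hηflat y hd).contraChristoffel_eq (hηs y) hd i j r
    · intro c y _ hd i j r
      exact (hpencil c y hd).contraChristoffel_eq (hps c y) hd i j r

end

end FlatPencil

end

/-! ### Flat charts and the transformation laws of metric and connection. -/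

noncomputable section

open Polynomial
open scoped ContDiff Topology Matrix

namespace FlatPencil

variable {n : ℕ}

/-! ### Metrics with constant components in a chart -/

/-- The map `F` is a chart in which the metric `g` has the constant components `D` and the
connection with contravariant components `Γ` is trivial. -/
structure IsFlatChart (F : (Fin n → ℂ) → (Fin n → ℂ)) (D : Matrix (Fin n) (Fin n) ℂ)
    (g : (Fin n → ℂ) → Matrix (Fin n) (Fin n) ℂ)
    (Γ : (Fin n → ℂ) → Fin n → Matrix (Fin n) (Fin n) ℂ) : Prop where
  metric : ∀ x, g (F x) = jacobian F x * D * (jacobian F x)ᵀ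
  conn : ∀ x c, ∑ r, jacobian F x r c • Γ (F x) r =
    jacobian F x * D * (mpd (jacobian F) c x)ᵀ

/-- Tensorial identities in the target coordinates may be checked after contraction with the columns
of an invertible Jacobian. -/
theorem eq_of_sum_smul_eq {V : Type*} [AddCommGroup V] [Module ℂ V] {J : Matrix (Fin n) (Fin n) ℂ}
    (hJ : J.det ≠ 0) {A B : Fin n → V} (h : ∀ c, ∑ r, J r c • A r = ∑ r, J r c • B r) : A = B := by
  have hu := isUnit_iff_ne_zero.mpr hJ
  have key : ∀ (A : Fin n → V) s, ∑ c, J⁻¹ c s • ∑ r, J r c • A r = A s := by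
    intro A s
    simp only [Finset.smul_sum, smul_smul]
    rw [Finset.sum_comm]
    have : ∀ r, ∑ c, (J⁻¹ c s * J r c) • A r = (if r = s then (1 : ℂ) else 0) • A r := by
      intro r
      rw [← Finset.sum_smul]
      congr 1
      have h1 := congrFun (congrFun (Matrix.mul_nonsing_inv J hu) r) s
      rw [Matrix.mul_apply, Matrix.one_apply] at h1
      rw [← h1]
      exact Finset.sum_congr rfl fun c _ => mul_comm _ _
    simp [this]
  ext s
  rw [← key A s, ← key B s]
  simp only [h]

/-- Pulled back along `F`, the equations become identities between derivatives of `F`: the product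
rule for `J D Jᵀ`, symmetry of second derivatives for torsion, and symmetry of third derivatives for
the curvature. Nondegeneracy of `g` at `F x` makes both `J` and `D` invertible. -/
theorem IsFlatChart.flatAt {F : (Fin n → ℂ) → (Fin n → ℂ)} {D : Matrix (Fin n) (Fin n) ℂ}
    {g : (Fin n → ℂ) → Matrix (Fin n) (Fin n) ℂ}
    {Γ : (Fin n → ℂ) → Fin n → Matrix (Fin n) (Fin n) ℂ} (h : IsFlatChart F D g Γ)
    (hF : ContDiff ℂ ∞ F) (hD : D.IsSymm) (x : Fin n → ℂ) (hg : SmoothAt g (F x))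
    (hΓ : ∀ r, SmoothAt (fun z => Γ z r) (F x)) (hd : (g (F x)).det ≠ 0) : FlatAt g Γ (F x) := by
  have hFd : DifferentiableAt ℂ F x := hF.contDiffAt.differentiableAt (by simp)
  have hJs := smoothAt_jacobian hF
  have hJ : (jacobian F x).det ≠ 0 := by
    intro h0; rw [h.metric, Matrix.det_mul, Matrix.det_mul, h0] at hd; simp at hd
  have hDd : D.det ≠ 0 := by
    intro h0; rw [h.metric, Matrix.det_mul, Matrix.det_mul, h0] at hd; simp at hd
  set J := jacobian F x with hJdef
  have hJu := isUnit_iff_ne_zero.mpr hJ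
  have hDu := isUnit_iff_ne_zero.mpr hDd
  set H : Fin n → Matrix (Fin n) (Fin n) ℂ := fun c => mpd (jacobian F) c x with hH
  have hHsymm : ∀ c b p, H c p b = H b p c := fun c b p =>
    pd_comm (f := fun z => F z p) ((contDiff_pi.mp hF p).contDiffAt) b c
  have hH2 : ∀ c d, mpd (fun z => mpd (jacobian F) c z) d x =
      mpd (fun z => mpd (jacobian F) d z) c x := by
    intro c d; ext i j
    exact pd_comm (hJs x i j) c d
  have hgx : g (F x) = J * D * Jᵀ := h.metric x
  refine ⟨?_, ?_, ?_, ?_⟩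
  · rw [hgx, Matrix.IsSymm]
    simp only [Matrix.transpose_mul, Matrix.transpose_transpose, hD.eq, Matrix.mul_assoc]
  · intro r
    refine congrFun (eq_of_sum_smul_eq hJ (A := fun r => mpd g r (F x))
      (B := fun r => Γ (F x) r + (Γ (F x) r)ᵀ) fun c => ?_) r
    rw [← mpd_comp hg hFd]
    simp only [h.metric]
    rw [mpd_mul ((hJs x).mul (smoothAt_const _ _)) (hJs x).transpose,
      mpd_mul (hJs x) (smoothAt_const _ _), mpd_const, mpd_transpose]
    simp only [smul_add, Finset.sum_add_distrib, ← Matrix.transpose_smul, ← Matrix.transpose_sum]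
    rw [h.conn]
    simp only [Matrix.transpose_mul, Matrix.transpose_transpose, hD.eq, Matrix.mul_zero, add_zero,
      Matrix.mul_assoc]
    rw [add_comm]
  -- In flat coordinates both sides of the torsion equation are the Hessian of `F^p` contracted with
  -- two rows of `J D`.
  · have key : ∀ i j p, ∑ s, g (F x) i s * Γ (F x) s j p =
        ∑ a, ∑ b, (J * D) i a * (J * D) j b * H a p b := by
      intro i j p
      have h1 : ∀ s, g (F x) i s * Γ (F x) s j p =
          ∑ a, (J * D) i a * (J s a * Γ (F x) s j p) := by
        intro s
        rw [hgx, Matrix.mul_apply (N := Jᵀ), Finset.sum_mul]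
        exact Finset.sum_congr rfl fun a _ => by rw [Matrix.transpose_apply, mul_assoc]
      simp only [h1]
      rw [Finset.sum_comm]
      refine Finset.sum_congr rfl fun a _ => ?_
      rw [← Finset.mul_sum]
      have h2 := congrFun (congrFun (h.conn x a) j) p
      simp only [Matrix.sum_apply, Matrix.smul_apply, smul_eq_mul] at h2
      rw [h2, Matrix.mul_apply (N := (mpd (jacobian F) a x)ᵀ), Finset.mul_sum]
      exact Finset.sum_congr rfl fun b _ => by rw [Matrix.transpose_apply, mul_assoc]
    intro i j p
    rw [key, key, Finset.sum_comm]
    exact Finset.sum_congr rfl fun a _ => Finset.sum_congr rfl fun b _ => by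
      rw [hHsymm]; ring
  · have hinv : (g (F x))⁻¹ = (Jᵀ)⁻¹ * D⁻¹ * J⁻¹ := by
      rw [hgx, Matrix.mul_inv_rev, Matrix.mul_inv_rev, Matrix.mul_assoc]
    set A : Fin n → Fin n → Matrix (Fin n) (Fin n) ℂ := fun a b => mpd (fun z => Γ z b) a (F x)
      with hA
    -- This is the derivative in direction `d` of the defining relation of the connection. Under
    -- antisymmetrization in `c, d` the first term on the left and the third derivatives on the
    -- right drop out.
    have hder : ∀ c d, (∑ r, H d r c • Γ (F x) r) + ∑ r, J r c • ∑ s, J s d • A s r =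
        H d * D * (H c)ᵀ + J * D * (mpd (fun z => mpd (jacobian F) c z) d x)ᵀ := by
      intro c d
      have h1 : mpd (fun z => ∑ r, jacobian F z r c • Γ (F z) r) d x =
          mpd (fun z => jacobian F z * D * (mpd (jacobian F) c z)ᵀ) d x :=
        mpd_congr (Filter.Eventually.of_forall fun z => h.conn z c) d
      rw [mpd_mul ((hJs x).mul (smoothAt_const _ _)) ((hJs x).mpd c).transpose,
        mpd_mul (hJs x) (smoothAt_const _ _), mpd_const, Matrix.mul_zero, add_zero, mpd_sum (A :=
          fun r z => jacobian F z r c • Γ (F z) r) _ fun r => SmoothAt.smul (hJs x r c)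
            (SmoothAt.comp (A := fun z => Γ z r) (hΓ r) hF.contDiffAt)] at h1
      refine Eq.trans ?_ h1
      rw [← Finset.sum_add_distrib]
      refine Finset.sum_congr rfl fun r _ => ?_
      have h2 := mpd_smul (hJs x r c) (SmoothAt.comp (A := fun z => Γ z r) (hΓ r) hF.contDiffAt) d
      rw [mpd_comp (A := fun z => Γ z r) (hΓ r) hFd] at h2
      exact h2.symm
    have hquad : ∀ c d, (∑ r, J r d • Γ (F x) r)ᵀ * (g (F x))⁻¹ * (∑ r, J r c • Γ (F x) r) =
        H d * D * (H c)ᵀ := by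
      intro c d
      rw [h.conn, h.conn, hinv, Matrix.transpose_mul, Matrix.transpose_mul,
        Matrix.transpose_transpose, hD.eq]
      have hJtu : IsUnit (Jᵀ).det := by rwa [Matrix.det_transpose]
      calc H d * (D * Jᵀ) * ((Jᵀ)⁻¹ * D⁻¹ * J⁻¹) * (J * D * (H c)ᵀ)
          = H d * (D * (Jᵀ * (Jᵀ)⁻¹) * D⁻¹) * (J⁻¹ * J) * (D * (H c)ᵀ) := by
            simp only [Matrix.mul_assoc]
        _ = _ := by
            rw [Matrix.mul_nonsing_inv _ hJtu, Matrix.nonsing_inv_mul _ hJu, Matrix.mul_one,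
              Matrix.mul_one, Matrix.mul_nonsing_inv _ hDu, Matrix.mul_one, Matrix.mul_assoc]
    intro a b
    refine congrFun (eq_of_sum_smul_eq hJ (A := fun b => A a b - A b a) (B := fun b =>
      (Γ (F x) a)ᵀ * (g (F x))⁻¹ * Γ (F x) b - (Γ (F x) b)ᵀ * (g (F x))⁻¹ * Γ (F x) a)
      fun c => ?_) b
    refine congrFun (eq_of_sum_smul_eq hJ (A := fun a => ∑ r, J r c • (A a r - A r a)) (B := fun a =>
      ∑ r, J r c • ((Γ (F x) a)ᵀ * (g (F x))⁻¹ * Γ (F x) r -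
        (Γ (F x) r)ᵀ * (g (F x))⁻¹ * Γ (F x) a)) fun d => ?_) a
    have hL : ∀ c d, ∑ s, J s d • ∑ r, J r c • A s r = ∑ r, J r c • ∑ s, J s d • A s r := by
      intro c d
      simp only [Finset.smul_sum]
      rw [Finset.sum_comm]
      exact Finset.sum_congr rfl fun r _ => Finset.sum_congr rfl fun s _ => smul_comm _ _ _
    have hR : ∀ c d, ∑ s, J s d • ∑ r, J r c • ((Γ (F x) s)ᵀ * (g (F x))⁻¹ * Γ (F x) r) =
        H d * D * (H c)ᵀ := by
      intro c d
      rw [← hquad c d, Matrix.transpose_sum, Finset.sum_mul, Finset.sum_mul]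
      refine Finset.sum_congr rfl fun s _ => ?_
      rw [Finset.mul_sum, Finset.smul_sum]
      refine Finset.sum_congr rfl fun r _ => ?_
      simp only [Matrix.transpose_smul, Matrix.smul_mul, Matrix.mul_smul]
      exact smul_comm _ _ _
    have hR' : ∑ s, J s d • ∑ r, J r c • ((Γ (F x) r)ᵀ * (g (F x))⁻¹ * Γ (F x) s) =
        H c * D * (H d)ᵀ := by
      rw [← hR d c]
      simp only [Finset.smul_sum]
      rw [Finset.sum_comm]
      exact Finset.sum_congr rfl fun r _ => Finset.sum_congr rfl fun s _ => smul_comm _ _ _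
    simp only [smul_sub, Finset.sum_sub_distrib]
    rw [hR, hR', hL]
    have h1 := hder c d
    have h2 := hder d c
    rw [hH2 d c] at h2
    have h3 : ∑ r, H c r d • Γ (F x) r = ∑ r, H d r c • Γ (F x) r :=
      Finset.sum_congr rfl fun r _ => by rw [hHsymm]
    rw [h3] at h2
    have h4 : ∑ r, J r c • ∑ s, J s d • A s r - ∑ r, J r d • ∑ s, J s c • A s r =
        H d * D * (H c)ᵀ - H c * D * (H d)ᵀ := by
      rw [← add_sub_add_left_eq_sub (∑ r, J r c • ∑ s, J s d • A s r) _ (∑ r, H d r c • Γ (F x) r),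
        h1, h2, add_sub_add_right_eq_sub]
    exact h4

/-- The metric in the coordinates `y` of a metric `g` given in the coordinates `Θ(y)`. -/
def pullMetric (Θ : (Fin n → ℂ) → (Fin n → ℂ)) (g : (Fin n → ℂ) → Matrix (Fin n) (Fin n) ℂ)
    (y : Fin n → ℂ) : Matrix (Fin n) (Fin n) ℂ :=
  (jacobian Θ y)⁻¹ * g (Θ y) * ((jacobian Θ y)⁻¹)ᵀ

/-- The transformation law of the contravariant components of a connection. -/
def pullConn (Θ : (Fin n → ℂ) → (Fin n → ℂ)) (g : (Fin n → ℂ) → Matrix (Fin n) (Fin n) ℂ)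
    (Γ : (Fin n → ℂ) → Fin n → Matrix (Fin n) (Fin n) ℂ) (y : Fin n → ℂ) (r : Fin n) :
    Matrix (Fin n) (Fin n) ℂ :=
  (jacobian Θ y)⁻¹ * (∑ s, jacobian Θ y s r • Γ (Θ y) s) * ((jacobian Θ y)⁻¹)ᵀ -
    pullMetric Θ g y * (mpd (jacobian Θ) r y)ᵀ * ((jacobian Θ y)⁻¹)ᵀ

section
variable {Θ F : (Fin n → ℂ) → (Fin n → ℂ)} {D : Matrix (Fin n) (Fin n) ℂ}
  {g : (Fin n → ℂ) → Matrix (Fin n) (Fin n) ℂ}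
  {Γ : (Fin n → ℂ) → Fin n → Matrix (Fin n) (Fin n) ℂ}

theorem smoothAt_pullMetric (hΘ : ContDiff ℂ ∞ Θ) (hdet : ∀ y, (jacobian Θ y).det ≠ 0)
    (hg : ∀ y, SmoothAt g y) (y : Fin n → ℂ) : SmoothAt (pullMetric Θ g) y := by
  have hK := (smoothAt_jacobian hΘ y).inv (hdet y)
  exact (hK.mul ((hg _).comp hΘ.contDiffAt)).mul hK.transpose

theorem smoothAt_pullConn (hΘ : ContDiff ℂ ∞ Θ) (hdet : ∀ y, (jacobian Θ y).det ≠ 0)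
    (hg : ∀ y, SmoothAt g y) (hΓ : ∀ y r, SmoothAt (fun z => Γ z r) y) (y : Fin n → ℂ) (r : Fin n) :
    SmoothAt (fun z => pullConn Θ g Γ z r) y := by
  have hJ := smoothAt_jacobian hΘ y
  have hK := hJ.inv (hdet y)
  refine ((hK.mul (SmoothAt.sum _ fun s => SmoothAt.smul (hJ s r) ?_)).mul hK.transpose).sub
    (((smoothAt_pullMetric hΘ hdet hg y).mul (hJ.mpd r).transpose).mul hK.transpose)
  exact SmoothAt.comp (A := fun z => Γ z s) (hΓ _ s) hΘ.contDiffAt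

theorem isSymm_pullMetric (hg : ∀ y, (g y).IsSymm) (y : Fin n → ℂ) :
    (pullMetric Θ g y).IsSymm := by
  unfold pullMetric
  rw [Matrix.IsSymm]
  simp only [Matrix.transpose_mul, Matrix.transpose_transpose, (hg _).eq, Matrix.mul_assoc]

/-- By the chain rule the Hessian of `Θ ∘ F` has a part containing the Hessian of `Θ` and a part
containing that of `F`; the inhomogeneous term of `pullConn` removes exactly the first. -/
theorem IsFlatChart.pull (hΘ : ContDiff ℂ ∞ Θ) (hdet : ∀ y, (jacobian Θ y).det ≠ 0)
    (hF : ContDiff ℂ ∞ F) (h : IsFlatChart (fun x => Θ (F x)) D g Γ) :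
    IsFlatChart F D (pullMetric Θ g) (pullConn Θ g Γ) := by
  have hFd : ∀ x, DifferentiableAt ℂ F x := fun x => hF.contDiffAt.differentiableAt (by simp)
  have hΘd : ∀ x, DifferentiableAt ℂ Θ x := fun x => hΘ.contDiffAt.differentiableAt (by simp)
  have hchain : jacobian (fun x => Θ (F x)) = fun x => jacobian Θ (F x) * jacobian F x := by
    ext1 x; exact jacobian_comp (hΘd _) (hFd _)
  have hKJ : ∀ x, (jacobian Θ (F x))⁻¹ * jacobian Θ (F x) = 1 := fun x =>
    Matrix.nonsing_inv_mul _ (isUnit_iff_ne_zero.mpr (hdet _))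
  have hKJt : ∀ x, (jacobian Θ (F x))ᵀ * ((jacobian Θ (F x))⁻¹)ᵀ = 1 := fun x => by
    rw [← Matrix.transpose_mul, hKJ, Matrix.transpose_one]
  have hmetric : ∀ x, pullMetric Θ g (F x) = jacobian F x * D * (jacobian F x)ᵀ := by
    intro x
    unfold pullMetric
    rw [h.metric, hchain]
    simp only [Matrix.transpose_mul]
    calc _ = ((jacobian Θ (F x))⁻¹ * jacobian Θ (F x)) * (jacobian F x * D * (jacobian F x)ᵀ) *
          ((jacobian Θ (F x))ᵀ * ((jacobian Θ (F x))⁻¹)ᵀ) := by simp only [Matrix.mul_assoc]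
      _ = _ := by rw [hKJ, hKJt, Matrix.one_mul, Matrix.mul_one]
  refine ⟨hmetric, fun x c => ?_⟩
  have hconn := h.conn x c
  set K := (jacobian Θ (F x))⁻¹ with hK
  set J := jacobian F x with hJ
  have hTs : SmoothAt (fun z => jacobian Θ (F z)) x :=
    (smoothAt_jacobian hΘ _).comp hF.contDiffAt
  have e0 : mpd (jacobian fun x => Θ (F x)) c x =
      (∑ r, J r c • mpd (jacobian Θ) r (F x)) * J + jacobian Θ (F x) * mpd (jacobian F) c x := by
    rw [hchain, mpd_mul hTs (smoothAt_jacobian hF x), mpd_comp (smoothAt_jacobian hΘ _) (hFd x)]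
  have e1 : ∑ s, jacobian (fun x => Θ (F x)) x s c • Γ (Θ (F x)) s =
      ∑ r, J r c • ∑ s, jacobian Θ (F x) s r • Γ (Θ (F x)) s := by
    simp only [Finset.smul_sum]
    rw [Finset.sum_comm]
    refine Finset.sum_congr rfl fun s _ => ?_
    rw [hchain]
    simp only [Matrix.mul_apply, smul_smul, ← Finset.sum_smul]
    congr 1
    exact Finset.sum_congr rfl fun r _ => mul_comm _ _
  have e2 : ∑ r, J r c • pullConn Θ g Γ (F x) r =
      K * (∑ s, jacobian (fun x => Θ (F x)) x s c • Γ (Θ (F x)) s) * Kᵀ -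
      pullMetric Θ g (F x) * (∑ r, J r c • mpd (jacobian Θ) r (F x))ᵀ * Kᵀ := by
    rw [e1]
    simp only [pullConn, smul_sub, Finset.sum_sub_distrib, Matrix.mul_sum, Matrix.sum_mul,
      Matrix.mul_smul, Matrix.smul_mul, Matrix.transpose_sum, Matrix.transpose_smul, hK]
  rw [e2, hconn, hmetric, e0, hchain, ← hJ]
  simp only [Matrix.transpose_add, Matrix.transpose_mul, Matrix.mul_add, Matrix.add_mul]
  have a1 : K * (jacobian Θ (F x) * J * D * (Jᵀ * (∑ r, J r c • mpd (jacobian Θ) r (F x))ᵀ)) * Kᵀ =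
      J * D * Jᵀ * (∑ r, J r c • mpd (jacobian Θ) r (F x))ᵀ * Kᵀ := by
    calc _ = (K * jacobian Θ (F x)) * (J * D * Jᵀ * (∑ r, J r c • mpd (jacobian Θ) r (F x))ᵀ * Kᵀ) := by
          simp only [Matrix.mul_assoc]
      _ = _ := by rw [hK, hKJ, Matrix.one_mul]
  have a2 : K * (jacobian Θ (F x) * J * D * ((mpd (jacobian F) c x)ᵀ * (jacobian Θ (F x))ᵀ)) * Kᵀ =
      J * D * (mpd (jacobian F) c x)ᵀ := by
    calc _ = (K * jacobian Θ (F x)) * (J * D * (mpd (jacobian F) c x)ᵀ) *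
          ((jacobian Θ (F x))ᵀ * Kᵀ) := by simp only [Matrix.mul_assoc]
      _ = _ := by rw [hK, hKJ, hKJt, Matrix.one_mul, Matrix.mul_one]
  rw [a1, a2, add_sub_cancel_left]

end

end FlatPencil

end

/-! ### The bilinear kernel that encodes metric and connection in the coordinates `θ`. -/

noncomputable section

open Polynomial
open scoped ContDiff Topology Matrix

namespace OrbitC

/-! ### Generating functions -/

theorem eval_polyOf (l : ℕ) (θ : Fin (l + 1) → ℂ) (u : ℂ) :
    (polyOf l θ).eval u = ∑ j, θ j * u ^ (l - (j : ℕ)) := by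
  simp [polyOf, eval_finsetSum]

theorem coeff_polyOf (l : ℕ) (θ : Fin (l + 1) → ℂ) (j : Fin (l + 1)) :
    (polyOf l θ).coeff (l - (j : ℕ)) = θ j := by
  rw [polyOf, finsetSum_coeff, Finset.sum_eq_single j]
  · simp
  · intro b _ hb
    rw [coeff_C_mul_X_pow, if_neg]
    intro h; apply hb; ext; omega
  · simp

theorem polyOf_injective (l : ℕ) : Function.Injective (polyOf l) := by
  intro θ θ' h
  ext j
  rw [← coeff_polyOf l θ, h, coeff_polyOf]

theorem natDegree_polyOf_le (l : ℕ) (θ : Fin (l + 1) → ℂ) : (polyOf l θ).natDegree ≤ l :=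
  natDegree_sum_le_of_forall_le _ _ fun _ _ => (natDegree_C_mul_X_pow_le _ _).trans (Nat.sub_le _ _)

theorem polyOf_coeff {l : ℕ} {p : ℂ[X]} (hp : p.natDegree ≤ l) :
    polyOf l (fun j => p.coeff (l - (j : ℕ))) = p := by
  ext m
  by_cases hm : m ≤ l
  · have := coeff_polyOf l (fun j => p.coeff (l - (j : ℕ))) ⟨l - m, by omega⟩
    simpa [Nat.sub_sub_self hm] using this
  · rw [coeff_eq_zero_of_natDegree_lt (lt_of_le_of_lt (natDegree_polyOf_le _ _) (by omega)),
      coeff_eq_zero_of_natDegree_lt (by omega)]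

theorem polyOf_sum {l : ℕ} {ι : Type*} (s : Finset ι) (c : ι → ℂ) (θ : ι → Fin (l + 1) → ℂ) :
    polyOf l (∑ i ∈ s, c i • θ i) = ∑ i ∈ s, C (c i) * polyOf l (θ i) := by
  simp only [polyOf, Finset.sum_apply, Pi.smul_apply, smul_eq_mul, map_sum, map_mul, Finset.sum_mul,
    Finset.mul_sum]
  rw [Finset.sum_comm]
  simp only [mul_assoc]

theorem polyOf_smul (l : ℕ) (c : ℂ) (θ : Fin (l + 1) → ℂ) :
    polyOf l (c • θ) = C c * polyOf l θ := by
  simp [polyOf, Finset.mul_sum, mul_assoc]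

theorem polynomial_eq_of_eval_eq {p q : ℂ[X]} {S : Set ℂ} (hS : S.Finite)
    (h : ∀ u ∉ S, p.eval u = q.eval u) : p = q :=
  eq_of_infinite_eval_eq p q (hS.infinite_compl.mono fun u hu => h u hu)

/-- The generating function `∑ A^{ij} u^{l-i} v^{l-j}`. -/
def gen {l : ℕ} (A : Matrix (Fin (l + 1)) (Fin (l + 1)) ℂ) (u v : ℂ) : ℂ :=
  ∑ i, ∑ j, A i j * u ^ (l - (i : ℕ)) * v ^ (l - (j : ℕ))

variable {l : ℕ}

theorem gen_eq_eval (A : Matrix (Fin (l + 1)) (Fin (l + 1)) ℂ) (u v : ℂ) :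
    gen A u v = (polyOf l fun i => (polyOf l (A i)).eval v).eval u := by
  simp only [gen, eval_polyOf, Finset.sum_mul]
  exact Finset.sum_congr rfl fun i _ => Finset.sum_congr rfl fun j _ => by ring

/-- A finite exceptional set and the diagonal can be discarded because polynomials are determined by
infinitely many values, one variable at a time. This permits dividing by `v - u` and by `u + 2 cosh
φ_j`. -/
theorem eq_of_gen_eq {A B : Matrix (Fin (l + 1)) (Fin (l + 1)) ℂ} {S : Set ℂ} (hS : S.Finite)
    (h : ∀ u ∉ S, ∀ v ∉ S, u ≠ v → gen A u v = gen B u v) : A = B := by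
  have h1 : ∀ v ∉ S, (fun i => (polyOf l (A i)).eval v) = fun i => (polyOf l (B i)).eval v := by
    intro v hv
    refine polyOf_injective l (polynomial_eq_of_eval_eq (hS.insert v) fun u hu => ?_)
    rw [Set.mem_insert_iff, not_or] at hu
    rw [← gen_eq_eval, ← gen_eq_eval, h u hu.2 v hv hu.1]
  ext i j
  refine congrFun (polyOf_injective l (a₁ := A i) (a₂ := B i)
    (polynomial_eq_of_eval_eq hS fun v hv => ?_)) j
  exact congrFun (h1 v hv) i

theorem gen_add (A B : Matrix (Fin (l + 1)) (Fin (l + 1)) ℂ) (u v : ℂ) :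
    gen (A + B) u v = gen A u v + gen B u v := by
  simp [gen, add_mul, Finset.sum_add_distrib]

theorem gen_smul (c : ℂ) (A : Matrix (Fin (l + 1)) (Fin (l + 1)) ℂ) (u v : ℂ) :
    gen (c • A) u v = c * gen A u v := by
  simp [gen, Finset.mul_sum, mul_assoc]

theorem gen_zero (u v : ℂ) : gen (0 : Matrix (Fin (l + 1)) (Fin (l + 1)) ℂ) u v = 0 := by
  simp [gen]

theorem gen_sum {ι : Type*} (s : Finset ι) (A : ι → Matrix (Fin (l + 1)) (Fin (l + 1)) ℂ)
    (u v : ℂ) : gen (∑ i ∈ s, A i) u v = ∑ i ∈ s, gen (A i) u v := by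
  classical
  induction s using Finset.induction_on with
  | empty => simp [gen_zero]
  | insert a s ha ih => rw [Finset.sum_insert ha, Finset.sum_insert ha, gen_add, ih]

theorem gen_transpose (A : Matrix (Fin (l + 1)) (Fin (l + 1)) ℂ) (u v : ℂ) :
    gen Aᵀ u v = gen A v u := by
  unfold gen
  rw [Finset.sum_comm]
  exact Finset.sum_congr rfl fun i _ => Finset.sum_congr rfl fun j _ => by
    rw [Matrix.transpose_apply]; ring

theorem gen_mul_diagonal_mul (A B : Matrix (Fin (l + 1)) (Fin (l + 1)) ℂ) (d : Fin (l + 1) → ℂ)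
    (u v : ℂ) : gen (A * Matrix.diagonal d * Bᵀ) u v =
      ∑ b, d b * (polyOf l fun i => A i b).eval u * (polyOf l fun j => B j b).eval v := by
  unfold gen
  simp only [Matrix.mul_apply (N := Bᵀ), Matrix.mul_diagonal, Matrix.transpose_apply, eval_polyOf,
    Finset.sum_mul, Finset.mul_sum]
  rw [Finset.sum_comm' (t' := Finset.univ) (s' := fun _ => Finset.univ) (by simp)]
  rw [Finset.sum_congr rfl fun j _ => Finset.sum_comm]
  rw [Finset.sum_comm]
  refine Finset.sum_congr rfl fun b _ => Finset.sum_congr rfl fun j _ =>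
    Finset.sum_congr rfl fun i _ => by ring

/-! ### The structure constants of the metric -/

/-- `(v - u)²` times the generating function of the contravariant connection. -/
def kernel {A : Type*} [CommRing A] [Algebra ℂ A] (l k : ℕ) (P R : ℂ[X]) (u v : A) : A :=
  ((k : A) - l) * aeval u P * aeval v R * (v - u) ^ 2 +
  ((4 - u ^ 2) * aeval u (derivative P) * aeval v R -
    (4 - v ^ 2) * aeval u P * aeval v (derivative R)) * (v - u) +
  (u * v - 4) * (aeval v P * aeval u R - aeval u P * aeval v R)

/-- Taylor expansion in `δ = v - u`: the first-order part `(4 - u²)(P'R - P R') δ` of the second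
summand is cancelled by that of the last, which is the reason for the term with `u v - 4`. The ring
is general so that `u` and `v` can be indeterminates. -/
theorem sq_dvd_kernel {A : Type*} [CommRing A] [Algebra ℂ A] (l k : ℕ) (P R : ℂ[X]) (u v : A) :
    (v - u) ^ 2 ∣ kernel l k P R u v := by
  obtain ⟨δ, rfl⟩ : ∃ δ, v = u + δ := ⟨v - u, by ring⟩
  have h2 : ∀ P : ℂ[X], ∃ a, aeval (u + δ) P = aeval u P + aeval u (derivative P) * δ + a * δ ^ 2 := by
    intro P
    obtain ⟨a, ha⟩ := Polynomial.binomExpansion (P.map (algebraMap ℂ A)) u δ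
    refine ⟨a, ?_⟩
    simpa [aeval_def, eval_map, derivative_map] using ha
  obtain ⟨a, ha⟩ := h2 P
  obtain ⟨b, hb⟩ := h2 R
  obtain ⟨c, hc⟩ := h2 (derivative R)
  rw [add_sub_cancel_left]
  unfold kernel
  rw [ha, hb, hc]
  set p := aeval u P
  set p' := aeval u (derivative P)
  set r := aeval u R
  set r' := aeval u (derivative R)
  set r'' := aeval u (derivative (derivative R))
  refine ⟨((k : A) - l) * p * (r + r' * δ + b * δ ^ 2) +
    (4 - u ^ 2) * p' * (r' + b * δ) - (4 - u ^ 2) * p * (r'' + c * δ)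
      + (2 * u + δ) * p * (r' + r'' * δ + c * δ ^ 2)
      + u * (p' * r - p * r') + (u * (u + δ) - 4) * (a * r - p * b), ?_⟩
  ring

theorem natDegree_kernel_aux {A : Type*} [CommRing A] [Algebra ℂ A] {P R : ℂ[X]} {l k d : ℕ}
    (hd1 : 1 ≤ d) (hP : P.natDegree ≤ d) (hR : R.natDegree ≤ d) (x : A) :
    (kernel l k P R (C x) (X : A[X])).natDegree ≤ d + 2 ∧
    (kernel l k P R (X : A[X]) (C x)).natDegree ≤ d + 2 := by
  have hC : ∀ Q : ℂ[X], aeval (C x : A[X]) Q = C (aeval x Q) := fun Q =>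
    aeval_algebraMap_apply A[X] x Q
  have hX : ∀ (Q : ℂ[X]) d, Q.natDegree ≤ d → (aeval (X : A[X]) Q).natDegree ≤ d := by
    intro Q d hd
    rw [show aeval (X : A[X]) Q = Q.map (algebraMap ℂ A) from rfl]
    exact natDegree_map_le.trans hd
  -- The subtraction is truncated. With `1 ≤ d` the term of degree `2 + (d - 1) + 1` stays within `d
  -- + 2`.
  have hd : ∀ Q : ℂ[X], Q.natDegree ≤ d → (derivative Q).natDegree ≤ d - 1 := fun Q hQ =>
    (natDegree_derivative_le Q).trans (Nat.sub_le_sub_right hQ 1)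
  have h1 := hX P d hP
  have h2 := hX R d hR
  have h3 := hX _ _ (hd P hP)
  have h4 := hX _ _ (hd R hR)
  have hnk : ((k : A[X]) - l).natDegree ≤ 0 := by compute_degree
  have e1 : (X - C x : A[X]).natDegree ≤ 1 := by compute_degree
  have e1' : (C x - X : A[X]).natDegree ≤ 1 := by compute_degree
  have e2 : (4 - X ^ 2 : A[X]).natDegree ≤ 2 := by compute_degree
  have e3 : (4 - (C x) ^ 2 : A[X]).natDegree ≤ 0 := by compute_degree
  have e4 : (C x * X - 4 : A[X]).natDegree ≤ 1 := by compute_degree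
  have e4' : (X * C x - 4 : A[X]).natDegree ≤ 1 := by compute_degree
  have c0 : ∀ y : A, (C y).natDegree ≤ 0 := fun y => (natDegree_C y).le
  unfold kernel
  simp only [hC]
  constructor
  · have t1 := natDegree_mul_le_of_le (natDegree_mul_le_of_le (natDegree_mul_le_of_le hnk
      (c0 (aeval x P))) h2) (natDegree_pow_le_of_le 2 e1)
    have t2 := natDegree_mul_le_of_le (natDegree_sub_le_of_le
      (natDegree_mul_le_of_le (natDegree_mul_le_of_le e3 (c0 (aeval x (derivative P)))) h2)
      (natDegree_mul_le_of_le (natDegree_mul_le_of_le e2 (c0 (aeval x P))) h4)) e1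
    have t3 := natDegree_mul_le_of_le e4 (natDegree_sub_le_of_le
      (natDegree_mul_le_of_le h1 (c0 (aeval x R))) (natDegree_mul_le_of_le (c0 (aeval x P)) h2))
    exact (natDegree_add_le_of_degree_le (natDegree_add_le_of_degree_le (t1.trans (by omega))
      (t2.trans (by omega))) (t3.trans (by omega)))
  · have t1 := natDegree_mul_le_of_le (natDegree_mul_le_of_le (natDegree_mul_le_of_le hnk
      h1) (c0 (aeval x R))) (natDegree_pow_le_of_le 2 e1')
    have t2 := natDegree_mul_le_of_le (natDegree_sub_le_of_le
      (natDegree_mul_le_of_le (natDegree_mul_le_of_le e2 h3) (c0 (aeval x R)))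
      (natDegree_mul_le_of_le (natDegree_mul_le_of_le e3 h1) (c0 (aeval x (derivative R))))) e1'
    have t3 := natDegree_mul_le_of_le e4' (natDegree_sub_le_of_le
      (natDegree_mul_le_of_le (c0 (aeval x P)) h2) (natDegree_mul_le_of_le h1 (c0 (aeval x R))))
    exact (natDegree_add_le_of_degree_le (natDegree_add_le_of_degree_le (t1.trans (by omega))
      (t2.trans (by omega))) (t3.trans (by omega)))

theorem map_kernel {A B : Type*} [CommRing A] [Algebra ℂ A] [CommRing B] [Algebra ℂ B]
    (f : A →ₐ[ℂ] B) (l k : ℕ) (P R : ℂ[X]) (u v : A) :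
    f (kernel l k P R u v) = kernel l k P R (f u) (f v) := by
  simp [kernel, aeval_algHom_apply, map_ofNat f 4]

theorem natDegree_le_of_sq_mul {A : Type*} [CommRing A] [Nontrivial A] {x : A} {Q : A[X]} {d : ℕ}
    (h : ((X - C x) ^ 2 * Q).natDegree ≤ d + 2) : Q.natDegree ≤ d := by
  rcases eq_or_ne Q 0 with rfl | h0
  · simp
  · rw [((monic_X_sub_C x).pow 2).natDegree_mul' h0, (monic_X_sub_C x).natDegree_pow,
      natDegree_X_sub_C] at h
    omega

theorem coeff_coeff_swap (Q : ℂ[X][X]) (i j : ℕ) :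
    ((Bivariate.swap (R := ℂ) Q).coeff i).coeff j = (Q.coeff j).coeff i := by
  induction Q using Polynomial.induction_on' with
  | add p q hp hq => simp [hp, hq]
  | monomial n f =>
    induction f using Polynomial.induction_on' with
    | add p q hp hq => simp only [map_add, coeff_add, hp, hq]
    | monomial m r =>
      rw [Bivariate.swap_monomial_monomial]
      simp only [coeff_monomial]
      split_ifs <;> simp_all [coeff_monomial]

/-- The kernel has degree at most `l + 2` in each variable, and its divisor `(v - u)²` is monic of
degree two in each. The quotient therefore has degree at most `l` in each variable and fits into an
`(l + 1) × (l + 1)` matrix of coefficients. -/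
theorem exists_gen_eq_kernel (k : ℕ) (hl : 1 ≤ l) {P R : ℂ[X]} (hP : P.natDegree ≤ l)
    (hR : R.natDegree ≤ l) : ∃ A : Matrix (Fin (l + 1)) (Fin (l + 1)) ℂ, ∀ u v : ℂ,
      (v - u) ^ 2 * gen A u v = kernel l k P R u v := by
  obtain ⟨Q, hQ⟩ := sq_dvd_kernel l k P R (C X : ℂ[X][X]) X
  have hdeg : Q.natDegree ≤ l := by
    have h1 := (natDegree_kernel_aux (l := l) (k := k) hl hP hR (X : ℂ[X])).1
    rw [hQ] at h1
    exact natDegree_le_of_sq_mul h1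
  -- The degree in `u` is bounded by exchanging the roles of the two indeterminates.
  have hdeg' : (Bivariate.swap (R := ℂ) Q).natDegree ≤ l := by
    have h1 := (natDegree_kernel_aux (l := l) (k := k) hl hP hR (X : ℂ[X])).2
    have h3 := map_kernel (Bivariate.swap (R := ℂ)).toAlgHom l k P R (C X : ℂ[X][X]) X
    rw [hQ] at h3
    simp only [AlgEquiv.toAlgHom_apply, map_mul, map_pow, map_sub, Bivariate.swap_X,
      Bivariate.swap_Y] at h3
    rw [← h3, show (C X - X : ℂ[X][X]) ^ 2 = (X - C X) ^ 2 by ring] at h1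
    exact natDegree_le_of_sq_mul h1
  have hcoeff : ∀ j, (Q.coeff j).natDegree ≤ l := by
    intro j
    rw [natDegree_le_iff_coeff_eq_zero]
    intro N hN
    rw [← coeff_coeff_swap, coeff_eq_zero_of_natDegree_lt (lt_of_le_of_lt hdeg' hN), coeff_zero]
  refine ⟨Matrix.of fun i j => (Q.coeff (l - (j : ℕ))).coeff (l - (i : ℕ)), fun u v => ?_⟩
  have h1 : gen (Matrix.of fun i j : Fin (l + 1) => (Q.coeff (l - (j : ℕ))).coeff (l - (i : ℕ)))
      u v = (aevalAeval u v) Q := by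
    have e1 : Q = ∑ j : Fin (l + 1), C (Q.coeff (l - (j : ℕ))) * X ^ (l - (j : ℕ)) := by
      conv_lhs => rw [as_sum_range_C_mul_X_pow' Q (Nat.lt_succ_of_le hdeg)]
      rw [← Finset.sum_range_reflect, Finset.sum_range]
      simp
    rw [coe_aevalAeval_eq_evalEval]
    conv_rhs => rw [e1]
    rw [evalEval_finsetSum, gen, Finset.sum_comm]
    refine Finset.sum_congr rfl fun j _ => ?_
    rw [evalEval_mul, evalEval_pow, evalEval_X, evalEval_C, ← Finset.sum_mul]
    congr 1
    conv_rhs => rw [← polyOf_coeff (hcoeff (l - (j : ℕ))), eval_polyOf]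
    rfl
  have h2 := map_kernel (aevalAeval u v) l k P R (C X : ℂ[X][X]) X
  rw [hQ] at h2
  simp only [map_mul, map_pow, map_sub, ← h1] at h2
  simpa [coe_aevalAeval_eq_evalEval, evalEval_C] using h2

/-- The coefficients of the bilinear expression for the contravariant connection. -/
def structConst (l k : ℕ) (r a : Fin (l + 1)) : Matrix (Fin (l + 1)) (Fin (l + 1)) ℂ :=
  if hl : 1 ≤ l then (exists_gen_eq_kernel k hl
    (natDegree_X_pow_le (R := ℂ) (n := l - (a : ℕ)) |>.trans (Nat.sub_le l a))
    (natDegree_X_pow_le (R := ℂ) (n := l - (r : ℕ)) |>.trans (Nat.sub_le l r))).choose else 0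

/-- The contravariant connection in the coordinates `θ`. -/
def thetaConn (l k : ℕ) (θ : Fin (l + 1) → ℂ) (r : Fin (l + 1)) :
    Matrix (Fin (l + 1)) (Fin (l + 1)) ℂ := ∑ a, θ a • structConst l k r a

/-- The contravariant metric in the coordinates `θ`. -/
def thetaMetric (l k : ℕ) (θ : Fin (l + 1) → ℂ) : Matrix (Fin (l + 1)) (Fin (l + 1)) ℂ :=
  ∑ r, θ r • thetaConn l k θ r

theorem gen_structConst {k : ℕ} (hl : 1 ≤ l) (r a : Fin (l + 1)) (u v : ℂ) :
    (v - u) ^ 2 * gen (structConst l k r a) u v =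
      kernel l k (X ^ (l - (a : ℕ))) (X ^ (l - (r : ℕ))) u v := by
  unfold structConst
  rw [dif_pos hl]
  exact (exists_gen_eq_kernel k hl
    (natDegree_X_pow_le (R := ℂ) (n := l - (a : ℕ)) |>.trans (Nat.sub_le l a))
    (natDegree_X_pow_le (R := ℂ) (n := l - (r : ℕ)) |>.trans (Nat.sub_le l r))).choose_spec u v

theorem kernel_sum_left {ι : Type*} (s : Finset ι) (l k : ℕ) (c : ι → ℂ) (P : ι → ℂ[X]) (R : ℂ[X])
    (u v : ℂ) : kernel l k (∑ i ∈ s, C (c i) * P i) R u v = ∑ i ∈ s, c i * kernel l k (P i) R u v := by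
  classical
  induction s using Finset.induction_on with
  | empty => simp [kernel]
  | insert a s ha ih =>
    rw [Finset.sum_insert ha, Finset.sum_insert ha, ← ih]
    simp only [kernel, map_add, map_mul, derivative_mul, derivative_C, coe_aeval_eq_eval, eval_C,
      zero_mul, zero_add]
    ring

theorem kernel_sum_right {ι : Type*} (s : Finset ι) (l k : ℕ) (c : ι → ℂ) (P : ℂ[X]) (R : ι → ℂ[X])
    (u v : ℂ) : kernel l k P (∑ i ∈ s, C (c i) * R i) u v = ∑ i ∈ s, c i * kernel l k P (R i) u v := by
  classical
  induction s using Finset.induction_on with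
  | empty => simp [kernel]
  | insert a s ha ih =>
    rw [Finset.sum_insert ha, Finset.sum_insert ha, ← ih]
    simp only [kernel, map_add, map_mul, derivative_mul, derivative_C, coe_aeval_eq_eval, eval_C,
      zero_mul, zero_add]
    ring

theorem gen_thetaConn {k : ℕ} (hl : 1 ≤ l) (θ ρ : Fin (l + 1) → ℂ) (u v : ℂ) :
    (v - u) ^ 2 * gen (∑ r, ρ r • thetaConn l k θ r) u v =
      kernel l k (polyOf l θ) (polyOf l ρ) u v := by
  simp only [gen_sum, gen_smul, thetaConn, Finset.mul_sum]
  conv_rhs => simp only [polyOf]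
  rw [kernel_sum_right]
  refine Finset.sum_congr rfl fun r _ => ?_
  rw [kernel_sum_left, Finset.mul_sum]
  refine Finset.sum_congr rfl fun a _ => ?_
  rw [← gen_structConst hl]; ring

theorem gen_thetaMetric {k : ℕ} (hl : 1 ≤ l) (θ : Fin (l + 1) → ℂ) (u v : ℂ) :
    (v - u) ^ 2 * gen (thetaMetric l k θ) u v = kernel l k (polyOf l θ) (polyOf l θ) u v :=
  gen_thetaConn hl θ θ u v

theorem eq_of_sq_mul_gen_eq {A B : Matrix (Fin (l + 1)) (Fin (l + 1)) ℂ} {S : Set ℂ} (hS : S.Finite)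
    (h : ∀ u ∉ S, ∀ v ∉ S, u ≠ v → (v - u) ^ 2 * gen A u v = (v - u) ^ 2 * gen B u v) : A = B :=
  eq_of_gen_eq hS fun u hu v hv huv =>
    mul_left_cancel₀ (pow_ne_zero 2 (sub_ne_zero.mpr huv.symm)) (h u hu v hv huv)

/-- For `R = P` the last summand of the kernel vanishes and the other two are invariant under `u ↔
v`. -/
theorem isSymm_thetaMetric {k : ℕ} (hl : 1 ≤ l) (θ : Fin (l + 1) → ℂ) :
    (thetaMetric l k θ).IsSymm := by
  refine eq_of_sq_mul_gen_eq Set.finite_empty fun u _ v _ _ => ?_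
  have h1 := gen_thetaMetric (k := k) hl θ v u
  rw [gen_transpose, gen_thetaMetric hl, ← neg_sub, neg_sq, h1]
  unfold kernel
  ring

end OrbitC

end

/-! ### The product formula for `P` and the derivatives of its factors. -/

noncomputable section

open Polynomial
open scoped ContDiff Topology Matrix

namespace OrbitC

open FlatPencil

variable {l k : ℕ}

/-! ### The flat chart -/

/-- The function `2 cosh t`. -/
def twoCosh (t : ℂ) : ℂ := Complex.exp t + Complex.exp (-t)

/-- The coordinates `y` in terms of `φ_j = 2πi (x_j - x_{j-1})` and `φ_{l+1} = 2πi x_{l+1}`. -/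
def phiChart (l k : ℕ) (φ : Fin (l + 1) → ℂ) : Fin (l + 1) → ℂ := fun j =>
  if j = Fin.last l then φ (Fin.last l)
  else Complex.exp ((min ((j : ℕ) + 1) k : ℕ) * φ (Fin.last l)) *
    MvPolynomial.aeval (fun i : Fin l => twoCosh (φ i.castSucc))
      (MvPolynomial.esymm (Fin l) ℂ ((j : ℕ) + 1))

theorem contDiff_twoCosh : ContDiff ℂ ∞ twoCosh := by
  unfold twoCosh; fun_prop

theorem contDiff_phiChart (l k : ℕ) : ContDiff ℂ ∞ (phiChart l k) := by
  rw [contDiff_pi]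
  intro j
  unfold phiChart
  split_ifs
  · fun_prop
  · have h := contDiff_twoCosh
    simp only [MvPolynomial.aeval_esymm_eq_multiset_esymm, Finset.esymm_map_val]
    refine ContDiff.mul (by fun_prop) (ContDiff.sum fun s _ => contDiff_prod fun i _ => ?_)
    exact h.comp (by fun_prop)

theorem contDiff_theta (l k : ℕ) : ContDiff ℂ ∞ (theta l k) := by
  rw [contDiff_pi]
  intro j
  unfold theta
  refine Fin.cases ?_ (fun i => ?_) j
  · simp only [Fin.cases_zero]; fun_prop
  · simp only [Fin.cases_succ]; fun_prop

/-- Vieta's formula. The exponents `min j k` in `y^j` and the truncated `k - j` in `θ^j` add up to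
`k` for every `j`, so the exponential is a common factor. -/
theorem polyOf_theta_phiChart (φ : Fin (l + 1) → ℂ) :
    polyOf l (theta l k (phiChart l k φ)) = C (Complex.exp (k * φ (Fin.last l))) *
      ∏ j : Fin l, (X + C (twoCosh (φ j.castSucc))) := by
  have h1 := Multiset.prod_X_add_C_eq_sum_esymm
    ((Finset.univ : Finset (Fin l)).val.map fun i => twoCosh (φ i.castSucc))
  rw [Multiset.map_map] at h1
  have h2 : ∏ j : Fin l, (X + C (twoCosh (φ j.castSucc))) = (Multiset.map ((fun r => X + C r) ∘
    fun i : Fin l => twoCosh (φ i.castSucc)) (Finset.univ : Finset (Fin l)).val).prod := rfl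
  rw [h2, h1, Finset.mul_sum]
  simp only [Multiset.card_map, Finset.card_val, Finset.card_univ, Fintype.card_fin]
  rw [Finset.sum_range]
  refine Finset.sum_congr rfl fun j _ => ?_
  rw [← mul_assoc, ← C_mul]
  congr 2
  refine Fin.cases ?_ (fun i => ?_) j
  · simp [theta, phiChart, Multiset.esymm]
  · simp only [theta, Fin.cases_succ, phiChart, if_neg (Fin.castSucc_ne_last i), Fin.val_castSucc,
      MvPolynomial.aeval_esymm_eq_multiset_esymm, Fin.val_succ, if_true]
    rw [mul_right_comm, ← Complex.exp_add, ← add_mul, ← Nat.cast_add]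
    congr 4
    omega

/-- The logarithmic derivatives of `φ ↦ e^{k φ_{l+1}} ∏ (u + 2 cosh φ_j)`. -/
def logDer (l k : ℕ) (u : ℂ) (b : Fin (l + 1)) (φ : Fin (l + 1) → ℂ) : ℂ :=
  if b = Fin.last l then k
  else (Complex.exp (φ b) - Complex.exp (-φ b)) / (u + twoCosh (φ b))

/-- The function `φ ↦ e^{k φ_{l+1}} ∏ (u + 2 cosh φ_j)`. -/
def genP (l k : ℕ) (u : ℂ) (φ : Fin (l + 1) → ℂ) : ℂ :=
  Complex.exp (k * φ (Fin.last l)) * ∏ j : Fin l, (u + twoCosh (φ j.castSucc))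

theorem eval_polyOf_theta_phiChart (u : ℂ) (φ : Fin (l + 1) → ℂ) :
    (polyOf l (theta l k (phiChart l k φ))).eval u = genP l k u φ := by
  simp [polyOf_theta_phiChart, eval_prod, genP]

theorem contDiff_genP (l k : ℕ) (u : ℂ) : ContDiff ℂ ∞ (genP l k u) := by
  unfold genP
  have h := contDiff_twoCosh
  refine ContDiff.mul (by fun_prop) (contDiff_prod fun i _ => ?_)
  exact contDiff_const.add (h.comp (by fun_prop))

theorem hasDerivAt_twoCosh (t : ℂ) : HasDerivAt twoCosh (Complex.exp t - Complex.exp (-t)) t := by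
  have h1 := (Complex.hasDerivAt_exp t).add ((Complex.hasDerivAt_exp (-t)).comp t (hasDerivAt_neg t))
  exact h1.congr_deriv (by ring)

/-- The set of `u` at which a logarithmic derivative has a pole. -/
def poles (l : ℕ) (φ : Fin (l + 1) → ℂ) : Set ℂ :=
  Set.range fun j : Fin l => -twoCosh (φ j.castSucc)

theorem finite_poles (φ : Fin (l + 1) → ℂ) : (poles l φ).Finite := Set.finite_range _

theorem add_twoCosh_ne_zero {φ : Fin (l + 1) → ℂ} {u : ℂ} (hu : u ∉ poles l φ) (j : Fin l) :
    u + twoCosh (φ j.castSucc) ≠ 0 := by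
  intro h
  exact hu ⟨j, by simp only; linear_combination -h⟩

theorem pd_genP {φ : Fin (l + 1) → ℂ} {u : ℂ} {b : Fin (l + 1)}
    (hb : b = Fin.last l ∨ u + twoCosh (φ b) ≠ 0) :
    pd (genP l k u) b φ = logDer l k u b φ * genP l k u φ := by
  refine pd_eq_of_hasDerivAt ((contDiff_genP l k u).contDiffAt.differentiableAt (by simp)) ?_
  refine Fin.lastCases (fun _ => ?_) (fun b hb => ?_) b hb
  · have h1 : (fun t => genP l k u (Function.update φ (Fin.last l) t)) = fun t =>
        Complex.exp (k * t) * ∏ j : Fin l, (u + twoCosh (φ j.castSucc)) := by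
      ext t
      simp [genP]
    rw [h1]
    have h2 := ((hasDerivAt_id (φ (Fin.last l))).const_mul (k : ℂ)).cexp.mul_const
      (∏ j : Fin l, (u + twoCosh (φ j.castSucc)))
    refine h2.congr_deriv ?_
    simp [logDer, genP]; ring
  · have h1 : (fun t => genP l k u (Function.update φ b.castSucc t)) = fun t =>
        (Complex.exp (k * φ (Fin.last l)) * ∏ j ∈ Finset.univ.erase b,
          (u + twoCosh (φ j.castSucc))) * (u + twoCosh t) := by
      ext t
      rw [genP, Function.update_of_ne (Fin.castSucc_ne_last b).symm,
        ← Finset.mul_prod_erase _ _ (Finset.mem_univ b), Function.update_self]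
      rw [Finset.prod_congr rfl fun j hj => by
        rw [Function.update_of_ne ((Fin.castSucc_injective l).ne (Finset.ne_of_mem_erase hj))]]
      ring
    rw [h1]
    refine (((hasDerivAt_twoCosh (φ b.castSucc)).const_add u).const_mul _).congr_deriv ?_
    have hb' := hb.resolve_left (Fin.castSucc_ne_last b)
    rw [logDer, if_neg (Fin.castSucc_ne_last b), genP, ← Finset.mul_prod_erase _ _ (Finset.mem_univ b)]
    field_simp

/-- The logarithmic derivative in `φ_b` depends on `φ_b` alone and is constant for the last index,
so the correction to the product of logarithmic derivatives lives on the diagonal, away from the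
last index. -/
theorem pd_pd_genP {φ : Fin (l + 1) → ℂ} {u : ℂ} (hu : u ∉ poles l φ) (b c : Fin (l + 1)) :
    pd (pd (genP l k u) b) c φ = genP l k u φ * (logDer l k u b φ * logDer l k u c φ +
      if b = c ∧ b ≠ Fin.last l then twoCosh (φ b) / (u + twoCosh (φ b)) - (logDer l k u b φ) ^ 2
      else 0) := by
  have hne : ∀ b, b = Fin.last l ∨ u + twoCosh (φ b) ≠ 0 := by
    intro b
    refine Fin.lastCases (Or.inl rfl) (fun b => Or.inr (add_twoCosh_ne_zero hu b)) b
  have hev : pd (genP l k u) b =ᶠ[𝓝 φ] fun φ => logDer l k u b φ * genP l k u φ := by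
    rcases hne b with h | h
    · exact Filter.Eventually.of_forall fun φ => pd_genP (Or.inl h)
    · have hc : ContinuousAt (fun φ : Fin (l + 1) → ℂ => u + twoCosh (φ b)) φ :=
        continuousAt_const.add (contDiff_twoCosh.continuous.continuousAt.comp
          (continuous_apply b).continuousAt)
      filter_upwards [hc.eventually_ne h] with φ hφ using pd_genP (Or.inr hφ)
  have hP : DifferentiableAt ℂ (genP l k u) φ :=
    (contDiff_genP l k u).contDiffAt.differentiableAt (by simp)
  rw [pd_congr hev]
  have hL : DifferentiableAt ℂ (logDer l k u b) φ ∧ pd (logDer l k u b) c φ =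
      if b = c ∧ b ≠ Fin.last l then twoCosh (φ b) / (u + twoCosh (φ b)) - (logDer l k u b φ) ^ 2
      else 0 := by
    by_cases hb : b = Fin.last l
    · have : logDer l k u b = fun _ => (k : ℂ) := by ext φ; simp [logDer, hb]
      rw [this]
      exact ⟨differentiableAt_const _, by simp [pd_const, hb]⟩
    · have hd := (hne b).resolve_left hb
      have h1 : logDer l k u b = fun φ =>
          (Complex.exp (φ b) - Complex.exp (-φ b)) / (u + twoCosh (φ b)) := by
        ext φ; simp [logDer, hb]
      have hdiff : DifferentiableAt ℂ (logDer l k u b) φ := by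
        rw [h1]
        have h2 : ContDiffAt ℂ 1 (fun φ : Fin (l + 1) → ℂ => u + twoCosh (φ b)) φ := by
          unfold twoCosh; fun_prop
        have h3 : ContDiffAt ℂ 1 (fun φ : Fin (l + 1) → ℂ =>
          Complex.exp (φ b) - Complex.exp (-φ b)) φ := by fun_prop
        exact (h3.div h2 hd).differentiableAt (by simp)
      refine ⟨hdiff, pd_eq_of_hasDerivAt hdiff ?_⟩
      rw [h1]
      by_cases hbc : b = c
      · subst hbc
        simp only [Function.update_self, true_and, ne_eq, hb, not_false_eq_true, if_true]
        have e1 := ((Complex.hasDerivAt_exp (φ b)).sub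
          ((Complex.hasDerivAt_exp (-φ b)).comp (φ b) (hasDerivAt_neg (φ b)))).fun_div
          ((hasDerivAt_twoCosh (φ b)).const_add u) hd
        refine e1.congr_deriv ?_
        simp only [Pi.sub_apply, Function.comp_apply]
        have : twoCosh (φ b) = Complex.exp (φ b) - Complex.exp (-φ b) * -1 := by
          unfold twoCosh; ring
        rw [← this]
        field_simp
      · simp only [Function.update_of_ne hbc, hbc, false_and, if_false]
        exact hasDerivAt_const _ _
  rw [pd_mul hL.1 hP, hL.2, pd_genP (hne c)]
  ring

end OrbitC

end

/-! ### The flat chart in the coordinates `θ`, by partial fractions. -/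

noncomputable section

open Polynomial
open scoped ContDiff Topology Matrix

namespace OrbitC

open FlatPencil

variable {l k : ℕ}

/-- The constant components of the metric in the coordinates `φ`. -/
def phiForm (l k : ℕ) : Fin (l + 1) → ℂ := fun b => if b = Fin.last l then 1 / (k : ℂ) else -1

/-- The coordinates `θ` as functions of `φ`. -/
def thetaChart (l k : ℕ) (φ : Fin (l + 1) → ℂ) : Fin (l + 1) → ℂ := theta l k (phiChart l k φ)

theorem contDiff_thetaChart (l k : ℕ) : ContDiff ℂ ∞ (thetaChart l k) :=
  (contDiff_theta l k).comp (contDiff_phiChart l k)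

theorem genP_eq_sum (u : ℂ) :
    genP l k u = fun φ => ∑ j : Fin (l + 1), u ^ (l - (j : ℕ)) * thetaChart l k φ j := by
  ext φ
  rw [← eval_polyOf_theta_phiChart, eval_polyOf]
  exact Finset.sum_congr rfl fun j _ => mul_comm _ _

theorem contDiffAt_thetaChart_apply (φ : Fin (l + 1) → ℂ) (j : Fin (l + 1)) :
    ContDiffAt ℂ ∞ (fun z => thetaChart l k z j) φ :=
  (contDiff_pi.mp (contDiff_thetaChart l k) j).contDiffAt

theorem pd_genP_eq_sum (u : ℂ) (b : Fin (l + 1)) : pd (genP l k u) b =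
    fun φ => ∑ j : Fin (l + 1), u ^ (l - (j : ℕ)) * jacobian (thetaChart l k) φ j b := by
  ext φ
  have hd : ∀ j, DifferentiableAt ℂ (fun z => thetaChart l k z j) φ := fun j =>
    (contDiffAt_thetaChart_apply φ j).differentiableAt (by simp)
  rw [genP_eq_sum, pd_sum _ fun j _ => (hd j).const_mul _]
  exact Finset.sum_congr rfl fun j _ => pd_const_mul (hd j) _ b

theorem eval_polyOf_jacobian (φ : Fin (l + 1) → ℂ) (u : ℂ) (b : Fin (l + 1)) :
    (polyOf l fun i => jacobian (thetaChart l k) φ i b).eval u = pd (genP l k u) b φ := by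
  rw [pd_genP_eq_sum, eval_polyOf]
  exact Finset.sum_congr rfl fun j _ => mul_comm _ _

theorem eval_polyOf_hessian (φ : Fin (l + 1) → ℂ) (u : ℂ) (b c : Fin (l + 1)) :
    (polyOf l fun i => mpd (jacobian (thetaChart l k)) c φ i b).eval u =
      pd (pd (genP l k u) b) c φ := by
  have hd := fun j => (smoothAt_jacobian (contDiff_thetaChart l k) φ).diff j b
  rw [pd_genP_eq_sum, eval_polyOf, pd_sum _ fun j _ => (hd j).const_mul _]
  exact Finset.sum_congr rfl fun j _ => by rw [pd_const_mul (hd j), mul_comm]; rfl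

/-- The sum `∑ 1 / (u + ξ_j)`. -/
def invSum (l : ℕ) (φ : Fin (l + 1) → ℂ) (u : ℂ) : ℂ := ∑ j : Fin l, 1 / (u + twoCosh (φ j.castSucc))

theorem eval_derivative_theta {φ : Fin (l + 1) → ℂ} {u : ℂ} (hu : u ∉ poles l φ) :
    (derivative (polyOf l (thetaChart l k φ))).eval u = genP l k u φ * invSum l φ u := by
  rw [thetaChart, polyOf_theta_phiChart, derivative_mul, derivative_C, zero_mul, zero_add,
    derivative_prod_finset, eval_mul, eval_finsetSum, genP, invSum, eval_C, mul_assoc,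
    Finset.mul_sum (f := fun j : Fin l => 1 / (u + twoCosh (φ j.castSucc)))]
  congr 1
  refine Finset.sum_congr rfl fun j _ => ?_
  rw [← Finset.mul_prod_erase _ _ (Finset.mem_univ j)]
  have := add_twoCosh_ne_zero hu j
  simp only [eval_prod, eval_add, eval_X, eval_C, derivative_add, derivative_X,
    derivative_C, add_zero, mul_one]
  field_simp

theorem sq_exp_sub (t : ℂ) :
    (Complex.exp t - Complex.exp (-t)) ^ 2 = twoCosh t ^ 2 - 4 := by
  have : Complex.exp t * Complex.exp (-t) = 1 := by rw [← Complex.exp_add]; simp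
  unfold twoCosh
  linear_combination (-4) * this

/-- With `ξ = 2 cosh φ_j` the `j`-th term is `-(ξ² - 4) / ((u + ξ)(v + ξ))`; multiplied by `v - u`
it equals `(4 - u²)/(u + ξ) - (4 - v²)/(v + ξ) - (v - u)`. The constants sum to `-l`, and the last
coordinate contributes `k² / k`. -/
theorem sum_logDer (hk : 1 ≤ k) {φ : Fin (l + 1) → ℂ} {u v : ℂ} (hu : u ∉ poles l φ)
    (hv : v ∉ poles l φ) :
    (v - u) * ∑ b, phiForm l k b * logDer l k u b φ * logDer l k v b φ =
      (v - u) * (k - l) + (4 - u ^ 2) * invSum l φ u - (4 - v ^ 2) * invSum l φ v := by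
  have hk' : (k : ℂ) ≠ 0 := by exact_mod_cast (by omega : k ≠ 0)
  rw [Fin.sum_univ_castSucc]
  simp only [phiForm, logDer, if_true, if_neg (Fin.castSucc_ne_last _)]
  have h1 : ∀ j : Fin l, (v - u) * (-1 * ((Complex.exp (φ j.castSucc) - Complex.exp (-φ j.castSucc)) /
      (u + twoCosh (φ j.castSucc))) * ((Complex.exp (φ j.castSucc) - Complex.exp (-φ j.castSucc)) /
      (v + twoCosh (φ j.castSucc)))) = (4 - u ^ 2) * (1 / (u + twoCosh (φ j.castSucc))) -
      (4 - v ^ 2) * (1 / (v + twoCosh (φ j.castSucc))) - (v - u) := by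
    intro j
    have a1 := add_twoCosh_ne_zero hu j
    have a2 := add_twoCosh_ne_zero hv j
    have a3 := sq_exp_sub (φ j.castSucc)
    field_simp
    rw [a3]
    ring
  rw [mul_add, Finset.mul_sum, Finset.sum_congr rfl fun j _ => h1 j]
  simp only [Finset.sum_sub_distrib, ← Finset.mul_sum, Finset.sum_const, Finset.card_univ,
    Fintype.card_fin, nsmul_eq_mul, invSum]
  field_simp
  ring

/-- The metric is `P(u) P(v)` times the sum in `sum_logDer`, where `P · invSum` is the derivative of
`P`. For the connection the second argument of the kernel is `R = ∂P/∂φ_c`, and the Hessian adds one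
diagonal term to that sum. -/
theorem isFlatChart_theta (hk : 1 ≤ k) (hkl : k ≤ l) :
    IsFlatChart (thetaChart l k) (Matrix.diagonal (phiForm l k)) (thetaMetric l k)
      (thetaConn l k) := by
  have hl : 1 ≤ l := hk.trans hkl
  have hne : ∀ {φ : Fin (l + 1) → ℂ} {u : ℂ}, u ∉ poles l φ → ∀ b,
      b = Fin.last l ∨ u + twoCosh (φ b) ≠ 0 := by
    intro φ u hu b
    exact Fin.lastCases (Or.inl rfl) (fun b => Or.inr (add_twoCosh_ne_zero hu b)) b
  constructor
  · intro φ
    refine eq_of_sq_mul_gen_eq (finite_poles φ) fun u hu v hv huv => ?_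
    rw [gen_thetaMetric hl, gen_mul_diagonal_mul]
    simp only [eval_polyOf_jacobian, pd_genP (hne hu _), pd_genP (hne hv _)]
    have h1 : ∑ b, phiForm l k b * (logDer l k u b φ * genP l k u φ) *
        (logDer l k v b φ * genP l k v φ) = (∑ b, phiForm l k b * logDer l k u b φ *
        logDer l k v b φ) * (genP l k u φ * genP l k v φ) := by
      rw [Finset.sum_mul]
      exact Finset.sum_congr rfl fun b _ => by ring
    rw [h1]
    simp only [kernel, coe_aeval_eq_eval, eval_derivative_theta hu, eval_derivative_theta hv]
    simp only [thetaChart, eval_polyOf_theta_phiChart]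
    linear_combination (-(v - u) * genP l k u φ * genP l k v φ) * sum_logDer hk hu hv
  · intro φ c
    refine eq_of_sq_mul_gen_eq (finite_poles φ) fun u hu v hv huv => ?_
    rw [gen_thetaConn hl, gen_mul_diagonal_mul]
    simp only [eval_polyOf_jacobian, eval_polyOf_hessian, pd_genP (hne hu _), pd_pd_genP hv]
    set R := polyOf l fun r => jacobian (thetaChart l k) φ r c with hR
    have hRe : ∀ u ∉ poles l φ, R.eval u = logDer l k u c φ * genP l k u φ := by
      intro u hu
      rw [hR, eval_polyOf_jacobian, pd_genP (hne hu _)]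
    have h1 : ∑ b, phiForm l k b * (logDer l k u b φ * genP l k u φ) * (genP l k v φ *
        (logDer l k v b φ * logDer l k v c φ + if b = c ∧ b ≠ Fin.last l then
          twoCosh (φ b) / (v + twoCosh (φ b)) - logDer l k v b φ ^ 2 else 0)) =
        genP l k u φ * genP l k v φ * ((∑ b, phiForm l k b * logDer l k u b φ *
          logDer l k v b φ) * logDer l k v c φ + ∑ b, phiForm l k b * logDer l k u b φ *
          if b = c ∧ b ≠ Fin.last l then
          twoCosh (φ b) / (v + twoCosh (φ b)) - logDer l k v b φ ^ 2 else 0) := by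
      rw [Finset.sum_mul, ← Finset.sum_add_distrib, Finset.mul_sum]
      exact Finset.sum_congr rfl fun b _ => by ring
    rw [h1]
    simp only [kernel, coe_aeval_eq_eval, eval_derivative_theta hu, hRe u hu, hRe v hv]
    have hs := sum_logDer hk hu hv
    set Q := ∑ b, phiForm l k b * logDer l k u b φ * logDer l k v b φ
    by_cases hc : c = Fin.last l
    · have h2 : ∀ b, (phiForm l k b * logDer l k u b φ * if b = c ∧ b ≠ Fin.last l then
          twoCosh (φ b) / (v + twoCosh (φ b)) - logDer l k v b φ ^ 2 else 0) = 0 := by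
        intro b
        rw [if_neg, mul_zero]
        rintro ⟨rfl, h⟩; exact h hc
      -- Differentiation in the last coordinate only multiplies `P` by `k`.
      have h3 : R = C (k : ℂ) * polyOf l (thetaChart l k φ) := by
        refine polynomial_eq_of_eval_eq (finite_poles φ) fun u hu => ?_
        rw [hRe u hu, eval_mul, eval_C, thetaChart, eval_polyOf_theta_phiChart, logDer, if_pos hc]
      rw [Finset.sum_congr rfl fun b _ => h2 b, h3, derivative_C_mul, eval_mul,
        eval_derivative_theta hv]
      simp only [thetaChart, eval_polyOf_theta_phiChart, eval_C, logDer, if_pos hc,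
        Finset.sum_const_zero, add_zero]
      linear_combination (-(v - u) * genP l k u φ * genP l k v φ * k) * hs
    · have h2 : ∑ b, (phiForm l k b * logDer l k u b φ * if b = c ∧ b ≠ Fin.last l then
          twoCosh (φ b) / (v + twoCosh (φ b)) - logDer l k v b φ ^ 2 else 0) =
          -logDer l k u c φ * (twoCosh (φ c) / (v + twoCosh (φ c)) - logDer l k v c φ ^ 2) := by
        rw [Finset.sum_eq_single c]
        · simp [hc, phiForm]
        · intro b _ hb; simp [hb]
        · simp
      have hcu := (hne hu c).resolve_left hc
      have hcv := (hne hv c).resolve_left hc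
      set ξ := twoCosh (φ c) with hξ
      set e := Complex.exp (φ c) - Complex.exp (-φ c) with he
      have he2 : e ^ 2 = ξ ^ 2 - 4 := sq_exp_sub _
      have hL : ∀ u, logDer l k u c φ = e / (u + ξ) := fun u => by rw [logDer, if_neg hc]
      -- Here `R` is `P` with its `c`-th factor replaced by the constant `e = 2 sinh φ_c`;
      -- differentiating this relation gives `R'` in terms of `invSum`.
      have h3 : R * (X + C ξ) = C e * polyOf l (thetaChart l k φ) := by
        refine polynomial_eq_of_eval_eq (finite_poles φ) fun u hu => ?_
        have : u + ξ ≠ 0 := (hne hu c).resolve_left hc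
        rw [eval_mul, hRe u hu, eval_mul, eval_C, thetaChart, eval_polyOf_theta_phiChart, hL]
        simp only [eval_add, eval_X, eval_C]
        field_simp
      have h4 := congrArg (fun p => eval v (derivative p)) h3
      simp only [derivative_mul, derivative_C, derivative_add, derivative_X, zero_mul, zero_add,
        add_zero, mul_one, eval_add, eval_mul, eval_X, eval_C, hRe v hv,
        eval_derivative_theta hv] at h4
      have h5 : eval v (derivative R) = (e * (genP l k v φ * invSum l φ v) -
          logDer l k v c φ * genP l k v φ) / (v + ξ) := by
        rw [eq_div_iff hcv]; linear_combination h4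
      rw [h2, h5, hL u, hL v]
      simp only [thetaChart, eval_polyOf_theta_phiChart]
      have hs' : (v - u) * Q * (e / (v + ξ)) = ((v - u) * (k - l) + (4 - u ^ 2) * invSum l φ u -
        (4 - v ^ 2) * invSum l φ v) * (e / (v + ξ)) := by rw [hs]
      have h6 : (v - u) ^ 2 * (genP l k u φ * genP l k v φ * (Q * (e / (v + ξ)) +
          -(e / (u + ξ)) * (ξ / (v + ξ) - (e / (v + ξ)) ^ 2))) =
          (v - u) * genP l k u φ * genP l k v φ * (((v - u) * (k - l) + (4 - u ^ 2) * invSum l φ u -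
        (4 - v ^ 2) * invSum l φ v) * (e / (v + ξ))) - (v - u) ^ 2 * (genP l k u φ * genP l k v φ) *
        ((e / (u + ξ)) * (ξ / (v + ξ) - (ξ ^ 2 - 4) / (v + ξ) ^ 2)) := by
        rw [← hs', div_pow, he2]; ring
      rw [h6]
      field_simp
      ring

end OrbitC

end

/-! ### Linear change from `x` to `φ`, and surjectivity of the coordinate map. -/

noncomputable section

open Polynomial
open scoped ContDiff Topology Matrix

namespace OrbitC

open FlatPencil

variable {l k : ℕ}

/-! ### From the coordinates `x` to `φ` -/

/-- The matrix of the linear change of coordinates from `x` to `φ`. -/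
def phiMatrix (l : ℕ) : Matrix (Fin (l + 1)) (Fin (l + 1)) ℂ := Matrix.of fun j a =>
  2 * Real.pi * Complex.I * ((if a = j then 1 else 0) -
    if (a : ℕ) + 1 = j ∧ j ≠ Fin.last l then 1 else 0)

theorem sum_phiMatrix_mul (j : Fin (l + 1)) (f : Fin (l + 1) → ℂ) :
    ∑ a, phiMatrix l j a * f a = 2 * Real.pi * Complex.I *
      (f j - if h : (j : ℕ) = 0 ∨ j = Fin.last l then 0 else f ⟨(j : ℕ) - 1, by omega⟩) := by
  simp only [phiMatrix, Matrix.of_apply, mul_assoc, ← Finset.mul_sum, sub_mul,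
    Finset.sum_sub_distrib]
  congr 4
  · simp
  · split_ifs with h
    · refine Finset.sum_eq_zero fun a _ => ?_
      rw [if_neg, zero_mul]
      rintro ⟨h1, h2⟩
      rcases h with h | h
      · omega
      · exact h2 h
    · rw [not_or] at h
      rw [Finset.sum_eq_single ⟨(j : ℕ) - 1, by omega⟩]
      · rw [if_pos ⟨by simp only; omega, h.2⟩, one_mul]
      · intro b _ hb
        rw [if_neg, zero_mul]
        rintro ⟨h1, _⟩
        exact hb (by ext; simp only; omega)
      · simp

theorem phiMatrix_mul_dualForm (j b : Fin (l + 1)) : (phiMatrix l * dualForm l k) j b =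
    2 * Real.pi * Complex.I * if j = Fin.last l ∧ b = Fin.last l then
      -1 / (4 * k * (Real.pi : ℂ) ^ 2) else if j = Fin.last l ∨ b = Fin.last l then 0
      else if j ≤ b then 1 / (4 * (Real.pi : ℂ) ^ 2) else 0 := by
  rw [Matrix.mul_apply, sum_phiMatrix_mul]
  congr 1
  simp only [dualForm, Matrix.of_apply]
  by_cases hj : j = Fin.last l
  · simp [hj]
  · by_cases hb : b = Fin.last l
    · have : ∀ h : (j : ℕ) - 1 < l + 1, (⟨(j : ℕ) - 1, h⟩ : Fin (l + 1)) ≠ Fin.last l := by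
        intro h h'
        have := congrArg Fin.val h'
        simp only [Fin.val_last] at this
        exact hj (by ext; simp only [Fin.val_last]; omega)
      simp [hj, hb, this]
    · have h1 : ∀ h : (j : ℕ) - 1 < l + 1, (⟨(j : ℕ) - 1, h⟩ : Fin (l + 1)) ≠ Fin.last l := by
        intro h h'
        have := congrArg Fin.val h'
        simp only [Fin.val_last] at this
        exact hj (by ext; simp only [Fin.val_last]; omega)
      simp only [hj, hb, h1, and_self, or_self, if_false, or_false]
      by_cases h0 : (j : ℕ) = 0
      · have : j ≤ b := by rw [Fin.le_def]; omega
        simp [h0, this]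
      · rw [dif_neg h0]
        by_cases hjb : j ≤ b
        · have e1 : min (j : ℕ) (b : ℕ) = ((j : ℕ) - 1) + 1 := by rw [Fin.le_def] at hjb; omega
          have e2 : min ((j : ℕ) - 1) (b : ℕ) = (j : ℕ) - 1 := by rw [Fin.le_def] at hjb; omega
          rw [if_pos hjb, e1, e2]
          push_cast
          ring
        · have e1 : min (j : ℕ) (b : ℕ) = b := by rw [Fin.le_def] at hjb; omega
          have e2 : min ((j : ℕ) - 1) (b : ℕ) = b := by rw [Fin.le_def] at hjb; omega
          rw [if_neg hjb, e1, e2, sub_self]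

/-- The Gram matrix `min(s, n)` is that of partial sums of an orthonormal system, so the successive
differences are orthonormal. The factor `(2πi)² / 4π² = -1` supplies the signs. -/
theorem phiMatrix_mul_dualForm_mul (hk : 1 ≤ k) :
    phiMatrix l * dualForm l k * (phiMatrix l)ᵀ = Matrix.diagonal (phiForm l k) := by
  have hk' : (k : ℂ) ≠ 0 := by exact_mod_cast (by omega : k ≠ 0)
  have hpi : (Real.pi : ℂ) ≠ 0 := by exact_mod_cast Real.pi_ne_zero
  have hI := Complex.I_sq
  ext i j
  rw [Matrix.mul_apply]
  simp only [Matrix.transpose_apply]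
  rw [Finset.sum_congr rfl fun b _ => mul_comm _ _, sum_phiMatrix_mul]
  simp only [phiMatrix_mul_dualForm, Matrix.diagonal_apply, phiForm]
  by_cases hi : i = Fin.last l
  · by_cases hj : j = Fin.last l
    · simp only [hi, hj, and_self, if_true, or_true, dif_pos, sub_zero]
      field_simp
      rw [hI]; ring
    · have h1 : ∀ h : (j : ℕ) - 1 < l + 1, (⟨(j : ℕ) - 1, h⟩ : Fin (l + 1)) ≠ Fin.last l := by
        intro h h'
        have := congrArg Fin.val h'
        simp only [Fin.val_last] at this
        exact hj (by ext; simp only [Fin.val_last]; omega)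
      simp [hi, hj, h1, Ne.symm hj]
  · by_cases hj : j = Fin.last l
    · simp [hi, hj]
    · have h1 : ∀ h : (j : ℕ) - 1 < l + 1, (⟨(j : ℕ) - 1, h⟩ : Fin (l + 1)) ≠ Fin.last l := by
        intro h h'
        have := congrArg Fin.val h'
        simp only [Fin.val_last] at this
        exact hj (by ext; simp only [Fin.val_last]; omega)
      simp only [hi, hj, h1, and_self, or_self, if_false, or_false]
      rcases lt_trichotomy i j with h | h | h
      · have e1 : (j : ℕ) ≠ 0 := by rw [Fin.lt_def] at h; omega
        have e2 : i ≤ ⟨(j : ℕ) - 1, by omega⟩ := by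
          rw [Fin.lt_def] at h; rw [Fin.le_def]; simp only; omega
        simp [e1, e2, h.le, h.ne]
      · subst h
        have e2 : (i : ℕ) ≠ 0 → ¬ i ≤ ⟨(i : ℕ) - 1, by omega⟩ := by
          intro h0 h; rw [Fin.le_def] at h; simp only at h; omega
        by_cases e1 : (i : ℕ) = 0
        · simp only [le_refl, if_true, dif_pos e1]
          field_simp
          linear_combination 4 * hI
        · simp only [le_refl, if_true, dif_neg e1, if_neg (e2 e1)]
          field_simp
          rw [hI]; ring
      · have e2 : ¬ i ≤ ⟨(j : ℕ) - 1, by omega⟩ := by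
          intro h'; rw [Fin.lt_def] at h; rw [Fin.le_def] at h'; simp only at h'; omega
        simp [e2, not_le.mpr h, h.ne']

theorem det_phiMatrix_ne_zero (l : ℕ) : (phiMatrix l).det ≠ 0 := by
  intro h
  -- `phiMatrix` does not depend on `k`, so any admissible value serves; the right side is diagonal
  -- with nonzero entries.
  have h1 := congrArg Matrix.det (phiMatrix_mul_dualForm_mul (l := l) (k := 1) le_rfl)
  rw [Matrix.det_mul, Matrix.det_mul, h, zero_mul, zero_mul, Matrix.det_diagonal] at h1
  refine absurd h1.symm (Finset.prod_ne_zero_iff.mpr fun b _ => ?_)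
  unfold phiForm
  split_ifs <;> simp

theorem yCoord_eq (l k : ℕ) : yCoord l k = fun x => phiChart l k ((phiMatrix l).mulVec x) := by
  have hlast : ∀ x, (phiMatrix l).mulVec x (Fin.last l) = 2 * Real.pi * Complex.I * x (Fin.last l) := by
    intro x
    have := sum_phiMatrix_mul (Fin.last l) x
    rw [Matrix.mulVec, dotProduct, this]; simp
  ext x j
  unfold yCoord phiChart
  split_ifs with hj
  · rw [hlast]
  · rw [hlast]
    have hxi : xi l x = fun i : Fin l => twoCosh ((phiMatrix l).mulVec x i.castSucc) := by
      ext i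
      rw [Matrix.mulVec, dotProduct, sum_phiMatrix_mul, xi, twoCosh]
      simp [Fin.castSucc_ne_last]
    rw [hxi]
    congr 2
    ring

theorem jacobian_mulVec (A : Matrix (Fin (l + 1)) (Fin (l + 1)) ℂ) (x : Fin (l + 1) → ℂ) :
    jacobian A.mulVec x = A := by
  ext i a
  show fderiv ℂ (fun z => A.mulVec z i) x (Pi.single a 1) = _
  have h : (fun z => A.mulVec z i) =
      (LinearMap.toContinuousLinearMap ((LinearMap.proj i).comp A.mulVecLin) :
        (Fin (l + 1) → ℂ) →L[ℂ] ℂ) := by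
    ext z; simp
  rw [h, ContinuousLinearMap.fderiv]
  simp

theorem differentiable_mulVec (A : Matrix (Fin (l + 1)) (Fin (l + 1)) ℂ) :
    Differentiable ℂ A.mulVec := by
  rw [differentiable_pi]
  intro i
  unfold Matrix.mulVec dotProduct
  fun_prop

theorem pushForm_comp_phi (hk : 1 ≤ k) {F : (Fin (l + 1) → ℂ) → (Fin (l + 1) → ℂ)}
    (hF : ContDiff ℂ ∞ F) (x : Fin (l + 1) → ℂ) :
    pushForm l k (fun z => F ((phiMatrix l).mulVec z)) x =
      jacobian F ((phiMatrix l).mulVec x) * Matrix.diagonal (phiForm l k) *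
        (jacobian F ((phiMatrix l).mulVec x))ᵀ := by
  rw [pushForm, jacobian_comp (hF.contDiffAt.differentiableAt (by simp)) (differentiable_mulVec _ x),
    jacobian_mulVec, ← phiMatrix_mul_dualForm_mul hk, Matrix.transpose_mul]
  simp only [Matrix.mul_assoc]

/-! ### Surjectivity -/

theorem twoCosh_surjective : Function.Surjective twoCosh := by
  intro w
  obtain ⟨z, hz⟩ := Complex.cos_surjective (w / 2)
  refine ⟨z * Complex.I, ?_⟩
  rw [Complex.cos] at hz
  rw [twoCosh, ← neg_mul]
  linear_combination 2 * hz

theorem exists_prod_X_add_C {p : ℂ[X]} (hp : p.Monic) (hd : p.natDegree = l) :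
    ∃ ξ : Fin l → ℂ, ∏ j, (X + C (ξ j)) = p := by
  have hs := IsAlgClosed.splits p
  have hcard : Multiset.card p.roots = l := by rw [← hd]; exact hs.natDegree_eq_card_roots.symm
  have hprod := hs.eq_prod_roots_of_monic hp
  obtain ⟨L, hL⟩ := Quot.exists_rep p.roots
  have hL' : p.roots = (L : Multiset ℂ) := hL.symm
  rw [hL'] at hcard hprod
  simp only [Multiset.coe_card] at hcard
  subst hcard
  refine ⟨fun j => -L.get j, ?_⟩
  conv_rhs => rw [hprod]
  rw [Finset.prod_eq_multiset_prod]
  congr 1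
  have : (L : Multiset ℂ) = (Finset.univ : Finset (Fin L.length)).val.map L.get := by
    rw [Fin.univ_val_map, List.ofFn_get]
  conv_rhs => rw [this, Multiset.map_map]
  refine Multiset.map_congr rfl fun j _ => ?_
  simp [sub_eq_add_neg]

/-- The point with prescribed coordinates `θ^j` and last coordinate. -/
def thetaInv (l k : ℕ) (θ : Fin (l + 1) → ℂ) (s : ℂ) : Fin (l + 1) → ℂ := fun j =>
  if h : j = Fin.last l then s
  else θ (j.castPred h).succ * Complex.exp (-((k - ((j : ℕ) + 1) : ℕ) * s))

theorem thetaInv_last (θ : Fin (l + 1) → ℂ) (s : ℂ) : thetaInv l k θ s (Fin.last l) = s := by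
  simp [thetaInv]

theorem thetaInv_castSucc (θ : Fin (l + 1) → ℂ) (s : ℂ) (j : Fin l) :
    thetaInv l k θ s j.castSucc =
      θ j.succ * Complex.exp (-((k - ((j : ℕ) + 1) : ℕ) * s)) := by
  simp [thetaInv, Fin.castSucc_ne_last]

theorem theta_zero (y : Fin (l + 1) → ℂ) : theta l k y 0 = Complex.exp (k * y (Fin.last l)) := rfl

theorem theta_succ (y : Fin (l + 1) → ℂ) (j : Fin l) : theta l k y j.succ =
    y j.castSucc * Complex.exp ((k - ((j : ℕ) + 1) : ℕ) * y (Fin.last l)) := rfl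

theorem theta_thetaInv {θ : Fin (l + 1) → ℂ} {s : ℂ} (h : θ 0 = Complex.exp (k * s)) :
    theta l k (thetaInv l k θ s) = θ := by
  ext j
  refine Fin.cases ?_ (fun j => ?_) j
  · rw [theta_zero, thetaInv_last, h]
  · rw [theta_succ, thetaInv_last, thetaInv_castSucc, mul_assoc, ← Complex.exp_add]
    simp

theorem thetaInv_theta (y : Fin (l + 1) → ℂ) :
    thetaInv l k (theta l k y) (y (Fin.last l)) = y := by
  ext j
  refine Fin.lastCases ?_ (fun j => ?_) j
  · rw [thetaInv_last]
  · rw [thetaInv_castSucc, theta_succ, mul_assoc, ← Complex.exp_add]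
    simp

theorem theta_injective_of_last {y y' : Fin (l + 1) → ℂ} (h : theta l k y = theta l k y')
    (hl : y (Fin.last l) = y' (Fin.last l)) : y = y' := by
  rw [← thetaInv_theta (k := k) y, h, hl, thetaInv_theta]

theorem phiChart_last (φ : Fin (l + 1) → ℂ) : phiChart l k φ (Fin.last l) = φ (Fin.last l) := by
  simp [phiChart]

/-- Dividing `P` by `e^{k s}` makes it monic of degree `l`. It splits over `ℂ`, and every root has
the form `-2 cosh t`. -/
theorem phiChart_surjective (l k : ℕ) : Function.Surjective (phiChart l k) := by
  intro y
  set s := y (Fin.last l)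
  set e := Complex.exp (k * s) with he
  have hne : e ≠ 0 := Complex.exp_ne_zero _
  set p := polyOf l (e⁻¹ • theta l k y) with hp
  have hcoeff : p.coeff l = 1 := by
    have := coeff_polyOf l (e⁻¹ • theta l k y) 0
    rw [Fin.val_zero, Nat.sub_zero] at this
    rw [hp, this, Pi.smul_apply, theta_zero, smul_eq_mul, inv_mul_cancel₀ hne]
  have hdeg : p.natDegree = l := natDegree_eq_of_le_of_coeff_ne_zero (natDegree_polyOf_le _ _)
    (by rw [hcoeff]; exact one_ne_zero)
  have hmon : p.Monic := by rw [Monic, leadingCoeff, hdeg, hcoeff]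
  obtain ⟨ξ, hξ⟩ := exists_prod_X_add_C hmon hdeg
  choose t ht using fun j => twoCosh_surjective (ξ j)
  refine ⟨fun j => if h : j = Fin.last l then s else t (j.castPred h), ?_⟩
  refine theta_injective_of_last (k := k) (polyOf_injective l ?_) (by simp [phiChart_last, s])
  rw [polyOf_theta_phiChart]
  simp only [dif_pos, Fin.castSucc_ne_last, dif_neg, not_false_eq_true, Fin.castPred_castSucc, ht]
  rw [hξ, hp, polyOf_smul, ← mul_assoc, ← C_mul, ← he, mul_inv_cancel₀ hne, C_1, one_mul]

theorem mulVec_phiMatrix_surjective (l : ℕ) : Function.Surjective (phiMatrix l).mulVec := by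
  intro y
  refine ⟨(phiMatrix l)⁻¹.mulVec y, ?_⟩
  rw [Matrix.mulVec_mulVec, Matrix.mul_nonsing_inv _ (isUnit_iff_ne_zero.mpr
    (det_phiMatrix_ne_zero l)), Matrix.one_mulVec]

theorem yCoord_surjective (l k : ℕ) : Function.Surjective (yCoord l k) := by
  rw [yCoord_eq]
  exact (phiChart_surjective l k).comp (mulVec_phiMatrix_surjective l)

end OrbitC

end

/-! ### The metric in the coordinates `y` and its translates along `e`. -/

noncomputable section

open Polynomial
open scoped ContDiff Topology Matrix

namespace OrbitC

open FlatPencil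

variable {l k : ℕ}

/-! ### The Jacobian of the coordinates `θ` -/

theorem differentiableAt_theta_apply (y : Fin (l + 1) → ℂ) (j : Fin (l + 1)) :
    DifferentiableAt ℂ (fun z => theta l k z j) y :=
  ((contDiff_pi.mp (contDiff_theta l k) j).contDiffAt).differentiableAt (by simp)

theorem jacobian_theta_zero_last (y : Fin (l + 1) → ℂ) :
    jacobian (theta l k) y 0 (Fin.last l) = k * Complex.exp (k * y (Fin.last l)) := by
  refine pd_eq_of_hasDerivAt (differentiableAt_theta_apply y 0) ?_
  simp only [theta_zero, Function.update_self]
  exact ((hasDerivAt_id (y (Fin.last l))).const_mul (k : ℂ)).cexp.congr_deriv (by simp; ring)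

theorem jacobian_theta_zero_castSucc (y : Fin (l + 1) → ℂ) (j : Fin l) :
    jacobian (theta l k) y 0 j.castSucc = 0 := by
  refine pd_eq_of_hasDerivAt (differentiableAt_theta_apply y 0) ?_
  simp only [theta_zero, Function.update_of_ne (Fin.castSucc_ne_last j).symm]
  exact hasDerivAt_const _ _

theorem jacobian_theta_succ_last (y : Fin (l + 1) → ℂ) (i : Fin l) :
    jacobian (theta l k) y i.succ (Fin.last l) = ((k - ((i : ℕ) + 1) : ℕ) : ℂ) * y i.castSucc *
      Complex.exp ((k - ((i : ℕ) + 1) : ℕ) * y (Fin.last l)) := by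
  refine pd_eq_of_hasDerivAt (differentiableAt_theta_apply y i.succ) ?_
  simp only [theta_succ, Function.update_self, Function.update_of_ne (Fin.castSucc_ne_last i)]
  exact (((hasDerivAt_id (y (Fin.last l))).const_mul
    ((k - ((i : ℕ) + 1) : ℕ) : ℂ)).cexp.const_mul (y i.castSucc)).congr_deriv (by simp; ring)

theorem jacobian_theta_succ_castSucc (y : Fin (l + 1) → ℂ) (i j : Fin l) :
    jacobian (theta l k) y i.succ j.castSucc = if i = j then
      Complex.exp ((k - ((i : ℕ) + 1) : ℕ) * y (Fin.last l)) else 0 := by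
  refine pd_eq_of_hasDerivAt (differentiableAt_theta_apply y i.succ) ?_
  simp only [theta_succ, Function.update_of_ne (Fin.castSucc_ne_last j).symm]
  split_ifs with h
  · subst h
    simp only [Function.update_self]
    simpa using (hasDerivAt_id (y i.castSucc)).mul_const
      (Complex.exp ((k - ((i : ℕ) + 1) : ℕ) * y (Fin.last l)))
  · simp only [Function.update_of_ne ((Fin.castSucc_injective l).ne h)]
    exact hasDerivAt_const _ _

theorem det_jacobian_theta (y : Fin (l + 1) → ℂ) : (jacobian (theta l k) y).det =
    (-1) ^ l * (k * Complex.exp (k * y (Fin.last l))) *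
      ∏ j : Fin l, Complex.exp ((k - ((j : ℕ) + 1) : ℕ) * y (Fin.last l)) := by
  rw [Matrix.det_succ_row_zero, Finset.sum_eq_single (Fin.last l)]
  · rw [jacobian_theta_zero_last, Fin.val_last]
    congr 1
    have h1 : (jacobian (theta l k) y).submatrix Fin.succ (Fin.last l).succAbove =
        Matrix.diagonal fun j : Fin l => Complex.exp ((k - ((j : ℕ) + 1) : ℕ) * y (Fin.last l)) := by
      ext i j
      rw [Matrix.submatrix_apply, Fin.succAbove_last, jacobian_theta_succ_castSucc,
        Matrix.diagonal_apply]
    rw [h1, Matrix.det_diagonal]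
  · intro b _ hb
    obtain ⟨b, rfl⟩ := Fin.exists_castSucc_eq.mpr hb
    rw [jacobian_theta_zero_castSucc]; simp
  · simp

theorem det_jacobian_theta_ne_zero (hk : 1 ≤ k) (y : Fin (l + 1) → ℂ) :
    (jacobian (theta l k) y).det ≠ 0 := by
  rw [det_jacobian_theta]
  have hk' : (k : ℂ) ≠ 0 := by exact_mod_cast (by omega : k ≠ 0)
  exact mul_ne_zero (mul_ne_zero (pow_ne_zero _ (by simp)) (mul_ne_zero hk' (Complex.exp_ne_zero _)))
    (Finset.prod_ne_zero_iff.mpr fun _ _ => Complex.exp_ne_zero _)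

/-! ### The orbit metric -/

/-- The metric in the coordinates `y`. -/
def yMetric (l k : ℕ) : (Fin (l + 1) → ℂ) → Matrix (Fin (l + 1)) (Fin (l + 1)) ℂ :=
  pullMetric (theta l k) (thetaMetric l k)

/-- The contravariant connection in the coordinates `y`. -/
def yConn (l k : ℕ) : (Fin (l + 1) → ℂ) → Fin (l + 1) → Matrix (Fin (l + 1)) (Fin (l + 1)) ℂ :=
  pullConn (theta l k) (thetaMetric l k) (thetaConn l k)

theorem smoothAt_thetaConn (y : Fin (l + 1) → ℂ) (r : Fin (l + 1)) :
    SmoothAt (fun θ => thetaConn l k θ r) y := by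
  unfold thetaConn
  exact SmoothAt.sum _ fun a => SmoothAt.smul (contDiff_apply ℂ ℂ a).contDiffAt (smoothAt_const _ _)

theorem smoothAt_thetaMetric (y : Fin (l + 1) → ℂ) : SmoothAt (thetaMetric l k) y :=
  SmoothAt.sum _ fun r => SmoothAt.smul (contDiff_apply ℂ ℂ r).contDiffAt (smoothAt_thetaConn y r)

theorem isFlatChart_phiChart (hk : 1 ≤ k) (hkl : k ≤ l) :
    IsFlatChart (phiChart l k) (Matrix.diagonal (phiForm l k)) (yMetric l k) (yConn l k) :=
  IsFlatChart.pull (contDiff_theta l k) (det_jacobian_theta_ne_zero hk) (contDiff_phiChart l k)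
    (isFlatChart_theta hk hkl)

theorem pushForm_yCoord (hk : 1 ≤ k) (hkl : k ≤ l) (x : Fin (l + 1) → ℂ) :
    pushForm l k (yCoord l k) x = yMetric l k (yCoord l k x) := by
  rw [yCoord_eq, pushForm_comp_phi hk (contDiff_phiChart l k), (isFlatChart_phiChart hk hkl).metric]

theorem pushForm_theta_yCoord (hk : 1 ≤ k) (hkl : k ≤ l) (x : Fin (l + 1) → ℂ) :
    pushForm l k (fun z => theta l k (yCoord l k z)) x =
      thetaMetric l k (theta l k (yCoord l k x)) := by
  have h := (isFlatChart_theta hk hkl).metric ((phiMatrix l).mulVec x)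
  rw [yCoord_eq]
  exact (pushForm_comp_phi hk (contDiff_thetaChart l k) x).trans h.symm

theorem orbitMetric_eq (hk : 1 ≤ k) (hkl : k ≤ l) : orbitMetric l k = yMetric l k := by
  ext1 y
  rw [orbitMetric, pushForm_yCoord hk hkl, Function.rightInverse_invFun (yCoord_surjective l k)]

theorem orbitMetric_yCoord (hk : 1 ≤ k) (hkl : k ≤ l) (x : Fin (l + 1) → ℂ) :
    orbitMetric l k (yCoord l k x) = pushForm l k (yCoord l k) x := by
  rw [pushForm_yCoord hk hkl, orbitMetric_eq hk hkl]

theorem exp_natCast_mul_eq {s s' : ℂ} (h : Complex.exp s = Complex.exp s') (d : ℕ) :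
    Complex.exp (d * s) = Complex.exp (d * s') := by
  rw [Complex.exp_nat_mul, Complex.exp_nat_mul, h]

theorem theta_congr {y y' : Fin (l + 1) → ℂ} (h : ∀ j : Fin l, y j.castSucc = y' j.castSucc)
    (he : Complex.exp (y (Fin.last l)) = Complex.exp (y' (Fin.last l))) :
    theta l k y = theta l k y' := by
  ext j
  refine Fin.cases ?_ (fun j => ?_) j
  · rw [theta_zero, theta_zero, exp_natCast_mul_eq he]
  · rw [theta_succ, theta_succ, exp_natCast_mul_eq he, h]

/-- For `j ≥ k` the exponent in `θ^j` is zero, so the Jacobian involves only `y^1, …, y^{k-1}` and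
`e^{y^{l+1}}`. In particular it does not change along `e`, whose components with index below `k`
vanish. -/
theorem jacobian_theta_congr {y y' : Fin (l + 1) → ℂ}
    (h : ∀ j : Fin l, (j : ℕ) + 1 < k → y j.castSucc = y' j.castSucc)
    (he : Complex.exp (y (Fin.last l)) = Complex.exp (y' (Fin.last l))) :
    jacobian (theta l k) y = jacobian (theta l k) y' := by
  ext i j
  refine Fin.cases ?_ (fun i => ?_) i <;> refine Fin.lastCases ?_ (fun j => ?_) j
  · rw [jacobian_theta_zero_last, jacobian_theta_zero_last, exp_natCast_mul_eq he]
  · rw [jacobian_theta_zero_castSucc, jacobian_theta_zero_castSucc]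
  · rw [jacobian_theta_succ_last, jacobian_theta_succ_last, exp_natCast_mul_eq he]
    by_cases hi : (i : ℕ) + 1 < k
    · rw [h i hi]
    · rw [Nat.sub_eq_zero_of_le (by omega)]; simp
  · rw [jacobian_theta_succ_castSucc, jacobian_theta_succ_castSucc, exp_natCast_mul_eq he]

theorem yMetric_congr {y y' : Fin (l + 1) → ℂ} (h : ∀ j : Fin l, y j.castSucc = y' j.castSucc)
    (he : Complex.exp (y (Fin.last l)) = Complex.exp (y' (Fin.last l))) :
    yMetric l k y = yMetric l k y' := by
  unfold yMetric pullMetric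
  rw [theta_congr h he, jacobian_theta_congr (fun j _ => h j) he]

theorem orbitMetric_periodic (hk : 1 ≤ k) (hkl : k ≤ l) (y : Fin (l + 1) → ℂ) :
    orbitMetric l k (y + Pi.single (Fin.last l) (2 * Real.pi * Complex.I)) = orbitMetric l k y := by
  rw [orbitMetric_eq hk hkl]
  refine yMetric_congr (fun j => ?_) ?_
  · simp [Fin.castSucc_ne_last]
  · simp [Complex.exp_periodic _]

/-! ### Translations -/

theorem natDegree_shiftPoly {m : ℕ} (hm : m ≤ l - k) : (shiftPoly l k m).natDegree = l - k := by
  unfold shiftPoly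
  rw [((monic_X_add_C (2 : ℂ)).pow m).natDegree_mul ((monic_X_sub_C (2 : ℂ)).pow _),
    (monic_X_add_C (2 : ℂ)).natDegree_pow, (monic_X_sub_C (2 : ℂ)).natDegree_pow,
    natDegree_X_add_C, natDegree_X_sub_C]
  omega

/-- The vector field `e` in the coordinates `θ`. -/
def shiftVec (l k m : ℕ) : Fin (l + 1) → ℂ := fun j => (shiftPoly l k m).coeff (l - (j : ℕ))

theorem polyOf_shiftVec {m : ℕ} (hm : m ≤ l - k) : polyOf l (shiftVec l k m) = shiftPoly l k m :=
  polyOf_coeff ((natDegree_shiftPoly hm).le.trans (Nat.sub_le l k))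

theorem shiftVec_eq_zero {m : ℕ} (hm : m ≤ l - k) {j : Fin (l + 1)} (hkl : k ≤ l) (hj : (j : ℕ) < k) :
    shiftVec l k m j = 0 := by
  refine coeff_eq_zero_of_natDegree_lt ?_
  rw [natDegree_shiftPoly hm]
  omega

theorem unityField_last (m : ℕ) : unityField l k m (Fin.last l) = 0 := by
  simp [unityField]

theorem unityField_castSucc (m : ℕ) (j : Fin l) : unityField l k m j.castSucc =
    if k ≤ (j : ℕ) + 1 then shiftVec l k m j.succ else 0 := by
  have := j.2
  simp only [unityField, shiftVec, Fin.val_castSucc, Fin.val_succ]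
  congr 1
  simp

theorem theta_add_unityField (hk : 1 ≤ k) (hkl : k ≤ l) {m : ℕ} (hm : m ≤ l - k)
    (y : Fin (l + 1) → ℂ) (t : ℂ) :
    theta l k (y + t • unityField l k m) = theta l k y + t • shiftVec l k m := by
  ext j
  refine Fin.cases ?_ (fun j => ?_) j
  · simp [theta_zero, unityField_last, shiftVec_eq_zero hm hkl (j := 0) (by simpa using Nat.lt_of_succ_le hk)]
  · simp only [theta_succ, Pi.add_apply, Pi.smul_apply, unityField_last, unityField_castSucc,
      smul_eq_mul, mul_zero, add_zero]
    split_ifs with h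
    · rw [Nat.sub_eq_zero_of_le h]; simp
    · rw [shiftVec_eq_zero hm hkl (by simp; omega)]; simp

theorem jacobian_theta_add_unityField {m : ℕ} (y : Fin (l + 1) → ℂ) (t : ℂ) :
    jacobian (theta l k) (y + t • unityField l k m) = jacobian (theta l k) y := by
  refine jacobian_theta_congr (fun j hj => ?_) ?_
  · simp only [Pi.add_apply, Pi.smul_apply, unityField_castSucc]
    rw [if_neg (by omega)]; simp
  · simp [unityField_last]

theorem mulVec_jacobian_theta_unityField (hk : 1 ≤ k) (hkl : k ≤ l) {m : ℕ} (hm : m ≤ l - k)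
    (y : Fin (l + 1) → ℂ) (j : Fin (l + 1)) :
    (jacobian (theta l k) y).mulVec (unityField l k m) j = shiftVec l k m j := by
  rw [Matrix.mulVec, dotProduct, Fin.sum_univ_castSucc, unityField_last, mul_zero, add_zero]
  refine Fin.cases ?_ (fun j => ?_) j
  · simp [jacobian_theta_zero_castSucc, shiftVec_eq_zero hm hkl (j := 0) (by simpa using Nat.lt_of_succ_le hk)]
  · simp only [jacobian_theta_succ_castSucc, unityField_castSucc, ite_mul, zero_mul,
      Finset.sum_ite_eq, Finset.mem_univ, if_true]
    split_ifs with h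
    · rw [Nat.sub_eq_zero_of_le h]; simp
    · rw [shiftVec_eq_zero hm hkl (by simp; omega)]; simp

/-- The factor `4 - X² = -(X + 2)(X - 2)` clears the simple poles of `P₀'/P₀` at `±2`. -/
theorem shiftPoly_derivative (l k m : ℕ) :
    (4 - X ^ 2) * derivative (shiftPoly l k m) = shiftPoly l k m *
      (C (2 * (m - ((l - k - m : ℕ) : ℂ))) - C (m + ((l - k - m : ℕ) : ℂ)) * X) := by
  have h : ∀ (a : ℂ) (d : ℕ), (X + C a) * derivative ((X + C a) ^ d) = C (d : ℂ) * (X + C a) ^ d := by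
    intro a d
    rw [derivative_pow, derivative_X_add_C, mul_one]
    rcases d with _ | d
    · simp
    · rw [Nat.add_sub_cancel]; ring
  have h1 := h 2 m
  have h2 := h (-2) (l - k - m)
  rw [show X + C (-2 : ℂ) = X - C 2 by rw [C_neg, sub_eq_add_neg]] at h2
  unfold shiftPoly
  rw [derivative_mul]
  simp only [C_mul, C_sub, C_add]
  have e4 : (4 : ℂ[X]) = C 2 * C 2 := by
    rw [← C_mul]; norm_num; exact (map_ofNat C 4).symm
  rw [e4]
  linear_combination (-(X - C 2) ^ (l - k - m + 1)) * h1 - ((X + C 2) ^ (m + 1)) * h2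

/-- Since `(4 - u²) P₀'/P₀` is affine with slope `-(l - k)`, its difference at `u` and `v` cancels
the term `(k - l)(v - u)`. This kills the quadratic term of the metric along `e`. -/
theorem kernel_shiftPoly {m : ℕ} (hkl : k ≤ l) (hm : m ≤ l - k) (u v : ℂ) :
    kernel l k (shiftPoly l k m) (shiftPoly l k m) u v = 0 := by
  have hev : ∀ u : ℂ, (4 - u ^ 2) * (derivative (shiftPoly l k m)).eval u =
      (shiftPoly l k m).eval u * (2 * (m - ((l - k - m : ℕ) : ℂ)) -
        (m + ((l - k - m : ℕ) : ℂ)) * u) := by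
    intro u
    simpa using congrArg (eval u) (shiftPoly_derivative l k m)
  have hl : (l : ℂ) = k + m + ((l - k - m : ℕ) : ℂ) := by
    rw [← Nat.cast_add, ← Nat.cast_add]; congr 1; omega
  simp only [kernel, coe_aeval_eq_eval, hl]
  linear_combination (eval v (shiftPoly l k m) * (v - u)) * hev u -
    (eval u (shiftPoly l k m) * (v - u)) * hev v

/-- The derivative of the metric along `e` in the coordinates `θ`. -/
def thetaEta (l k m : ℕ) (θ : Fin (l + 1) → ℂ) : Matrix (Fin (l + 1)) (Fin (l + 1)) ℂ :=
  ∑ r, shiftVec l k m r • thetaConn l k θ r + ∑ r, θ r • thetaConn l k (shiftVec l k m) r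

theorem thetaConn_add_smul (θ c : Fin (l + 1) → ℂ) (t : ℂ) :
    thetaConn l k (θ + t • c) = thetaConn l k θ + t • thetaConn l k c := by
  ext1 r
  simp only [thetaConn, Pi.add_apply, Pi.smul_apply, add_smul, Finset.sum_add_distrib,
    Finset.smul_sum, smul_assoc]

theorem thetaMetric_add_smul (θ c : Fin (l + 1) → ℂ) (t : ℂ) :
    thetaMetric l k (θ + t • c) = thetaMetric l k θ +
      t • (∑ r, c r • thetaConn l k θ r + ∑ r, θ r • thetaConn l k c r) +
      t ^ 2 • thetaMetric l k c := by
  simp only [thetaMetric, thetaConn_add_smul, Pi.add_apply, Pi.smul_apply, smul_add, Finset.smul_sum,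
    ← Finset.sum_add_distrib, smul_eq_mul]
  exact Finset.sum_congr rfl fun r _ => by module

theorem thetaMetric_shiftVec (hk : 1 ≤ k) (hkl : k ≤ l) {m : ℕ} (hm : m ≤ l - k) :
    thetaMetric l k (shiftVec l k m) = 0 := by
  refine eq_of_sq_mul_gen_eq Set.finite_empty fun u _ v _ _ => ?_
  rw [gen_thetaMetric (hk.trans hkl), polyOf_shiftVec hm, kernel_shiftPoly hkl hm, gen_zero, mul_zero]

/-- The derivative of the metric along `e` in the coordinates `y`. -/
def yEta (l k m : ℕ) : (Fin (l + 1) → ℂ) → Matrix (Fin (l + 1)) (Fin (l + 1)) ℂ :=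
  pullMetric (theta l k) (thetaEta l k m)

theorem yMetric_add_smul (hk : 1 ≤ k) (hkl : k ≤ l) {m : ℕ} (hm : m ≤ l - k)
    (y : Fin (l + 1) → ℂ) (t : ℂ) :
    yMetric l k (y + t • unityField l k m) = yMetric l k y + t • yEta l k m y := by
  simp only [yMetric, yEta, pullMetric, jacobian_theta_add_unityField, theta_add_unityField hk hkl hm,
    thetaMetric_add_smul, thetaMetric_shiftVec hk hkl hm, smul_zero, add_zero, Matrix.mul_add,
    Matrix.add_mul, Matrix.mul_smul, Matrix.smul_mul, thetaEta]

theorem yConn_add_smul (hk : 1 ≤ k) (hkl : k ≤ l) {m : ℕ} (hm : m ≤ l - k)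
    (y : Fin (l + 1) → ℂ) (t : ℂ) :
    yConn l k (y + t • unityField l k m) =
      yConn l k y + t • (yConn l k (y + unityField l k m) - yConn l k y) := by
  have hmpd : ∀ (t : ℂ) r, mpd (jacobian (theta l k)) r (y + t • unityField l k m) =
      mpd (jacobian (theta l k)) r y := by
    intro t r
    rw [← mpd_add_right]
    exact mpd_congr (Filter.Eventually.of_forall fun z => jacobian_theta_add_unityField z t) r
  have key : ∀ t : ℂ, ∀ r, yConn l k (y + t • unityField l k m) r = yConn l k y r + t •
      ((jacobian (theta l k) y)⁻¹ * (∑ s, jacobian (theta l k) y s r •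
        thetaConn l k (shiftVec l k m) s) * ((jacobian (theta l k) y)⁻¹)ᵀ -
      yEta l k m y * (mpd (jacobian (theta l k)) r y)ᵀ * ((jacobian (theta l k) y)⁻¹)ᵀ) := by
    intro t r
    have h1 := yMetric_add_smul hk hkl hm y t
    unfold yMetric at h1
    simp only [yConn, pullConn, h1, hmpd, jacobian_theta_add_unityField,
      theta_add_unityField hk hkl hm, thetaConn_add_smul, Pi.add_apply, Pi.smul_apply]
    simp only [smul_add, Finset.sum_add_distrib, Matrix.mul_add, Matrix.add_mul, smul_sub,
      smul_comm _ t, ← Finset.smul_sum, Matrix.mul_smul, Matrix.smul_mul]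
    abel
  ext1 r
  have h1 := key 1 r
  -- The explicit slope of the affine function in `key` is identified with the difference of its
  -- values at `t = 1` and `t = 0`.
  rw [one_smul, one_smul] at h1
  rw [key, Pi.add_apply, Pi.smul_apply, Pi.sub_apply, h1, add_sub_cancel_left]

theorem smoothAt_yMetric (hk : 1 ≤ k) (y : Fin (l + 1) → ℂ) : SmoothAt (yMetric l k) y :=
  smoothAt_pullMetric (contDiff_theta l k) (det_jacobian_theta_ne_zero hk) smoothAt_thetaMetric y

/-- The components of `e` are constant in `y`, so the Lie derivative is the directional derivative,
which is the slope of the affine function in `yMetric_add_smul`. -/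
theorem orbitEta_eq (hk : 1 ≤ k) (hkl : k ≤ l) {m : ℕ} (hm : m ≤ l - k) :
    orbitEta l k m = yEta l k m := by
  ext y i j
  rw [orbitEta, orbitMetric_eq hk hkl]
  simp only [lieDeriv, Matrix.of_apply, pd_const, mul_zero, sub_zero]
  have hd := (smoothAt_yMetric (l := l) hk y).diff i j
  have h1 : HasDerivAt (fun t : ℂ => yMetric l k (y + t • unityField l k m) i j)
      (fderiv ℂ (fun z => yMetric l k z i j) y (unityField l k m)) 0 := by
    have h2 : HasDerivAt (fun t : ℂ => y + t • unityField l k m) (unityField l k m) 0 := by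
      simpa using ((hasDerivAt_id (0 : ℂ)).smul_const (unityField l k m)).const_add y
    have h3 : HasFDerivAt (fun z => yMetric l k z i j) (fderiv ℂ (fun z => yMetric l k z i j) y)
        (y + (0 : ℂ) • unityField l k m) := by simpa using hd.hasFDerivAt
    exact h3.comp_hasDerivAt (0 : ℂ) h2
  have h4 : HasDerivAt (fun t : ℂ => yMetric l k (y + t • unityField l k m) i j)
      (yEta l k m y i j) 0 := by
    simp only [yMetric_add_smul hk hkl hm, Matrix.add_apply, Matrix.smul_apply, smul_eq_mul]
    simpa using ((hasDerivAt_id (0 : ℂ)).mul_const (yEta l k m y i j)).const_add (yMetric l k y i j)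
  rw [h4.unique h1, fderiv_eq_sum_pd]
  exact Finset.sum_congr rfl fun s _ => mul_comm _ _

theorem isFlatPencil_orbit (hk : 1 ≤ k) (hkl : k ≤ l) {m : ℕ} (hm : m ≤ l - k)
    (hne : ∃ y, (orbitEta l k m y).det ≠ 0) :
    IsFlatPencil {y | (orbitEta l k m y).det ≠ 0} (orbitMetric l k) (orbitEta l k m) := by
  have hs := smoothAt_pullConn (g := thetaMetric l k) (Γ := thetaConn l k) (contDiff_theta l k)
    (det_jacobian_theta_ne_zero hk) smoothAt_thetaMetric smoothAt_thetaConn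
  rw [orbitMetric_eq hk hkl]
  refine isFlatPencil_of_translation (Γ := yConn l k) (e := unityField l k m)
    (smoothAt_yMetric hk) hs
    (isSymm_pullMetric (isSymm_thetaMetric (hk.trans hkl))) ?_ ?_ (yConn_add_smul hk hkl hm) hne
  · intro y hd
    -- The chart is onto, and nondegeneracy of the metric at `y` makes its Jacobian invertible at
    -- any preimage.
    obtain ⟨φ, rfl⟩ := phiChart_surjective l k y
    exact (isFlatChart_phiChart hk hkl).flatAt (contDiff_phiChart l k)
      (Matrix.isSymm_diagonal _) φ (smoothAt_yMetric hk _) (hs _) hd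
  · intro y t
    rw [orbitEta_eq hk hkl hm, yMetric_add_smul hk hkl hm]

end OrbitC

end

/-! ### Orbits: permutations, signs and integer translations. -/

noncomputable section

open Polynomial
open scoped ContDiff Topology Matrix

namespace OrbitC

open FlatPencil

variable {l k : ℕ}

/-! ### Orbits of the extended affine Weyl group -/

theorem simpleCoroot_apply (j i : Fin l) :
    simpleCoroot l j i = (if i = j then 1 else 0) - if (i : ℕ) = (j : ℕ) + 1 then 1 else 0 := by
  have hdot : simpleRoot l j ⬝ᵥ simpleRoot l j = if (j : ℕ) + 1 = l then 4 else 2 := by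
    rw [dotProduct]
    split_ifs with h
    · rw [Finset.sum_eq_single j]
      · simp [simpleRoot, h]; norm_num
      · intro b _ hb
        have : (b : ℕ) ≠ (j : ℕ) + 1 := by omega
        simp [simpleRoot, hb, this]
      · simp
    · have hj : (j : ℕ) + 1 < l := by omega
      have hne : j ≠ ⟨(j : ℕ) + 1, hj⟩ := by
        intro h'; have := congrArg Fin.val h'; simp at this
      rw [Fintype.sum_eq_add j ⟨(j : ℕ) + 1, hj⟩ hne]
      · simp [simpleRoot, h, Ne.symm hne]; norm_num
      · rintro b ⟨h1, h2⟩
        have : (b : ℕ) ≠ (j : ℕ) + 1 := fun h' => h2 (Fin.ext h')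
        simp [simpleRoot, h1, this]
  rw [simpleCoroot, hdot, Pi.smul_apply, smul_eq_mul, simpleRoot]
  by_cases hij : i = j
  · subst hij
    split_ifs <;> norm_num
    all_goals omega
  · by_cases hi : (i : ℕ) = (j : ℕ) + 1
    · have : (j : ℕ) + 1 ≠ l := by omega
      simp [hij, hi, this]
    · simp [hij, hi]

theorem phiMatrix_mulVec_castSucc (x : Fin (l + 1) → ℂ) (i : Fin l) :
    (phiMatrix l).mulVec x i.castSucc = 2 * Real.pi * Complex.I * vec l x i := by
  rw [Matrix.mulVec, dotProduct, sum_phiMatrix_mul]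
  congr 1
  rw [vec, Finset.sum_apply]
  simp only [Pi.smul_apply, simpleCoroot_apply, smul_eq_mul, mul_sub, Finset.sum_sub_distrib,
    mul_ite, mul_one, mul_zero, Finset.sum_ite_eq, Finset.mem_univ, if_true]
  congr 1
  split_ifs with h
  · rcases h with h | h
    · rw [Finset.sum_eq_zero]
      intro b _
      rw [if_neg]
      rw [Fin.val_castSucc] at h
      omega
    · exact absurd h (Fin.castSucc_ne_last i)
  · rw [not_or, Fin.val_castSucc] at h
    rw [Finset.sum_eq_single ⟨(i : ℕ) - 1, by omega⟩]
    · rw [if_pos (by simp only; omega)]; rfl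
    · intro b _ hb
      rw [if_neg]
      intro h'
      exact hb (Fin.ext (by simp only; omega))
    · simp

theorem phiMatrix_mulVec_last (x : Fin (l + 1) → ℂ) :
    (phiMatrix l).mulVec x (Fin.last l) = 2 * Real.pi * Complex.I * x (Fin.last l) := by
  rw [Matrix.mulVec, dotProduct, sum_phiMatrix_mul]; simp

/-- Up to the factor `2πi` this map is the invertible matrix `phiMatrix`; it identifies `x` with
`(𝐱, x_{l+1})`, where the generators act in the simplest form. -/
theorem bijective_split (l : ℕ) : Function.Bijective
    (fun x : Fin (l + 1) → ℂ => (vec l x, x (Fin.last l))) := by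
  constructor
  · intro x x' h
    simp only [Prod.mk.injEq] at h
    refine Matrix.mulVec_injective_of_det_ne_zero (det_phiMatrix_ne_zero l) ?_
    ext j
    refine Fin.lastCases ?_ (fun j => ?_) j
    · rw [phiMatrix_mulVec_last, phiMatrix_mulVec_last, h.2]
    · rw [phiMatrix_mulVec_castSucc, phiMatrix_mulVec_castSucc, h.1]
  · rintro ⟨v, s⟩
    obtain ⟨x, hx⟩ := mulVec_phiMatrix_surjective l fun j => 2 * Real.pi * Complex.I *
      Fin.lastCases (motive := fun _ => ℂ) s v j
    refine ⟨x, ?_⟩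
    ext j
    · have := congrFun hx j.castSucc
      rw [phiMatrix_mulVec_castSucc, Fin.lastCases_castSucc] at this
      exact mul_left_cancel₀ Complex.two_pi_I_ne_zero this
    · have := congrFun hx (Fin.last l)
      rw [phiMatrix_mulVec_last, Fin.lastCases_last] at this
      exact mul_left_cancel₀ Complex.two_pi_I_ne_zero this

/-- The point `x` corresponds to the pair `(𝐱, x_{l+1})`. -/
def splitEquiv (l : ℕ) : (Fin (l + 1) → ℂ) ≃ (Fin l → ℂ) × ℂ :=
  Equiv.ofBijective _ (bijective_split l)

/-- Two points of `V_ℂ ⊕ ℂ` lie in the same orbit. -/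
def SameOrbit (l k : ℕ) (p q : (Fin l → ℂ) × ℂ) : Prop :=
  ∃ w ∈ extAffineWeyl l k, w ((splitEquiv l).symm p) = (splitEquiv l).symm q

theorem SameOrbit.refl (p : (Fin l → ℂ) × ℂ) : SameOrbit l k p p :=
  ⟨1, one_mem _, rfl⟩

theorem SameOrbit.symm {p q : (Fin l → ℂ) × ℂ} (h : SameOrbit l k p q) : SameOrbit l k q p := by
  obtain ⟨w, hw, h⟩ := h
  exact ⟨w⁻¹, inv_mem hw, by rw [← h]; simp⟩

theorem SameOrbit.trans {p q r : (Fin l → ℂ) × ℂ} (h : SameOrbit l k p q)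
    (h' : SameOrbit l k q r) : SameOrbit l k p r := by
  obtain ⟨w, hw, h⟩ := h
  obtain ⟨w', hw', h'⟩ := h'
  exact ⟨w' * w, mul_mem hw' hw, by rw [Equiv.Perm.mul_apply, h, h']⟩

theorem sameOrbit_of_perm (T : Equiv.Perm ((Fin l → ℂ) × ℂ))
    (h : ((splitEquiv l).trans T).trans (splitEquiv l).symm ∈ extAffineWeyl l k)
    (p : (Fin l → ℂ) × ℂ) : SameOrbit l k p (T p) :=
  ⟨_, h, by simp⟩

theorem splitEquiv_apply_fst (x : Fin (l + 1) → ℂ) : (splitEquiv l x).1 = vec l x := rfl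

theorem splitEquiv_apply_snd (x : Fin (l + 1) → ℂ) : (splitEquiv l x).2 = x (Fin.last l) := rfl

theorem vec_splitEquiv_symm (p : (Fin l → ℂ) × ℂ) : vec l ((splitEquiv l).symm p) = p.1 := by
  rw [← splitEquiv_apply_fst, Equiv.apply_symm_apply]

theorem last_splitEquiv_symm (p : (Fin l → ℂ) × ℂ) :
    (splitEquiv l).symm p (Fin.last l) = p.2 := by
  have h := splitEquiv_apply_snd ((splitEquiv l).symm p)
  rw [Equiv.apply_symm_apply] at h
  exact h.symm

/-- Being an involution, the reflection defines a permutation of the whole space, as membership in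
the group requires. -/
theorem sameOrbit_of_involutive (j : Fin l) (hT : Function.Involutive (simpleReflection l j))
    (v : Fin l → ℂ) (s : ℂ) : SameOrbit l k (v, s) (simpleReflection l j v, s) := by
  refine sameOrbit_of_perm ((hT.toPerm _).prodCongr (Equiv.refl ℂ)) (Subgroup.subset_closure
    (Or.inl (Or.inl ⟨j, fun x => ⟨?_, ?_⟩⟩))) (v, s)
  · simp only [Equiv.trans_apply, vec_splitEquiv_symm]; rfl
  · simp only [Equiv.trans_apply, last_splitEquiv_symm]; rfl

theorem sameOrbit_add_coroot (j : Fin l) (v : Fin l → ℂ) (s : ℂ) :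
    SameOrbit l k (v, s) (v + simpleCoroot l j, s) := by
  refine sameOrbit_of_perm ((Equiv.addRight (simpleCoroot l j)).prodCongr (Equiv.refl ℂ))
    (Subgroup.subset_closure (Or.inl (Or.inr ⟨j, fun x => ⟨?_, ?_⟩⟩))) (v, s)
  · simp only [Equiv.trans_apply, vec_splitEquiv_symm]; rfl
  · simp only [Equiv.trans_apply, last_splitEquiv_symm]; rfl

theorem sameOrbit_add_fundWeight (v : Fin l → ℂ) (s : ℂ) :
    SameOrbit l k (v, s) (v + fundWeight l k, s - 1) := by
  refine sameOrbit_of_perm ((Equiv.addRight (fundWeight l k)).prodCongr (Equiv.subRight 1))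
    (Subgroup.subset_closure (Or.inr fun x => ⟨?_, ?_⟩)) (v, s)
  · simp only [Equiv.trans_apply, vec_splitEquiv_symm]; rfl
  · simp only [Equiv.trans_apply, last_splitEquiv_symm]; rfl

theorem dotProduct_simpleCoroot (v : Fin l → ℂ) (j : Fin l) : v ⬝ᵥ simpleCoroot l j =
    v j - if h : (j : ℕ) + 1 < l then v ⟨(j : ℕ) + 1, h⟩ else 0 := by
  rw [dotProduct]
  simp only [simpleCoroot_apply, mul_sub, Finset.sum_sub_distrib, mul_ite, mul_one, mul_zero,
    Finset.sum_ite_eq', Finset.mem_univ, if_true]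
  congr 1
  split_ifs with h
  · rw [Finset.sum_eq_single ⟨(j : ℕ) + 1, h⟩]
    · simp
    · intro b _ hb
      rw [if_neg]
      exact fun h' => hb (Fin.ext h')
    · simp
  · refine Finset.sum_eq_zero fun b _ => ?_
    rw [if_neg]; omega

theorem simpleReflection_castSucc {n : ℕ} (j : Fin n) (v : Fin (n + 1) → ℂ) :
    simpleReflection (n + 1) j.castSucc v = v ∘ Equiv.swap j.castSucc j.succ := by
  ext i
  have hj := j.2
  have h1 : ((j.castSucc : Fin (n + 1)) : ℕ) + 1 < n + 1 := by simp
  have h2 : (⟨((j.castSucc : Fin (n + 1)) : ℕ) + 1, h1⟩ : Fin (n + 1)) = j.succ := by ext; simp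
  rw [simpleReflection, dotProduct_simpleCoroot, dif_pos h1, h2]
  simp only [Pi.sub_apply, Pi.smul_apply, smul_eq_mul, simpleRoot, Function.comp_apply]
  have h3 : ((j.castSucc : Fin (n + 1)) : ℕ) + 1 ≠ n + 1 := by rw [Fin.val_castSucc]; omega
  rw [if_neg h3]
  by_cases hi : i = j.castSucc
  · subst hi; simp
  · by_cases hi' : i = j.succ
    · subst hi'
      have : (j.succ : Fin (n + 1)) ≠ j.castSucc := hi
      simp [this]
    · have : (i : ℕ) ≠ (j : ℕ) + 1 := fun h => hi' (Fin.ext h)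
      rw [Equiv.swap_apply_of_ne_of_ne hi hi']
      simp [hi, this]

theorem simpleReflection_last {n : ℕ} (v : Fin (n + 1) → ℂ) :
    simpleReflection (n + 1) (Fin.last n) v =
      Function.update v (Fin.last n) (-v (Fin.last n)) := by
  ext i
  rw [simpleReflection, dotProduct_simpleCoroot, dif_neg (by simp)]
  simp only [Pi.sub_apply, Pi.smul_apply, smul_eq_mul, simpleRoot, Fin.val_last, if_true, sub_zero]
  by_cases hi : i = Fin.last n
  · subst hi; simp; ring
  · rw [Function.update_of_ne hi, if_neg hi, if_neg (by omega), mul_zero, sub_zero]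

/-- The reflections in `α_j`, `j < l`, are the adjacent transpositions of coordinates, and these
generate the symmetric group. -/
theorem sameOrbit_comp_perm {n : ℕ} (π : Equiv.Perm (Fin (n + 1))) (v : Fin (n + 1) → ℂ) (s : ℂ) :
    SameOrbit (n + 1) k (v, s) (v ∘ π, s) := by
  have hπ : π ∈ Submonoid.closure (Set.range fun i : Fin n ↦ Equiv.swap i.castSucc i.succ) := by
    rw [Equiv.Perm.mclosure_swap_castSucc_succ]; trivial
  revert v
  induction hπ using Submonoid.closure_induction with
  | mem π hπ =>
    obtain ⟨j, rfl⟩ := hπ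
    intro v
    have hinv : Function.Involutive (simpleReflection (n + 1) j.castSucc) := by
      intro v
      rw [simpleReflection_castSucc, simpleReflection_castSucc]
      ext i; simp
    have := sameOrbit_of_involutive (k := k) j.castSucc hinv v s
    rwa [simpleReflection_castSucc] at this
  | one => exact fun v => SameOrbit.refl _
  | mul π π' _ _ h h' => exact fun v => (h v).trans (h' (v ∘ π))

/-- Equality up to sign and integer translations. -/
def SignShift (a b : ℂ) : Prop := ∃ n : ℤ, b = a + n ∨ b = -a + n

/-- The last simple reflection changes the sign of the last coordinate, and the last coroot is the
last unit vector; together they realize every sign shift there. A transposition carries this to the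
coordinate `i`. -/
theorem sameOrbit_update {n : ℕ} (i : Fin (n + 1)) (v : Fin (n + 1) → ℂ) (s b : ℂ)
    (h : SignShift (v i) b) : SameOrbit (n + 1) k (v, s) (Function.update v i b, s) := by
  have hneg : ∀ v : Fin (n + 1) → ℂ, SameOrbit (n + 1) k (v, s)
      (Function.update v (Fin.last n) (-v (Fin.last n)), s) := by
    intro v
    have hinv : Function.Involutive (simpleReflection (n + 1) (Fin.last n)) := by
      intro v
      rw [simpleReflection_last, simpleReflection_last]
      ext i; simp
    have := sameOrbit_of_involutive (k := k) (Fin.last n) hinv v s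
    rwa [simpleReflection_last] at this
  have hone : ∀ v : Fin (n + 1) → ℂ, SameOrbit (n + 1) k (v, s)
      (Function.update v (Fin.last n) (v (Fin.last n) + 1), s) := by
    intro v
    have h1 : v + simpleCoroot (n + 1) (Fin.last n) =
        Function.update v (Fin.last n) (v (Fin.last n) + 1) := by
      ext i
      rw [Pi.add_apply, simpleCoroot_apply]
      by_cases hi : i = Fin.last n
      · subst hi; simp
      · rw [Function.update_of_ne hi, if_neg hi, if_neg (by rw [Fin.val_last]; omega)]; simp
    rw [← h1]
    exact sameOrbit_add_coroot _ _ _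
  have hint : ∀ (m : ℤ) (v : Fin (n + 1) → ℂ), SameOrbit (n + 1) k (v, s)
      (Function.update v (Fin.last n) (v (Fin.last n) + m), s) := by
    intro m
    induction m using Int.induction_on with
    | zero => intro v; simpa using SameOrbit.refl _
    | succ m ih =>
      intro v
      refine (ih v).trans ?_
      have := hone (Function.update v (Fin.last n) (v (Fin.last n) + (m : ℤ)))
      rw [Function.update_self, Function.update_idem] at this
      simpa [add_assoc] using this
    | pred m ih =>
      intro v
      refine (ih v).trans (SameOrbit.symm ?_)
      have := hone (Function.update v (Fin.last n) (v (Fin.last n) + ((-(m : ℤ) - 1 : ℤ) : ℂ)))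
      rw [Function.update_self, Function.update_idem] at this
      have e : v (Fin.last n) + ((-(m : ℤ) - 1 : ℤ) : ℂ) + 1 = v (Fin.last n) + ((-(m : ℤ) : ℤ) : ℂ) := by
        push_cast; ring
      rwa [e] at this
  have hlast : ∀ (v : Fin (n + 1) → ℂ) b, SignShift (v (Fin.last n)) b → SameOrbit (n + 1) k (v, s)
      (Function.update v (Fin.last n) b, s) := by
    rintro v b ⟨m, rfl | rfl⟩
    · exact hint m v
    · have := (hneg v).trans (hint m _)
      rwa [Function.update_self, Function.update_idem] at this
  have h1 := sameOrbit_comp_perm (k := k) (Equiv.swap i (Fin.last n)) v s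
  have h2 := hlast (v ∘ Equiv.swap i (Fin.last n)) b (by simpa using h)
  have h3 := sameOrbit_comp_perm (k := k) (Equiv.swap i (Fin.last n))
    (Function.update (v ∘ Equiv.swap i (Fin.last n)) (Fin.last n) b) s
  convert (h1.trans h2).trans h3 using 2
  ext j
  by_cases hj : j = i
  · subst hj; simp
  · rw [Function.update_of_ne hj, Function.comp_apply, Function.update_of_ne]
    · simp
    · intro h'
      apply hj
      rw [Equiv.swap_apply_eq_iff, Equiv.swap_apply_right] at h'
      exact h'

theorem sameOrbit_of_signShift {n : ℕ} {v v' : Fin (n + 1) → ℂ} (s : ℂ)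
    (h : ∀ i, SignShift (v i) (v' i)) : SameOrbit (n + 1) k (v, s) (v', s) := by
  classical
  have key : ∀ S : Finset (Fin (n + 1)), SameOrbit (n + 1) k (v, s) (S.piecewise v' v, s) := by
    intro S
    induction S using Finset.induction_on with
    | empty => simpa using SameOrbit.refl _
    | insert a S ha ih =>
      refine ih.trans ?_
      rw [Finset.piecewise_insert]
      refine sameOrbit_update a _ s _ ?_
      rw [Finset.piecewise_eq_of_notMem _ _ _ ha]
      exact h a
  simpa using key Finset.univ

/-- The translation by `ω_k` that accompanies `s ↦ s - 1` has integer coordinates, so it can be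
undone by integer translations. -/
theorem sameOrbit_add_int {n : ℕ} (v : Fin (n + 1) → ℂ) (s : ℂ) (m : ℤ) :
    SameOrbit (n + 1) k (v, s) (v, s + m) := by
  have hone : ∀ s, SameOrbit (n + 1) k (v, s) (v, s - 1) := by
    intro s
    refine (sameOrbit_add_fundWeight v s).trans (sameOrbit_of_signShift _ fun i => ?_)
    rw [Pi.add_apply, fundWeight]
    split_ifs
    · exact ⟨-1, Or.inl (by push_cast; ring)⟩
    · exact ⟨0, Or.inl (by push_cast; ring)⟩
  induction m using Int.induction_on with
  | zero => simpa using SameOrbit.refl _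
  | succ m ih =>
    refine ih.trans (SameOrbit.symm ?_)
    convert hone (s + ((m + 1 : ℤ) : ℂ)) using 2
    push_cast; ring
  | pred m ih =>
    refine ih.trans ?_
    convert hone (s + ((-(m : ℤ) : ℤ) : ℂ)) using 2
    push_cast; ring

theorem twoCosh_eq_iff {a b : ℂ} : twoCosh (2 * Real.pi * Complex.I * a) =
    twoCosh (2 * Real.pi * Complex.I * b) ↔ SignShift a b := by
  set w := 2 * Real.pi * Complex.I with hw
  have hw0 : w ≠ 0 := Complex.two_pi_I_ne_zero
  have hmul : ∀ t, Complex.exp t * Complex.exp (-t) = 1 := fun t => by rw [← Complex.exp_add]; simp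
  constructor
  · intro h
    unfold twoCosh at h
    -- Multiplying `t + t⁻¹ = s + s⁻¹` by `t` factors the equation as `(t - s)(t - s⁻¹) = 0`.
    have h1 : (Complex.exp (w * b) - Complex.exp (w * a)) *
        (Complex.exp (w * b) - Complex.exp (-(w * a))) = 0 := by
      linear_combination (-Complex.exp (w * b)) * h + hmul (w * a) - hmul (w * b)
    rcases mul_eq_zero.mp h1 with h2 | h2
    · obtain ⟨n, hn⟩ := Complex.exp_eq_exp_iff_exists_int.mp (sub_eq_zero.mp h2)
      refine ⟨n, Or.inl (mul_left_cancel₀ hw0 ?_)⟩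
      rw [hn]; ring
    · obtain ⟨n, hn⟩ := Complex.exp_eq_exp_iff_exists_int.mp (sub_eq_zero.mp h2)
      refine ⟨n, Or.inr (mul_left_cancel₀ hw0 ?_)⟩
      rw [hn]; ring
  · have hper : ∀ (a : ℂ) (n : ℤ), Complex.exp (w * (a + n)) = Complex.exp (w * a) := fun a n =>
      Complex.exp_eq_exp_iff_exists_int.mpr ⟨n, by ring⟩
    have hper' : ∀ (a : ℂ) (n : ℤ), Complex.exp (-(w * (a + n))) = Complex.exp (-(w * a)) :=
      fun a n => Complex.exp_eq_exp_iff_exists_int.mpr ⟨-n, by push_cast; ring⟩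
    rintro ⟨n, rfl | rfl⟩
    · rw [twoCosh, twoCosh, hper, hper']
    · rw [twoCosh, twoCosh, hper, hper', mul_neg, neg_neg, add_comm]

/-- Equal multisets of values mean fibres of equal cardinality, and bijections between the fibres
assemble to a permutation. -/
theorem exists_perm_of_map_eq {ι α : Type*} [Fintype ι] {f g : ι → α}
    (h : (Finset.univ.val.map f : Multiset α) = Finset.univ.val.map g) :
    ∃ π : Equiv.Perm ι, g ∘ π = f := by
  classical
  have hc : ∀ c, Fintype.card {i // f i = c} = Fintype.card {i // g i = c} := by
    intro c
    have := congrArg (Multiset.count c) h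
    rw [Multiset.count_map, Multiset.count_map] at this
    rw [Fintype.card_subtype, Fintype.card_subtype]
    simp only [eq_comm (a := c)] at this
    exact this
  exact ⟨Equiv.ofFiberEquiv fun c => Fintype.equivOfCardEq (hc c), by
    ext i; exact Equiv.ofFiberEquiv_map _ i⟩

theorem yCoord_last (x : Fin (l + 1) → ℂ) :
    yCoord l k x (Fin.last l) = 2 * Real.pi * Complex.I * x (Fin.last l) := by
  simp [yCoord]

theorem polyOf_theta_yCoord (x : Fin (l + 1) → ℂ) : polyOf l (theta l k (yCoord l k x)) =
    C (Complex.exp (k * yCoord l k x (Fin.last l))) *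
      ∏ j : Fin l, (X + C (twoCosh (2 * Real.pi * Complex.I * vec l x j))) := by
  rw [yCoord_last, yCoord_eq, polyOf_theta_phiChart, phiMatrix_mulVec_last]
  simp only [phiMatrix_mulVec_castSucc]

/-- Once `e^{y^{l+1}}` agrees, the remaining coordinates are equivalent to the monic part of `P`,
hence to the multiset of its roots `-ξ_j`. By `twoCosh_eq_iff` each root fixes a coordinate of `𝐱`
up to sign and integers. -/
theorem invariants_eq_iff (x x' : Fin (l + 1) → ℂ) :
    ((∀ j : Fin l, yCoord l k x j.castSucc = yCoord l k x' j.castSucc) ∧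
      Complex.exp (yCoord l k x (Fin.last l)) = Complex.exp (yCoord l k x' (Fin.last l))) ↔
    ((∃ π : Equiv.Perm (Fin l), ∀ i, SignShift (vec l x (π i)) (vec l x' i)) ∧
      ∃ n : ℤ, x' (Fin.last l) = x (Fin.last l) + n) := by
  have hexp : Complex.exp (yCoord l k x (Fin.last l)) = Complex.exp (yCoord l k x' (Fin.last l)) ↔
      ∃ n : ℤ, x' (Fin.last l) = x (Fin.last l) + n := by
    rw [yCoord_last, yCoord_last, eq_comm, Complex.exp_eq_exp_iff_exists_int]
    refine exists_congr fun n => ⟨fun h => mul_left_cancel₀ Complex.two_pi_I_ne_zero ?_, fun h => ?_⟩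
    · rw [h]; ring
    · rw [h]; ring
  rw [hexp]
  refine and_congr_left fun hn => ?_
  have he := hexp.mpr hn
  have hroots : ∀ f : Fin l → ℂ, (∏ j, (X + C (f j))).roots = Finset.univ.val.map fun j => -f j := by
    intro f
    have h1 := roots_multiset_prod_X_sub_C (Finset.univ.val.map fun j => -f j)
    rw [Multiset.map_map] at h1
    rw [← h1, Finset.prod_eq_multiset_prod]
    congr 3
    ext1 j
    simp
  constructor
  · intro h
    have h1 := congrArg (polyOf l) (theta_congr (k := k) h he)
    rw [polyOf_theta_yCoord, polyOf_theta_yCoord, exp_natCast_mul_eq he] at h1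
    have h2 := mul_left_cancel₀ (C_ne_zero.mpr (Complex.exp_ne_zero _)) h1
    have h3 := congrArg roots h2
    rw [hroots, hroots] at h3
    obtain ⟨π, hπ⟩ := exists_perm_of_map_eq h3.symm
    refine ⟨π, fun i => twoCosh_eq_iff.mp ?_⟩
    have := congrFun hπ i
    simp only [Function.comp_apply, neg_inj] at this
    exact this
  · rintro ⟨π, hπ⟩ j
    have h1 : theta l k (yCoord l k x) = theta l k (yCoord l k x') := by
      refine polyOf_injective l ?_
      rw [polyOf_theta_yCoord, polyOf_theta_yCoord, exp_natCast_mul_eq he]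
      congr 1
      rw [← Equiv.prod_comp π]
      exact Finset.prod_congr rfl fun i _ => by rw [twoCosh_eq_iff.mpr (hπ i)]
    have h2 := congrFun h1 j.succ
    rw [theta_succ, theta_succ, exp_natCast_mul_eq he] at h2
    exact mul_right_cancel₀ (Complex.exp_ne_zero _) h2

theorem SignShift.refl (a : ℂ) : SignShift a a := ⟨0, Or.inl (by simp)⟩

theorem yCoord_invariant (hk : 1 ≤ k) (hkl : k ≤ l) {w : Equiv.Perm (Fin (l + 1) → ℂ)}
    (hw : w ∈ extAffineWeyl l k) (x : Fin (l + 1) → ℂ) :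
    (∀ j : Fin l, yCoord l k x j.castSucc = yCoord l k (w x) j.castSucc) ∧
      Complex.exp (yCoord l k x (Fin.last l)) = Complex.exp (yCoord l k (w x) (Fin.last l)) := by
  obtain ⟨n, rfl⟩ : ∃ n, l = n + 1 := ⟨l - 1, by omega⟩
  revert x
  induction hw using Subgroup.closure_induction with
  | mem σ hσ =>
    intro x
    rw [invariants_eq_iff]
    rcases hσ with (⟨j, hj⟩ | ⟨j, hj⟩) | hσ
    · refine ⟨?_, 0, by rw [(hj x).2]; simp⟩
      rw [(hj x).1]
      refine Fin.lastCases ?_ (fun j => ?_) j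
      · refine ⟨1, fun i => ?_⟩
        rw [simpleReflection_last, Equiv.Perm.one_apply]
        by_cases hi : i = Fin.last n
        · subst hi; exact ⟨0, Or.inr (by simp)⟩
        · rw [Function.update_of_ne hi]; exact SignShift.refl _
      · refine ⟨Equiv.swap j.castSucc j.succ, fun i => ?_⟩
        rw [simpleReflection_castSucc]; exact SignShift.refl _
    · refine ⟨⟨1, fun i => ?_⟩, 0, by rw [(hj x).2]; simp⟩
      rw [(hj x).1, Pi.add_apply, simpleCoroot_apply, Equiv.Perm.one_apply]
      exact ⟨(if i = j then 1 else 0) - if (i : ℕ) = (j : ℕ) + 1 then 1 else 0,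
        Or.inl (by push_cast; rfl)⟩
    · refine ⟨⟨1, fun i => ?_⟩, -1, by rw [(hσ x).2]; push_cast; ring⟩
      rw [(hσ x).1, Pi.add_apply, fundWeight, Equiv.Perm.one_apply]
      exact ⟨if (i : ℕ) < k then 1 else 0, Or.inl (by push_cast; rfl)⟩
  | one => exact fun x => ⟨fun _ => rfl, rfl⟩
  | mul σ σ' _ _ h h' =>
    intro x
    exact ⟨fun j => ((h' x).1 j).trans ((h (σ' x)).1 j), (h' x).2.trans (h (σ' x)).2⟩
  | inv σ _ h =>
    intro x
    have := h (σ⁻¹ x)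
    rw [show σ (σ⁻¹ x) = x from σ.apply_symm_apply x] at this
    exact ⟨fun j => (this.1 j).symm, this.2.symm⟩

theorem orbit_iff (hk : 1 ≤ k) (hkl : k ≤ l) (x x' : Fin (l + 1) → ℂ) :
    (∃ w ∈ extAffineWeyl l k, w x = x') ↔
      (∀ j : Fin l, yCoord l k x j.castSucc = yCoord l k x' j.castSucc) ∧
      Complex.exp (yCoord l k x (Fin.last l)) = Complex.exp (yCoord l k x' (Fin.last l)) := by
  constructor
  · rintro ⟨w, hw, rfl⟩
    exact yCoord_invariant hk hkl hw x
  · rw [invariants_eq_iff]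
    rintro ⟨⟨π, hπ⟩, m, hm⟩
    obtain ⟨n, rfl⟩ : ∃ n, l = n + 1 := ⟨l - 1, by omega⟩
    have h1 := ((sameOrbit_comp_perm (k := k) π (vec (n + 1) x) (x (Fin.last _))).trans
      (sameOrbit_of_signShift _ hπ)).trans (sameOrbit_add_int _ _ m)
    rw [← hm] at h1
    have e : ∀ x, (splitEquiv (n + 1)).symm (vec (n + 1) x, x (Fin.last _)) = x := fun x =>
      (splitEquiv (n + 1)).symm_apply_apply x
    unfold SameOrbit at h1
    rwa [e, e] at h1

theorem orbitEta_invariant (hk : 1 ≤ k) (hkl : k ≤ l) {m : ℕ} (hm : m ≤ l - k)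
    {w : Equiv.Perm (Fin (l + 1) → ℂ)} (hw : w ∈ extAffineWeyl l k) (x : Fin (l + 1) → ℂ) :
    orbitEta l k m (yCoord l k (w x)) = orbitEta l k m (yCoord l k x) := by
  obtain ⟨h1, h2⟩ := yCoord_invariant hk hkl hw x
  rw [orbitEta_eq hk hkl hm, yEta, pullMetric, pullMetric, theta_congr h1 h2,
    jacobian_theta_congr (fun j _ => h1 j) h2]

end OrbitC

end

/-! ### Triangular Hankel matrices and the basis defining the coordinates `ϖ`. -/

noncomputable section

open Polynomial
open scoped ContDiff Topology Matrix

namespace OrbitC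

open FlatPencil

variable {l k m : ℕ}

/-! ### Hankel matrices -/

/-- The Hankel matrix `f (i + j)`. -/
def hankel (N : ℕ) (f : ℕ → ℂ) : Matrix (Fin N) (Fin N) ℂ := Matrix.of fun i j => f (i + j)

/-- The matrix vanishes below the antidiagonal. Expansion along the last row leaves one entry, and
its minor is the Hankel matrix of the shifted function. -/
theorem det_hankel (N : ℕ) (f : ℕ → ℂ) (hf : ∀ s, N ≤ s → f s = 0) :
    (hankel N f).det = (-1) ^ N.choose 2 * f (N - 1) ^ N := by
  induction N generalizing f with
  | zero => simp
  | succ N ih =>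
    have h1 : (hankel (N + 1) f).submatrix (Fin.last N).succAbove (Fin.succAbove 0) =
        hankel N fun s => f (s + 1) := by
      ext i j
      simp [hankel, Fin.succAbove_last, add_assoc]
    rw [Matrix.det_succ_row _ (Fin.last N), Finset.sum_eq_single 0]
    · rw [h1, ih _ fun s hs => hf _ (by omega)]
      have h2 : hankel (N + 1) f (Fin.last N) 0 = f N := by simp [hankel]
      rw [h2, Fin.val_last, Fin.val_zero, Nat.add_sub_cancel, Nat.choose_succ_succ' N 1,
        Nat.choose_one_right]
      rcases N with _ | N
      · simp
      · simp only [Nat.add_sub_cancel]; ring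
    · intro j _ hj
      have h2 : hankel (N + 1) f (Fin.last N) j = 0 := by
        refine hf _ ?_
        have := Fin.pos_iff_ne_zero.mpr hj
        rw [Fin.lt_def] at this
        simp only [Fin.val_zero] at this
        rw [Fin.val_last]; omega
      rw [h2]; ring
    · simp

/-- This is the divided difference `(w - z) ∑_{i+j=s} w^i z^j = w^{s+1} - z^{s+1}`, weighted by `f
s`. It is what makes the blocks of `η` Hankel. -/
theorem sum_hankel (N : ℕ) (f : ℕ → ℂ) (hf : ∀ s, N ≤ s → f s = 0) (w z : ℂ) :
    (w - z) * ∑ i : Fin N, ∑ j : Fin N, hankel N f i j * w ^ (i : ℕ) * z ^ (j : ℕ) =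
      ∑ s ∈ Finset.range N, f s * (w ^ (s + 1) - z ^ (s + 1)) := by
  induction N generalizing f with
  | zero => simp
  | succ N ih =>
    rw [Fin.sum_univ_succ]
    have h1 : ∑ i : Fin N, ∑ j : Fin (N + 1), hankel (N + 1) f i.succ j * w ^ (i.succ : ℕ) * z ^ (j : ℕ)
        = w * ∑ i : Fin N, ∑ j : Fin N, hankel N (fun s => f (s + 1)) i j *
          w ^ (i : ℕ) * z ^ (j : ℕ) := by
      rw [Finset.mul_sum]
      refine Finset.sum_congr rfl fun i _ => ?_
      rw [Fin.sum_univ_castSucc, Finset.mul_sum]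
      have h2 : hankel (N + 1) f i.succ (Fin.last N) = 0 := hf _ (by simp [Fin.val_last]; try omega)
      rw [h2, zero_mul, zero_mul, add_zero]
      refine Finset.sum_congr rfl fun j _ => ?_
      simp only [hankel, Matrix.of_apply, Fin.val_succ, Fin.val_castSucc]
      rw [show (i : ℕ) + 1 + j = i + j + 1 by ring]; ring
    have h3 := ih (fun s => f (s + 1)) fun s hs => hf _ (by omega)
    rw [h1, mul_add, mul_left_comm, h3, Finset.sum_range_succ', Fin.sum_univ_succ]
    have h4 : ∑ j : Fin N, hankel (N + 1) f 0 j.succ * w ^ ((0 : Fin (N + 1)) : ℕ) *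
        z ^ (j.succ : ℕ) = ∑ s ∈ Finset.range N, f (s + 1) * z ^ (s + 1) := by
      rw [Finset.sum_range]
      exact Finset.sum_congr rfl fun j _ => by simp [hankel]
    rw [h4, mul_add, Finset.mul_sum, Finset.mul_sum, add_assoc, ← Finset.sum_add_distrib, add_comm]
    congr 1
    · exact Finset.sum_congr rfl fun s _ => by ring
    · simp [hankel]; ring

theorem sum_range_shift (N : ℕ) (g : ℕ → ℂ) (hg : g N = 0) :
    ∑ i ∈ Finset.range N, g i = g 0 + ∑ i ∈ Finset.range N, g (i + 1) := by
  rw [add_comm, ← Finset.sum_range_succ', Finset.sum_range_succ, hg, add_zero]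

/-! ### The coordinates `ϖ` -/

/-- The polynomials multiplied by `ϖ^j` in the definition of the coordinates `τ`. -/
def tauBasis (l k m : ℕ) (j : Fin (l + 1)) : ℂ[X] :=
  if (j : ℕ) ≤ l - m then (X + C 2) ^ m * (X - C 2) ^ (l - m - (j : ℕ))
  else -((X + C 2) ^ (l - (j : ℕ)) * (X - C 2) ^ ((j : ℕ) - k - 1))

theorem polyTau_eq (ϖ : Fin (l + 1) → ℂ) : polyTau l k m ϖ = ∑ j, C (ϖ j) * tauBasis l k m j := by
  refine Finset.sum_congr rfl fun j _ => ?_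
  unfold tauBasis
  split_ifs <;> ring

theorem natDegree_pow_mul_pow (a b : ℕ) :
    ((X + C (2 : ℂ)) ^ a * (X - C 2) ^ b).natDegree = a + b := by
  rw [((monic_X_add_C (2 : ℂ)).pow a).natDegree_mul ((monic_X_sub_C (2 : ℂ)).pow _),
    (monic_X_add_C (2 : ℂ)).natDegree_pow, (monic_X_sub_C (2 : ℂ)).natDegree_pow,
    natDegree_X_add_C, natDegree_X_sub_C, mul_one, mul_one]

theorem natDegree_tauBasis (hk : 1 ≤ k) (hkl : k ≤ l) (hm : m ≤ l - k) (j : Fin (l + 1)) :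
    (tauBasis l k m j).natDegree ≤ if j = 0 then l else l - 1 := by
  have hj := j.2
  unfold tauBasis
  split_ifs with h1 h2 h2
  · rw [natDegree_pow_mul_pow]; omega
  · have : (j : ℕ) ≠ 0 := fun h => h2 (Fin.ext h)
    rw [natDegree_pow_mul_pow]; omega
  · rw [natDegree_neg, natDegree_pow_mul_pow]; omega
  · rw [natDegree_neg, natDegree_pow_mul_pow]; omega

theorem natDegree_tauBasis_le (hk : 1 ≤ k) (hkl : k ≤ l) (hm : m ≤ l - k) (j : Fin (l + 1)) :
    (tauBasis l k m j).natDegree ≤ l := by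
  refine (natDegree_tauBasis hk hkl hm j).trans ?_
  split_ifs <;> omega

/-- The matrix expressing the coordinates `θ` through `ϖ`. -/
def tauMatrix (l k m : ℕ) : Matrix (Fin (l + 1)) (Fin (l + 1)) ℂ :=
  Matrix.of fun r j => (tauBasis l k m j).coeff (l - (r : ℕ))

theorem polyOf_tauMatrix_col (hk : 1 ≤ k) (hkl : k ≤ l) (hm : m ≤ l - k) (j : Fin (l + 1)) :
    (polyOf l fun r => tauMatrix l k m r j) = tauBasis l k m j :=
  polyOf_coeff (natDegree_tauBasis_le hk hkl hm j)

theorem polyOf_tauMatrix_mulVec (hk : 1 ≤ k) (hkl : k ≤ l) (hm : m ≤ l - k)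
    (ϖ : Fin (l + 1) → ℂ) : polyOf l ((tauMatrix l k m).mulVec ϖ) = polyTau l k m ϖ := by
  have h1 : (tauMatrix l k m).mulVec ϖ = ∑ j, ϖ j • fun r => tauMatrix l k m r j := by
    ext r
    simp [Matrix.mulVec, dotProduct, mul_comm]
  rw [h1, polyOf_sum, polyTau_eq]
  exact Finset.sum_congr rfl fun j _ => by rw [polyOf_tauMatrix_col hk hkl hm]

/-- Only the basis polynomial of index `0` has degree `l`, and it is monic. This makes `ϖ^0 = θ^0`,
so that `τ^{l+1} = y^{l+1}` is consistent. -/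
theorem tauMatrix_mulVec_zero (hk : 1 ≤ k) (hkl : k ≤ l) (hm : m ≤ l - k)
    (ϖ : Fin (l + 1) → ℂ) : (tauMatrix l k m).mulVec ϖ 0 = ϖ 0 := by
  rw [Matrix.mulVec, dotProduct, Finset.sum_eq_single 0]
  · have h : tauBasis l k m 0 = (X + C 2) ^ m * (X - C 2) ^ (l - m) := by simp [tauBasis]
    have h2 : (tauBasis l k m 0).Monic := by
      rw [h]; exact ((monic_X_add_C (2 : ℂ)).pow m).mul ((monic_X_sub_C (2 : ℂ)).pow _)
    have h3 : (tauBasis l k m 0).natDegree = l := by rw [h, natDegree_pow_mul_pow]; omega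
    rw [Monic, leadingCoeff, h3] at h2
    simp [tauMatrix, h2]
  · intro j _ hj
    have := natDegree_tauBasis hk hkl hm j
    rw [if_neg hj] at this
    simp only [tauMatrix, Matrix.of_apply, Fin.val_zero, Nat.sub_zero]
    rw [coeff_eq_zero_of_natDegree_lt (by omega), zero_mul]
  · simp

/-- The polynomial has the form `(X + 2)^m A - (X - 2)^n B` with `B` of degree less than `m`. If it
is zero, coprimality makes `(X + 2)^m` divide `B`, so `B = 0` and then `A = 0`; the coefficients
within `A` and within `B` are recovered separately. -/
theorem polyTau_injective (hkl : k ≤ l) (hm : m ≤ l - k) {ϖ : Fin (l + 1) → ℂ}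
    (h : polyTau l k m ϖ = 0) : ϖ = 0 := by
  obtain ⟨n, rfl⟩ : ∃ n, l = k + n + m := ⟨l - k - m, by omega⟩
  set A : ℂ[X] := ∑ j : Fin (k + n + 1), C (ϖ ⟨j, by omega⟩) * (X - C 2) ^ (k + n - (j : ℕ)) with hA
  set B : ℂ[X] := ∑ i : Fin m, C (ϖ ⟨k + n + 1 + i, by omega⟩) *
    ((X + C 2) ^ (m - 1 - (i : ℕ)) * (X - C 2) ^ (i : ℕ)) with hB
  have hP : polyTau (k + n + m) k m ϖ = (X + C 2) ^ m * A - (X - C 2) ^ n * B := by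
    rw [polyTau_eq, ← (finCongr (show k + n + 1 + m = k + n + m + 1 by omega)).sum_comp,
      Fin.sum_univ_add, hA, hB, Finset.mul_sum, Finset.mul_sum, sub_eq_add_neg,
      ← Finset.sum_neg_distrib]
    congr 1
    · refine Finset.sum_congr rfl fun j _ => ?_
      have hj := j.2
      rw [tauBasis, if_pos (by simp; omega)]
      simp only [finCongr_apply, Fin.val_cast, Fin.val_castAdd]
      rw [Nat.add_sub_cancel, show (Fin.castAdd m j).cast (show k + n + 1 + m = k + n + m + 1 by omega)
        = (⟨j, by omega⟩ : Fin (k + n + m + 1)) from rfl]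
      ring
    · refine Finset.sum_congr rfl fun i _ => ?_
      have hi := i.2
      rw [tauBasis, if_neg (by simp; omega)]
      simp only [finCongr_apply, Fin.val_cast, Fin.val_natAdd]
      rw [show (Fin.natAdd (k + n + 1) i).cast (show k + n + 1 + m = k + n + m + 1 by omega)
        = (⟨k + n + 1 + i, by omega⟩ : Fin (k + n + m + 1)) from rfl,
        show k + n + m - (k + n + 1 + (i : ℕ)) = m - 1 - i by omega,
        show k + n + 1 + (i : ℕ) - k - 1 = n + i by omega]
      ring
  rw [hP, sub_eq_zero] at h
  have hcop : IsCoprime ((X + C (2 : ℂ)) ^ m) ((X - C (2 : ℂ)) ^ n) := by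
    refine IsCoprime.pow ?_
    have := isCoprime_X_sub_C_of_isUnit_sub (R := ℂ) (a := -2) (b := 2)
      (isUnit_iff_ne_zero.mpr (by norm_num))
    simpa using this
  have hdvd : (X + C (2 : ℂ)) ^ m ∣ B := hcop.dvd_of_dvd_mul_left ⟨A, h.symm⟩
  have hB0 : B = 0 := by
    rcases Nat.eq_zero_or_pos m with h0 | hpos
    · subst h0; simp [hB]
    · refine eq_zero_of_dvd_of_natDegree_lt hdvd ?_
      rw [(monic_X_add_C (2 : ℂ)).natDegree_pow, natDegree_X_add_C, mul_one]
      refine lt_of_le_of_lt (natDegree_sum_le_of_forall_le (n := m - 1) _ _ fun i _ => ?_) (by omega)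
      refine (natDegree_C_mul_le _ _).trans ?_
      rw [natDegree_pow_mul_pow]; omega
  have hA0 : A = 0 := by
    rw [hB0, mul_zero] at h
    exact (mul_eq_zero.mp h).resolve_left (pow_ne_zero _ (monic_X_add_C (2 : ℂ)).ne_zero)
  have hA1 : (fun j : Fin (k + n + 1) => ϖ ⟨j, by omega⟩) = 0 := by
    refine polyOf_injective (k + n) (funext fun w => ?_)
    have := congrArg (eval (w + 2)) hA0
    rw [hA, eval_finsetSum] at this
    simp only [eval_mul, eval_C, eval_pow, eval_sub, eval_X, eval_zero, add_sub_cancel_right] at this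
    rw [eval_polyOf, eval_polyOf, this]
    simp
  have hB1 : ∀ i : Fin m, ϖ ⟨k + n + 1 + i, by omega⟩ = 0 := by
    set S : ℂ[X] := ∑ i : Fin m, C (ϖ ⟨k + n + 1 + i, by omega⟩) * X ^ (i : ℕ) with hS
    have hS0 : S = 0 := by
      refine polynomial_eq_of_eval_eq (Set.finite_singleton 1) fun s hs => ?_
      have hs1 : 1 - s ≠ 0 := sub_ne_zero.mpr (Ne.symm hs)
      -- `B` is homogeneous of degree `m - 1` in `u + 2` and `u - 2`. This point solves `(u - 2)/(u
      -- + 2) = s`, which turns `B` into an ordinary polynomial in `s`.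
      have h1 := congrArg (eval (2 * (1 + s) / (1 - s))) hB0
      have e1 : 2 * (1 + s) / (1 - s) + 2 = 4 / (1 - s) := by field_simp; ring
      have e2 : 2 * (1 + s) / (1 - s) - 2 = 4 / (1 - s) * s := by field_simp; ring
      rw [hB, eval_finsetSum] at h1
      simp only [eval_mul, eval_C, eval_pow, eval_sub, eval_add, eval_X, eval_zero, e1, e2] at h1
      have h2 : ∀ i : Fin m, ϖ ⟨k + n + 1 + i, by omega⟩ * ((4 / (1 - s)) ^ (m - 1 - (i : ℕ)) *
          (4 / (1 - s) * s) ^ (i : ℕ)) = (4 / (1 - s)) ^ (m - 1) *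
          (ϖ ⟨k + n + 1 + i, by omega⟩ * s ^ (i : ℕ)) := by
        intro i
        have : m - 1 = (m - 1 - (i : ℕ)) + i := by omega
        conv_rhs => rw [this, pow_add]
        rw [mul_pow]; ring
      rw [Finset.sum_congr rfl fun i _ => h2 i, ← Finset.mul_sum] at h1
      rw [hS, eval_finsetSum, eval_zero]
      simp only [eval_mul, eval_C, eval_pow, eval_X]
      exact (mul_eq_zero.mp h1).resolve_left (pow_ne_zero _ (div_ne_zero (by norm_num) hs1))
    intro i
    have := congrArg (fun p => p.coeff (i : ℕ)) hS0
    simp only [hS, finsetSum_coeff, coeff_C_mul_X_pow, coeff_zero] at this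
    rw [Finset.sum_eq_single i] at this
    · simpa using this
    · intro b _ hb
      rw [if_neg]
      exact fun h => hb (Fin.ext h.symm)
    · simp
  ext ⟨j, hj⟩
  by_cases hj' : j < k + n + 1
  · exact congrFun hA1 ⟨j, hj'⟩
  · have := hB1 ⟨j - (k + n + 1), by omega⟩
    simp only [show k + n + 1 + (j - (k + n + 1)) = j by omega] at this
    exact this

theorem det_tauMatrix_ne_zero (hk : 1 ≤ k) (hkl : k ≤ l) (hm : m ≤ l - k) :
    (tauMatrix l k m).det ≠ 0 := by
  intro h
  obtain ⟨v, hv, h0⟩ := Matrix.exists_mulVec_eq_zero_iff.mpr h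
  refine hv (polyTau_injective hkl hm ?_)
  rw [← polyOf_tauMatrix_mulVec hk hkl hm, h0]
  simp [polyOf]

end OrbitC

end

/-! ### Block diagonalization of `η` by divided differences. -/

noncomputable section

open Polynomial
open scoped ContDiff Topology Matrix

namespace OrbitC

open FlatPencil

variable {k n m : ℕ}

/-! ### The tensor `η` in the coordinates `ϖ` -/

/-- The indices of the three blocks of `η` in the coordinates `ϖ`. -/
def blockEquiv (k n m : ℕ) : Fin (k + 1) ⊕ (Fin n ⊕ Fin m) ≃ Fin (k + n + m + 1) :=
  ((Equiv.sumCongr (Fin.revPerm (n := k + 1)) (finSumFinEquiv (m := n) (n := m))).trans finSumFinEquiv).trans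
    (finCongr (show k + 1 + (n + m) = k + n + m + 1 by omega))

theorem blockEquiv_inl (i : Fin (k + 1)) : (blockEquiv k n m (Sum.inl i) : ℕ) = k - i := by
  simp [blockEquiv, Fin.val_rev]

theorem blockEquiv_inr_inl (i : Fin n) :
    (blockEquiv k n m (Sum.inr (Sum.inl i)) : ℕ) = k + 1 + i := by
  simp [blockEquiv]

theorem blockEquiv_inr_inr (i : Fin m) :
    (blockEquiv k n m (Sum.inr (Sum.inr i)) : ℕ) = k + 1 + (n + i) := by
  simp [blockEquiv]

/-- The coefficients `ϖ^{k - a}`, with value `0` for `a > k`. -/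
def coordX (ϖ : Fin (k + n + m + 1) → ℂ) (a : ℕ) : ℂ :=
  if a ≤ k then ϖ ⟨k - a, by omega⟩ else 0

/-- The coefficients `ϖ^{k + b}`, with value `0` for `b > n`. -/
def coordY (ϖ : Fin (k + n + m + 1) → ℂ) (b : ℕ) : ℂ :=
  if h : b ≤ n then ϖ ⟨k + b, by omega⟩ else 0

/-- The coefficients `ϖ^{k + n + i}`, with value `0` for `i > m`. -/
def coordZ (ϖ : Fin (k + n + m + 1) → ℂ) (i : ℕ) : ℂ :=
  if h : i ≤ m then ϖ ⟨k + n + i, by omega⟩ else 0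

/-- The entries of the first block of `η`. -/
def entryX (ϖ : Fin (k + n + m + 1) → ℂ) (s : ℕ) : ℂ :=
  s * coordX ϖ s + 4 * (s + 1) * coordX ϖ (s + 1)

/-- The entries of the second block of `η`. -/
def entryY (ϖ : Fin (k + n + m + 1) → ℂ) (s : ℕ) : ℂ :=
  (s + 2) * coordY ϖ (s + 2) + 4 * (s + 1) * coordY ϖ (s + 1)

/-- The entries of the third block of `η`. -/
def entryZ (ϖ : Fin (k + n + m + 1) → ℂ) (s : ℕ) : ℂ :=
  4 * (s + 1) * (coordZ ϖ (s + 1) - coordZ ϖ (s + 2))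

/-- The tensor `η` in the coordinates `ϖ`. -/
def tauEta (ϖ : Fin (k + n + m + 1) → ℂ) :
    Matrix (Fin (k + n + m + 1)) (Fin (k + n + m + 1)) ℂ :=
  Matrix.reindex (blockEquiv k n m) (blockEquiv k n m)
    (Matrix.fromBlocks (hankel (k + 1) (entryX ϖ)) 0 0
      (Matrix.fromBlocks (hankel n (entryY ϖ)) 0 0 (hankel m (entryZ ϖ))))

theorem entryX_eq_zero (ϖ : Fin (k + n + m + 1) → ℂ) {s : ℕ} (hs : k + 1 ≤ s) :
    entryX ϖ s = 0 := by
  simp [entryX, coordX, show ¬ s ≤ k by omega, show ¬ s + 1 ≤ k by omega]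

theorem entryY_eq_zero (ϖ : Fin (k + n + m + 1) → ℂ) {s : ℕ} (hs : n ≤ s) :
    entryY ϖ s = 0 := by
  simp [entryY, coordY, show ¬ s + 2 ≤ n by omega, show ¬ s + 1 ≤ n by omega]

theorem entryZ_eq_zero (ϖ : Fin (k + n + m + 1) → ℂ) {s : ℕ} (hs : m ≤ s) :
    entryZ ϖ s = 0 := by
  simp [entryZ, coordZ, show ¬ s + 2 ≤ m by omega, show ¬ s + 1 ≤ m by omega]

theorem det_tauEta (ϖ : Fin (k + n + m + 1) → ℂ) : (tauEta ϖ).det =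
    ((-1) ^ (k + 1).choose 2 * (k * ϖ 0) ^ (k + 1)) *
    (((-1) ^ n.choose 2 * (4 * n * ϖ ⟨k + n, by omega⟩) ^ n) *
      ((-1) ^ m.choose 2 * (4 * m * ϖ ⟨k + n + m, by omega⟩) ^ m)) := by
  rw [tauEta, Matrix.det_reindex_self, Matrix.det_fromBlocks_zero₂₁, Matrix.det_fromBlocks_zero₂₁,
    det_hankel _ _ fun s hs => entryX_eq_zero ϖ hs, det_hankel _ _ fun s hs => entryY_eq_zero ϖ hs,
    det_hankel _ _ fun s hs => entryZ_eq_zero ϖ hs]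
  have h1 : entryX ϖ k = k * ϖ 0 := by
    have : (⟨0, by omega⟩ : Fin (k + n + m + 1)) = 0 := rfl
    simp [entryX, coordX, this]
  have h2 : entryY ϖ (n - 1) ^ n = (4 * n * ϖ ⟨k + n, by omega⟩) ^ n := by
    rcases n with _ | n
    · simp
    · simp [entryY, coordY]
  have h3 : entryZ ϖ (m - 1) ^ m = (4 * m * ϖ ⟨k + n + m, by omega⟩) ^ m := by
    rcases m with _ | m
    · simp
    · simp [entryZ, coordZ]
  rw [Nat.add_sub_cancel, h1, h2, h3]

theorem gen_mul_mul {l : ℕ} (M A : Matrix (Fin (l + 1)) (Fin (l + 1)) ℂ) (u v : ℂ) :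
    gen (M * A * Mᵀ) u v = ∑ a, ∑ b, A a b * (polyOf l fun i => M i a).eval u *
      (polyOf l fun j => M j b).eval v := by
  unfold gen
  simp only [Matrix.mul_apply, Matrix.transpose_apply, eval_polyOf, Finset.sum_mul,
    Finset.mul_sum]
  rw [Finset.sum_congr rfl fun i _ => Finset.sum_congr rfl fun j _ => Finset.sum_comm]
  rw [Finset.sum_congr rfl fun i _ => Finset.sum_comm, Finset.sum_comm]
  refine Finset.sum_congr rfl fun a _ => ?_
  rw [Finset.sum_congr rfl fun i _ => Finset.sum_comm, Finset.sum_comm]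
  refine Finset.sum_congr rfl fun b _ => ?_
  rw [Finset.sum_comm]
  exact Finset.sum_congr rfl fun i _ => Finset.sum_congr rfl fun j _ => by ring

/-- The numerator of the logarithmic derivative of `P / P₀`. -/
def defect (m n : ℕ) (P : ℂ[X]) (u : ℂ) : ℂ :=
  (4 - u ^ 2) * (derivative P).eval u - P.eval u * (2 * (m - n) - (m + n) * u)

/-- The identity of `shiftPoly_derivative` holds for arbitrary exponents `a, b`; taking its `k` to
be `0` and its `l` to be `a + b` yields it. -/
theorem defect_pow_mul_pow (m n a b : ℕ) (u : ℂ) :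
    defect m n ((X + C 2) ^ a * (X - C 2) ^ b) u =
      (u + 2) ^ a * (u - 2) ^ b * ((m - a) * (u - 2) + (n - b) * (u + 2)) := by
  have h := congrArg (eval u) (shiftPoly_derivative (a + b) 0 a)
  rw [shiftPoly, show a + b - 0 - a = b by omega] at h
  simp only [eval_mul, eval_sub, eval_ofNat, eval_pow, eval_X, eval_C, eval_add] at h
  rw [defect, h]
  simp only [eval_mul, eval_sub, eval_pow, eval_X, eval_C, eval_add]
  ring

theorem defect_neg (P : ℂ[X]) (u : ℂ) : defect m n (-P) u = -defect m n P u := by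
  simp only [defect, derivative_neg, eval_neg]; ring

theorem defect_sum {ι : Type*} (s : Finset ι) (c : ι → ℂ) (P : ι → ℂ[X]) (u : ℂ) :
    defect m n (∑ i ∈ s, C (c i) * P i) u = ∑ i ∈ s, c i * defect m n (P i) u := by
  simp only [defect, derivative_sum, derivative_mul, derivative_C, zero_mul, zero_add,
    eval_finsetSum, eval_mul, eval_C]
  rw [Finset.mul_sum, Finset.sum_mul, ← Finset.sum_sub_distrib]
  exact Finset.sum_congr rfl fun i _ => by ring

/-- In the polarized kernel the terms with `u v - 4` cancel, and the first-order equation for `P₀`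
absorbs the terms with `k - l`. Because `defect` equals `P₀ (4 - u²) (P/P₀)'` where `P₀ ≠ 0`, the
result is a divided difference numerator. -/
theorem kernel_add_kernel (P : ℂ[X]) (u v : ℂ) :
    kernel (k + n + m) k P (shiftPoly (k + n + m) k m) u v +
      kernel (k + n + m) k (shiftPoly (k + n + m) k m) P u v =
    (v - u) * ((shiftPoly (k + n + m) k m).eval v * defect m n P u -
      (shiftPoly (k + n + m) k m).eval u * defect m n P v) := by
  have hev : ∀ u : ℂ, (4 - u ^ 2) * (derivative (shiftPoly (k + n + m) k m)).eval u =
      (shiftPoly (k + n + m) k m).eval u * (2 * (m - n) - (m + n) * u) := by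
    intro u
    have := congrArg (eval u) (shiftPoly_derivative (k + n + m) k m)
    rw [show k + n + m - k - m = n by omega] at this
    simpa using this
  simp only [kernel, coe_aeval_eq_eval, defect, Nat.cast_add]
  linear_combination (eval v P * (v - u)) * hev u - (eval u P * (v - u)) * hev v

theorem eval_shiftPoly (u : ℂ) : (shiftPoly (k + n + m) k m).eval u = (u + 2) ^ m * (u - 2) ^ n := by
  rw [shiftPoly, show k + n + m - k - m = n by omega]; simp

theorem tauBasis_inl (i : Fin (k + 1)) : tauBasis (k + n + m) k m (blockEquiv k n m (Sum.inl i)) =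
    (X + C 2) ^ m * (X - C 2) ^ (n + (i : ℕ)) := by
  have := i.2
  rw [tauBasis, blockEquiv_inl, if_pos (by omega)]
  congr 2; omega

theorem tauBasis_inr_inl (i : Fin n) :
    tauBasis (k + n + m) k m (blockEquiv k n m (Sum.inr (Sum.inl i))) =
    (X + C 2) ^ m * (X - C 2) ^ (n - 1 - (i : ℕ)) := by
  have := i.2
  rw [tauBasis, blockEquiv_inr_inl, if_pos (by omega)]
  congr 2; omega

theorem tauBasis_inr_inr (i : Fin m) :
    tauBasis (k + n + m) k m (blockEquiv k n m (Sum.inr (Sum.inr i))) =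
    -((X + C 2) ^ (m - 1 - (i : ℕ)) * (X - C 2) ^ (n + (i : ℕ))) := by
  have := i.2
  rw [tauBasis, blockEquiv_inr_inr, if_neg (by omega)]
  congr 3 <;> omega

/-- With `w = u - 2` one has `4 - u² = -w (w + 4)`, so `(4 - u²) d/du` sends `w^i` to `-i (w^{i+1} +
4 w^i)`. Collecting powers by an index shift gives the entries `entryX`. -/
theorem sum_entryX (ϖ : Fin (k + n + m + 1) → ℂ) (w z : ℂ) :
    (z - w) * ∑ i : Fin (k + 1), ∑ j : Fin (k + 1), hankel (k + 1) (entryX ϖ) i j *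
      w ^ (i : ℕ) * z ^ (j : ℕ) = ∑ i : Fin (k + 1), ϖ (blockEquiv k n m (Sum.inl i)) *
      (-(i * (w ^ ((i : ℕ) + 1) + 4 * w ^ (i : ℕ))) - -(i * (z ^ ((i : ℕ) + 1) + 4 * z ^ (i : ℕ)))) := by
  have h1 : ∀ i : Fin (k + 1), ϖ (blockEquiv k n m (Sum.inl i)) = coordX ϖ i := by
    intro i
    rw [coordX, if_pos (by omega)]
    exact congrArg ϖ (Fin.ext (blockEquiv_inl i))
  have h2 := sum_hankel (k + 1) (entryX ϖ) (fun s hs => entryX_eq_zero ϖ hs) w z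
  have h3 := sum_range_shift (k + 1) (fun s => 4 * s * coordX ϖ s * (w ^ s - z ^ s))
    (by simp [coordX])
  simp only [h1]
  rw [← neg_sub, neg_mul, h2, ← Finset.sum_range fun i : ℕ => coordX ϖ i *
    (-(i * (w ^ (i + 1) + 4 * w ^ i)) - -(i * (z ^ (i + 1) + 4 * z ^ i)))]
  have h4 : ∑ s ∈ Finset.range (k + 1), entryX ϖ s * (w ^ (s + 1) - z ^ (s + 1)) =
      ∑ s ∈ Finset.range (k + 1), s * coordX ϖ s * (w ^ (s + 1) - z ^ (s + 1)) +
      ∑ s ∈ Finset.range (k + 1), 4 * s * coordX ϖ s * (w ^ s - z ^ s) := by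
    rw [h3, Nat.cast_zero, mul_zero, zero_mul, zero_mul, zero_add, ← Finset.sum_add_distrib]
    refine Finset.sum_congr rfl fun s _ => ?_
    rw [entryX, Nat.cast_succ]; ring
  rw [h4, ← Finset.sum_add_distrib, ← Finset.sum_neg_distrib]
  exact Finset.sum_congr rfl fun s _ => by ring

/-- For `p = 1/(u - 2)`, the operator `(4 - u²) d/du` sends `p^{i+1}` to `(i + 1)(p^i + 4 p^{i+1})`.
-/
theorem sum_entryY (ϖ : Fin (k + n + m + 1) → ℂ) (p q : ℂ) :
    (p - q) * ∑ i : Fin n, ∑ j : Fin n, hankel n (entryY ϖ) i j *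
      p ^ (i : ℕ) * q ^ (j : ℕ) = ∑ i : Fin n, ϖ (blockEquiv k n m (Sum.inr (Sum.inl i))) *
      ((i + 1) * (p ^ (i : ℕ) + 4 * p ^ ((i : ℕ) + 1)) -
        (i + 1) * (q ^ (i : ℕ) + 4 * q ^ ((i : ℕ) + 1))) := by
  have h1 : ∀ i : Fin n, ϖ (blockEquiv k n m (Sum.inr (Sum.inl i))) = coordY ϖ (i + 1) := by
    intro i
    rw [coordY, dif_pos (by omega)]
    exact congrArg ϖ (Fin.ext (by rw [blockEquiv_inr_inl]; simp only; omega))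
  have h2 := sum_hankel n (entryY ϖ) (fun s hs => entryY_eq_zero ϖ hs) p q
  have h3 := sum_range_shift n (fun s => (s + 1) * coordY ϖ (s + 1) * (p ^ s - q ^ s))
    (by simp [coordY])
  simp only [h1]
  rw [h2, ← Finset.sum_range fun i : ℕ => coordY ϖ (i + 1) *
    ((i + 1) * (p ^ i + 4 * p ^ (i + 1)) - (i + 1) * (q ^ i + 4 * q ^ (i + 1)))]
  have h4 : ∑ s ∈ Finset.range n, entryY ϖ s * (p ^ (s + 1) - q ^ (s + 1)) =
      ∑ s ∈ Finset.range n, 4 * (s + 1) * coordY ϖ (s + 1) * (p ^ (s + 1) - q ^ (s + 1)) +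
      ∑ s ∈ Finset.range n, (s + 1) * coordY ϖ (s + 1) * (p ^ s - q ^ s) := by
    rw [h3, pow_zero, pow_zero, sub_self, mul_zero, zero_add, ← Finset.sum_add_distrib]
    refine Finset.sum_congr rfl fun s _ => ?_
    rw [entryY, Nat.cast_succ]; ring
  rw [h4, ← Finset.sum_add_distrib]
  exact Finset.sum_congr rfl fun s _ => by ring

/-- For `p = (u - 2)/(u + 2)` one has `(u + 2)⁻¹ = (1 - p)/4` and `(4 - u²) dp/du = -4 p`, so `-(u +
2)⁻¹ p^i` is sent to `i p^i - (i + 1) p^{i+1}`. -/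
theorem sum_entryZ (ϖ : Fin (k + n + m + 1) → ℂ) (p q : ℂ) :
    (p - q) * ∑ i : Fin m, ∑ j : Fin m, hankel m (entryZ ϖ) i j *
      p ^ (i : ℕ) * q ^ (j : ℕ) = -4 * ∑ i : Fin m, ϖ (blockEquiv k n m (Sum.inr (Sum.inr i))) *
      ((i * p ^ (i : ℕ) - (i + 1) * p ^ ((i : ℕ) + 1)) -
        (i * q ^ (i : ℕ) - (i + 1) * q ^ ((i : ℕ) + 1))) := by
  have h1 : ∀ i : Fin m, ϖ (blockEquiv k n m (Sum.inr (Sum.inr i))) = coordZ ϖ (i + 1) := by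
    intro i
    rw [coordZ, dif_pos (by omega)]
    exact congrArg ϖ (Fin.ext (by rw [blockEquiv_inr_inr]; simp only; omega))
  have h2 := sum_hankel m (entryZ ϖ) (fun s hs => entryZ_eq_zero ϖ hs) p q
  have h3 := sum_range_shift m (fun s => s * coordZ ϖ (s + 1) * (p ^ s - q ^ s))
    (by simp [coordZ])
  simp only [h1]
  rw [h2, ← Finset.sum_range fun i : ℕ => coordZ ϖ (i + 1) *
    ((i * p ^ i - (i + 1) * p ^ (i + 1)) - (i * q ^ i - (i + 1) * q ^ (i + 1)))]
  have h4 : ∑ s ∈ Finset.range m, entryZ ϖ s * (p ^ (s + 1) - q ^ (s + 1)) =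
      4 * (∑ s ∈ Finset.range m, (s + 1) * coordZ ϖ (s + 1) * (p ^ (s + 1) - q ^ (s + 1)) -
      ∑ s ∈ Finset.range m, s * coordZ ϖ (s + 1) * (p ^ s - q ^ s)) := by
    rw [h3, pow_zero, pow_zero, sub_self, mul_zero, zero_add, ← Finset.sum_sub_distrib,
      Finset.mul_sum]
    refine Finset.sum_congr rfl fun s _ => ?_
    rw [entryZ, Nat.cast_succ]; ring
  rw [h4, ← Finset.sum_sub_distrib, Finset.mul_sum, Finset.mul_sum]
  exact Finset.sum_congr rfl fun s _ => by ring

/-- Away from `u, v = ±2` all basis polynomials are written as `P₀` times a power of `u - 2`, of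
`1/(u - 2)` up to one extra factor, or of `(u - 2)/(u + 2)` divided by `-(u + 2)`. The three sums
above then give the blocks, without mixed terms since the numerator is a sum over the basis. -/
theorem thetaEta_tauMatrix_mulVec (hk : 1 ≤ k) (ϖ : Fin (k + n + m + 1) → ℂ) :
    tauMatrix (k + n + m) k m * tauEta ϖ * (tauMatrix (k + n + m) k m)ᵀ =
      thetaEta (k + n + m) k m ((tauMatrix (k + n + m) k m).mulVec ϖ) := by
  have hkl : k ≤ k + n + m := by omega
  have hm : m ≤ k + n + m - k := by omega
  refine eq_of_sq_mul_gen_eq (S := {2, -2}) (Set.toFinite _) fun u hu v hv huv => ?_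
  simp only [Set.mem_insert_iff, Set.mem_singleton_iff, not_or] at hu hv
  have hu1 : u - 2 ≠ 0 := sub_ne_zero.mpr hu.1
  have hu2 : u + 2 ≠ 0 := fun h => hu.2 (eq_neg_of_add_eq_zero_left h)
  have hv1 : v - 2 ≠ 0 := sub_ne_zero.mpr hv.1
  have hv2 : v + 2 ≠ 0 := fun h => hv.2 (eq_neg_of_add_eq_zero_left h)
  rw [thetaEta, gen_add, mul_add, gen_thetaConn (hk.trans hkl), gen_thetaConn (hk.trans hkl),
    polyOf_shiftVec hm, polyOf_tauMatrix_mulVec hk hkl hm, kernel_add_kernel, polyTau_eq,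
    defect_sum, defect_sum, gen_mul_mul]
  simp only [polyOf_tauMatrix_col hk hkl hm]
  simp only [← (blockEquiv k n m).sum_comp, Fintype.sum_sum_type]
  simp only [tauEta, Matrix.reindex_apply, Matrix.submatrix_apply, Equiv.symm_apply_apply,
    Matrix.fromBlocks_apply₁₁, Matrix.fromBlocks_apply₁₂, Matrix.fromBlocks_apply₂₁,
    Matrix.fromBlocks_apply₂₂, Matrix.zero_apply, zero_mul, Finset.sum_const_zero, add_zero,
    zero_add]
  set Cu := (shiftPoly (k + n + m) k m).eval u with hCu
  set Cv := (shiftPoly (k + n + m) k m).eval v with hCv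
  have eX : ∀ u : ℂ, ∀ i : Fin (k + 1),
      (tauBasis (k + n + m) k m (blockEquiv k n m (Sum.inl i))).eval u =
      (shiftPoly (k + n + m) k m).eval u * (u - 2) ^ (i : ℕ) := by
    intro u i
    rw [tauBasis_inl, eval_shiftPoly]
    simp only [eval_mul, eval_sub, eval_pow, eval_X, eval_C, eval_add]
    ring
  have dX : ∀ u : ℂ, ∀ i : Fin (k + 1),
      defect m n (tauBasis (k + n + m) k m (blockEquiv k n m (Sum.inl i))) u =
      (shiftPoly (k + n + m) k m).eval u *
        -(i * ((u - 2) ^ ((i : ℕ) + 1) + 4 * (u - 2) ^ (i : ℕ))) := by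
    intro u i
    rw [tauBasis_inl, eval_shiftPoly, defect_pow_mul_pow]
    push_cast
    ring
  have eY : ∀ u : ℂ, u - 2 ≠ 0 → ∀ i : Fin n,
      (tauBasis (k + n + m) k m (blockEquiv k n m (Sum.inr (Sum.inl i)))).eval u =
      (shiftPoly (k + n + m) k m).eval u * ((u - 2)⁻¹ * (u - 2)⁻¹ ^ (i : ℕ)) := by
    intro u hu i
    obtain ⟨d, hd⟩ : ∃ d, n = d + 1 + i := ⟨n - 1 - i, by omega⟩
    have hp : (u - 2) ^ n = (u - 2) ^ d * (u - 2) * (u - 2) ^ (i : ℕ) := by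
      rw [← pow_succ, ← pow_add, ← hd]
    rw [tauBasis_inr_inl, eval_shiftPoly]
    simp only [eval_mul, eval_sub, eval_pow, eval_X, eval_C, eval_add]
    rw [show n - 1 - (i : ℕ) = d by omega]
    rw [inv_pow, hp]
    field_simp
  have dY : ∀ u : ℂ, u - 2 ≠ 0 → ∀ i : Fin n,
      defect m n (tauBasis (k + n + m) k m (blockEquiv k n m (Sum.inr (Sum.inl i)))) u =
      (shiftPoly (k + n + m) k m).eval u *
        ((i + 1) * ((u - 2)⁻¹ ^ (i : ℕ) + 4 * (u - 2)⁻¹ ^ ((i : ℕ) + 1))) := by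
    intro u hu i
    obtain ⟨d, hd⟩ : ∃ d, n = d + 1 + i := ⟨n - 1 - i, by omega⟩
    have hp : (u - 2) ^ n = (u - 2) ^ d * (u - 2) * (u - 2) ^ (i : ℕ) := by
      rw [← pow_succ, ← pow_add, ← hd]
    rw [tauBasis_inr_inl, eval_shiftPoly, defect_pow_mul_pow]
    rw [show n - 1 - (i : ℕ) = d by omega, show (n : ℂ) = d + 1 + i by exact_mod_cast hd]
    rw [inv_pow, inv_pow, hp]
    field_simp
    ring
  have eZ : ∀ u : ℂ, u + 2 ≠ 0 → ∀ i : Fin m,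
      (tauBasis (k + n + m) k m (blockEquiv k n m (Sum.inr (Sum.inr i)))).eval u =
      -((shiftPoly (k + n + m) k m).eval u * ((u + 2)⁻¹ * ((u - 2) * (u + 2)⁻¹) ^ (i : ℕ))) := by
    intro u hu i
    obtain ⟨d, hd⟩ : ∃ d, m = d + 1 + i := ⟨m - 1 - i, by omega⟩
    have hp : (u + 2) ^ m = (u + 2) ^ d * (u + 2) * (u + 2) ^ (i : ℕ) := by
      rw [← pow_succ, ← pow_add, ← hd]
    rw [tauBasis_inr_inr, eval_shiftPoly]
    simp only [eval_mul, eval_sub, eval_pow, eval_X, eval_C, eval_add, eval_neg]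
    rw [show m - 1 - (i : ℕ) = d by omega]
    rw [mul_pow, inv_pow, hp, pow_add]
    field_simp
  have dZ : ∀ u : ℂ, u + 2 ≠ 0 → ∀ i : Fin m,
      defect m n (tauBasis (k + n + m) k m (blockEquiv k n m (Sum.inr (Sum.inr i)))) u =
      (shiftPoly (k + n + m) k m).eval u *
        (i * ((u - 2) * (u + 2)⁻¹) ^ (i : ℕ) -
          (i + 1) * ((u - 2) * (u + 2)⁻¹) ^ ((i : ℕ) + 1)) := by
    intro u hu i
    obtain ⟨d, hd⟩ : ∃ d, m = d + 1 + i := ⟨m - 1 - i, by omega⟩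
    have hp : (u + 2) ^ m = (u + 2) ^ d * (u + 2) * (u + 2) ^ (i : ℕ) := by
      rw [← pow_succ, ← pow_add, ← hd]
    rw [tauBasis_inr_inr, eval_shiftPoly, defect_neg, defect_pow_mul_pow]
    rw [show m - 1 - (i : ℕ) = d by omega, show (m : ℂ) = d + 1 + i by exact_mod_cast hd]
    rw [hp]
    push_cast
    simp only [mul_pow, inv_pow, pow_add, pow_succ]
    field_simp
    ring
  simp only [eX, dX, eY u hu1, eY v hv1, dY u hu1, dY v hv1, eZ u hu2, eZ v hv2, dZ u hu2, dZ v hv2]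
  rw [← hCu, ← hCv]
  have sX := sum_entryX ϖ (u - 2) (v - 2)
  have sY := sum_entryY ϖ (u - 2)⁻¹ (v - 2)⁻¹
  have sZ := sum_entryZ ϖ ((u - 2) * (u + 2)⁻¹) ((v - 2) * (v + 2)⁻¹)
  simp only [mul_sub (ϖ _), Finset.sum_sub_distrib] at sX sY sZ
  have hS : ∀ (N : ℕ) (A : Matrix (Fin N) (Fin N) ℂ) (a b p q : ℂ),
      ∑ i : Fin N, ∑ j : Fin N, A i j * (Cu * (a * p ^ (i : ℕ))) * (Cv * (b * q ^ (j : ℕ))) =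
        Cu * Cv * (a * b) * ∑ i : Fin N, ∑ j : Fin N, A i j * p ^ (i : ℕ) * q ^ (j : ℕ) := by
    intro N A a b p q
    simp only [Finset.mul_sum]
    exact Finset.sum_congr rfl fun i _ => Finset.sum_congr rfl fun j _ => by ring
  have hT : ∀ (N : ℕ) (f : Fin N → Fin (k + n + m + 1)) (g : Fin N → ℂ) (c : ℂ),
      ∑ i, ϖ (f i) * (c * g i) = c * ∑ i, ϖ (f i) * g i := by
    intro N f g c
    rw [Finset.mul_sum]
    exact Finset.sum_congr rfl fun i _ => by ring
  have hX := hS (k + 1) (hankel (k + 1) (entryX ϖ)) 1 1 (u - 2) (v - 2)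
  simp only [one_mul, mul_one] at hX
  simp only [neg_mul_neg, mul_neg (hankel _ _ _ _)]
  rw [hX, hS, hS]
  simp only [hT, mul_sub (ϖ _), Finset.sum_sub_distrib]
  -- Passing from the auxiliary variables back to `v - u` produces exactly the extra factors `(u -
  -- 2)⁻¹ (v - 2)⁻¹` and, in the third block, `-4 (u + 2)⁻¹ (v + 2)⁻¹`.
  have hp : (u - 2)⁻¹ - (v - 2)⁻¹ = (v - u) * ((u - 2)⁻¹ * (v - 2)⁻¹) := by field_simp; ring
  have hq : (u - 2) * (u + 2)⁻¹ - (v - 2) * (v + 2)⁻¹ =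
      -4 * ((v - u) * ((u + 2)⁻¹ * (v + 2)⁻¹)) := by field_simp; ring
  rw [hp] at sY
  rw [hq] at sZ
  rw [show v - 2 - (u - 2) = v - u by ring] at sX
  linear_combination (v - u) * Cu * Cv * (sX + sY - sZ / 4)

end OrbitC

end

/-! ### The coordinates `τ`, and the determinant of `η` in them. -/

noncomputable section

open Polynomial
open scoped ContDiff Topology Matrix

namespace OrbitC

open FlatPencil

variable {l k m : ℕ}

/-! ### The coordinates `τ` -/

theorem tauMatrix_mul_inv (hk : 1 ≤ k) (hkl : k ≤ l) (hm : m ≤ l - k) (v : Fin (l + 1) → ℂ) :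
    (tauMatrix l k m).mulVec ((tauMatrix l k m)⁻¹.mulVec v) = v := by
  rw [Matrix.mulVec_mulVec, Matrix.mul_nonsing_inv _ (isUnit_iff_ne_zero.mpr
    (det_tauMatrix_ne_zero hk hkl hm)), Matrix.one_mulVec]

theorem tauMatrix_inv_mul (hk : 1 ≤ k) (hkl : k ≤ l) (hm : m ≤ l - k) (v : Fin (l + 1) → ℂ) :
    (tauMatrix l k m)⁻¹.mulVec ((tauMatrix l k m).mulVec v) = v := by
  rw [Matrix.mulVec_mulVec, Matrix.nonsing_inv_mul _ (isUnit_iff_ne_zero.mpr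
    (det_tauMatrix_ne_zero hk hkl hm)), Matrix.one_mulVec]

theorem theta_thetaInv_inv_mulVec (hk : 1 ≤ k) (hkl : k ≤ l) (hm : m ≤ l - k)
    (y : Fin (l + 1) → ℂ) :
    theta l k (thetaInv l k ((tauMatrix l k m)⁻¹.mulVec (theta l k y)) (y (Fin.last l))) =
      (tauMatrix l k m)⁻¹.mulVec (theta l k y) := by
  refine theta_thetaInv ?_
  rw [← tauMatrix_mulVec_zero hk hkl hm (Matrix.mulVec _ _), tauMatrix_mul_inv hk hkl hm, theta_zero]

theorem theta_thetaInv_mulVec (hk : 1 ≤ k) (hkl : k ≤ l) (hm : m ≤ l - k)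
    (t : Fin (l + 1) → ℂ) :
    theta l k (thetaInv l k ((tauMatrix l k m).mulVec (theta l k t)) (t (Fin.last l))) =
      (tauMatrix l k m).mulVec (theta l k t) := by
  refine theta_thetaInv ?_
  rw [tauMatrix_mulVec_zero hk hkl hm, theta_zero]

/-- The coordinates `τ` as functions of `y`. -/
def tauEquiv (hk : 1 ≤ k) (hkl : k ≤ l) (hm : m ≤ l - k) :
    (Fin (l + 1) → ℂ) ≃ (Fin (l + 1) → ℂ) where
  toFun y := thetaInv l k ((tauMatrix l k m)⁻¹.mulVec (theta l k y)) (y (Fin.last l))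
  invFun t := thetaInv l k ((tauMatrix l k m).mulVec (theta l k t)) (t (Fin.last l))
  left_inv y := by
    simp only [theta_thetaInv_inv_mulVec hk hkl hm, tauMatrix_mul_inv hk hkl hm, thetaInv_last,
      thetaInv_theta]
  right_inv t := by
    simp only [theta_thetaInv_mulVec hk hkl hm, tauMatrix_inv_mul hk hkl hm, thetaInv_last,
      thetaInv_theta]

theorem tauEquiv_last (hk : 1 ≤ k) (hkl : k ≤ l) (hm : m ≤ l - k) (y : Fin (l + 1) → ℂ) :
    tauEquiv hk hkl hm y (Fin.last l) = y (Fin.last l) := thetaInv_last _ _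

theorem theta_tauEquiv (hk : 1 ≤ k) (hkl : k ≤ l) (hm : m ≤ l - k) (y : Fin (l + 1) → ℂ) :
    theta l k (tauEquiv hk hkl hm y) = (tauMatrix l k m)⁻¹.mulVec (theta l k y) :=
  theta_thetaInv_inv_mulVec hk hkl hm y

theorem differentiable_thetaInv (A : Matrix (Fin (l + 1)) (Fin (l + 1)) ℂ) :
    Differentiable ℂ fun y => thetaInv l k (A.mulVec (theta l k y)) (y (Fin.last l)) := by
  have h : Differentiable ℂ fun y => A.mulVec (theta l k y) :=
    (differentiable_mulVec A).comp ((contDiff_theta l k).differentiable (by simp))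
  rw [differentiable_pi] at h ⊢
  intro j
  refine Fin.lastCases ?_ (fun j => ?_) j
  · simp only [thetaInv_last]; fun_prop
  · simp only [thetaInv_castSucc]
    have := h j.succ
    fun_prop

theorem tauEquiv_eq_iff (hk : 1 ≤ k) (hkl : k ≤ l) (hm : m ≤ l - k) (y t : Fin (l + 1) → ℂ) :
    tauEquiv hk hkl hm y = t ↔ t (Fin.last l) = y (Fin.last l) ∧
      polyOf l (theta l k y) = polyTau l k m (theta l k t) := by
  rw [← polyOf_tauMatrix_mulVec hk hkl hm, (polyOf_injective l).eq_iff]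
  constructor
  · rintro rfl
    rw [tauEquiv_last, theta_tauEquiv, tauMatrix_mul_inv hk hkl hm]
    exact ⟨rfl, rfl⟩
  · rintro ⟨h1, h2⟩
    refine theta_injective_of_last (k := k) ?_ ((tauEquiv_last hk hkl hm y).trans h1.symm)
    rw [theta_tauEquiv, h2, tauMatrix_inv_mul hk hkl hm]

/-! ### The determinant of `η` -/

/-- Differentiating `θ ∘ τ = M⁻¹ θ` relates the Jacobians. The determinants of `M` and of `θ` at `y`
cancel, leaving only the Jacobian from `τ` to `ϖ`. -/
theorem det_eta_tau_mul (hk : 1 ≤ k) {n : ℕ} (hkl : k ≤ k + n + m) (hm : m ≤ k + n + m - k)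
    (y : Fin (k + n + m + 1) → ℂ) :
    (jacobian (tauEquiv hk hkl hm) y * orbitEta (k + n + m) k m y *
      (jacobian (tauEquiv hk hkl hm) y)ᵀ).det *
      (jacobian (theta (k + n + m) k) (tauEquiv hk hkl hm y)).det ^ 2 =
    (tauEta (theta (k + n + m) k (tauEquiv hk hkl hm y))).det := by
  set τ := tauEquiv hk hkl hm with hτ
  set M := tauMatrix (k + n + m) k m with hM
  have hM0 : M.det ≠ 0 := det_tauMatrix_ne_zero hk hkl hm
  have hθd : Differentiable ℂ (theta (k + n + m) k) := (contDiff_theta _ _).differentiable (by simp)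
  have hτd : Differentiable ℂ τ := differentiable_thetaInv _
  have h1 : jacobian (theta (k + n + m) k) (τ y) * jacobian τ y =
      M⁻¹ * jacobian (theta (k + n + m) k) y := by
    rw [← jacobian_comp (hθd _) (hτd _)]
    simp only [hτ, theta_tauEquiv]
    rw [jacobian_comp (differentiable_mulVec _ _) (hθd _), jacobian_mulVec]
  have h2 := congrArg Matrix.det h1
  rw [Matrix.det_mul, Matrix.det_mul, Matrix.det_nonsing_inv, Ring.inverse_eq_inv'] at h2
  have h3 := det_jacobian_theta_ne_zero (l := k + n + m) hk y
  have h4 : theta (k + n + m) k y = M.mulVec (theta (k + n + m) k (τ y)) := by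
    rw [hτ, theta_tauEquiv, tauMatrix_mul_inv hk hkl hm]
  rw [orbitEta_eq hk hkl hm, yEta, pullMetric, h4, ← thetaEta_tauMatrix_mulVec hk]
  simp only [Matrix.det_mul, Matrix.det_transpose, Matrix.det_nonsing_inv, Ring.inverse_eq_inv']
  set d := (jacobian (theta (k + n + m) k) y).det
  set L := (jacobian (theta (k + n + m) k) (τ y)).det
  set J := (jacobian τ y).det
  set E := (tauEta (theta (k + n + m) k (τ y))).det
  rw [← hM]
  calc _ = (L * J) ^ 2 * (M.det * d⁻¹) ^ 2 * E := by ring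
    _ = (M.det⁻¹ * M.det * (d * d⁻¹)) ^ 2 * E := by rw [h2]; ring
    _ = E := by rw [inv_mul_cancel₀ hM0, mul_inv_cancel₀ h3]; ring

theorem sum_sub_succ_mul_two (hkl : k ≤ l) :
    (∑ j : Fin l, (k - ((j : ℕ) + 1))) * 2 = k * (k - 1) := by
  obtain ⟨d, rfl⟩ := Nat.exists_eq_add_of_le hkl
  rw [← Finset.sum_range fun j => k - (j + 1), Finset.sum_range_add,
    Finset.sum_eq_zero (s := Finset.range d) fun j _ => by omega, add_zero,
    ← Finset.sum_range_id_mul_two, ← Finset.sum_range_reflect]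
  congr 1
  refine Finset.sum_congr rfl fun j hj => ?_
  rw [Finset.mem_range] at hj
  omega

/-- The exponents add up to `2k + k(k - 1) = k(k + 1)` times `y^{l+1}`. This power of `θ^0` is what
the first block of `η` contributes, so the determinant in `τ` is free of exponentials. -/
theorem sq_det_jacobian_theta (hk : 1 ≤ k) (hkl : k ≤ l) (y : Fin (l + 1) → ℂ) :
    (jacobian (theta l k) y).det ^ 2 = k ^ 2 * theta l k y 0 ^ (k + 1) := by
  have h2 : (∑ j : Fin l, ((k - ((j : ℕ) + 1) : ℕ) : ℂ)) * 2 = k * (k - 1) := by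
    have := sum_sub_succ_mul_two hkl
    have h := congrArg (Nat.cast (R := ℂ)) this
    push_cast [Nat.cast_sub hk] at h
    exact_mod_cast h
  rw [det_jacobian_theta, ← Complex.exp_sum, ← Finset.sum_mul, theta_zero, mul_pow, mul_pow,
    mul_pow, ← pow_mul, mul_comm l 2, pow_mul, neg_one_sq, one_pow, one_mul, mul_assoc,
    ← Complex.exp_nat_mul, ← Complex.exp_nat_mul, ← Complex.exp_nat_mul, ← Complex.exp_add]
  congr 2
  push_cast
  linear_combination y (Fin.last l) * h2

theorem theta_of_le (hk : 1 ≤ k) {j : ℕ} (hj : k ≤ j) (hjl : j ≤ l) (y : Fin (l + 1) → ℂ) :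
    theta l k y ⟨j, by omega⟩ = y ⟨j - 1, by omega⟩ := by
  obtain ⟨i, rfl⟩ : ∃ i, j = i + 1 := ⟨j - 1, by omega⟩
  have h := theta_succ (k := k) y (⟨i, by omega⟩ : Fin l)
  rw [show k - (i + 1) = 0 by omega] at h
  simpa using h

theorem neg_one_pow_choose_two (hk : 1 ≤ k) :
    (-1 : ℂ) ^ (k + 1).choose 2 = (-1) ^ (1 + (k - 1).choose 2) := by
  obtain ⟨j, rfl⟩ : ∃ j, k = j + 1 := ⟨k - 1, by omega⟩
  rw [show (j + 1 + 1).choose 2 = 1 + j.choose 2 + 2 * j by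
    rw [Nat.choose_succ_succ' (j + 1) 1, Nat.choose_succ_succ' j 1]; simp; ring, pow_add _ _ (2 * j),
    pow_mul]
  simp

theorem det_eta_tau (hk : 1 ≤ k) (hkl : k ≤ l) (hm : m ≤ l - k) (y : Fin (l + 1) → ℂ) :
    (jacobian (tauEquiv hk hkl hm) y * orbitEta l k m y *
      (jacobian (tauEquiv hk hkl hm) y).transpose).det =
    (-1) ^ (1 + (k - 1).choose 2 + (l - k - m).choose 2 + m.choose 2) *
      (k : ℂ) ^ (k - 1) * 4 ^ (l - k) * (m : ℂ) ^ m *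
      ((l - k - m : ℕ) : ℂ) ^ (l - k - m) *
      (tauEquiv hk hkl hm y ⟨l - m - 1, by omega⟩) ^ (l - k - m) *
      (tauEquiv hk hkl hm y ⟨l - 1, by omega⟩) ^ m := by
  obtain ⟨n, rfl⟩ : ∃ n, l = k + n + m := ⟨l - k - m, by omega⟩
  have h := det_eta_tau_mul hk hkl hm y
  set t := tauEquiv hk hkl hm y
  have hk0 : (k : ℂ) ≠ 0 := by exact_mod_cast (by omega : k ≠ 0)
  have h0 : theta (k + n + m) k t 0 ≠ 0 := by rw [theta_zero]; exact Complex.exp_ne_zero _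
  rw [sq_det_jacobian_theta hk hkl, det_tauEta, theta_of_le (j := k + n) hk (by omega) (by omega),
    theta_of_le (j := k + n + m) hk (by omega) (by omega), neg_one_pow_choose_two hk] at h
  refine mul_right_cancel₀ (mul_ne_zero (pow_ne_zero 2 hk0) (pow_ne_zero (k + 1) h0)) (h.trans ?_)
  simp only [show k + n + m - k = n + m by omega, Nat.add_sub_cancel]
  have hkk : (k : ℂ) ^ (k + 1) = k ^ (k - 1) * k ^ 2 := by rw [← pow_add]; congr 1; omega
  rw [mul_pow, hkk]
  simp only [mul_pow, pow_add]
  ring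

theorem exists_det_orbitEta_ne_zero (hk : 1 ≤ k) (hkl : k ≤ l) (hm : m ≤ l - k) :
    ∃ y, (orbitEta l k m y).det ≠ 0 := by
  -- At the point with all `τ^j = 1` only the constant is left, and it is nonzero thanks to `0^0 =
  -- 1`.
  refine ⟨(tauEquiv hk hkl hm).symm 1, fun h0 => ?_⟩
  have h := det_eta_tau hk hkl hm ((tauEquiv hk hkl hm).symm 1)
  rw [Matrix.det_mul, Matrix.det_mul, h0, mul_zero, zero_mul, Equiv.apply_symm_apply] at h
  have hself : ∀ a : ℕ, (a : ℂ) ^ a ≠ 0 := by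
    intro a
    rcases Nat.eq_zero_or_pos a with rfl | ha
    · simp
    · exact pow_ne_zero _ (by exact_mod_cast ha.ne')
  have hk0 : (k : ℂ) ≠ 0 := by exact_mod_cast (by omega : k ≠ 0)
  simp only [Pi.one_apply, one_pow, mul_one] at h
  exact mul_ne_zero (mul_ne_zero (mul_ne_zero (mul_ne_zero (pow_ne_zero _ (by norm_num))
    (pow_ne_zero _ hk0)) (pow_ne_zero _ (by norm_num))) (hself _)) (hself _) h.symm

/-! ### The coefficients of `P₀` -/

theorem sum_coeff_shiftPoly (hkl : k ≤ l) (hm : m ≤ l - k) :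
    ∑ j ∈ Finset.Icc k l, C ((shiftPoly l k m).coeff (l - j)) * X ^ (l - j) = shiftPoly l k m := by
  conv_rhs => rw [(shiftPoly l k m).as_sum_range_C_mul_X_pow, natDegree_shiftPoly hm]
  refine Finset.sum_nbij' (fun j => l - j) (fun i => l - i) ?_ ?_ ?_ ?_ fun _ _ => rfl
  all_goals
    intro j hj
    simp only [Finset.mem_Icc, Finset.mem_range] at hj ⊢
    omega

theorem coeff_shiftPoly (hm : m ≤ l - k) {j : ℕ} (hj : k ≤ j) (hjl : j ≤ l) :
    (shiftPoly l k m).coeff (l - j) =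
      (-2) ^ (j - k) * ∑ s ∈ Finset.range (m + 1), (-1) ^ (m - s) * (m.choose s : ℂ) *
        (if s ≤ l - j then ((l - k - m).choose (l - j - s) : ℂ) else 0) := by
  rw [shiftPoly, add_pow, Finset.sum_mul, finsetSum_coeff, Finset.mul_sum]
  refine Finset.sum_congr rfl fun s hs => ?_
  rw [Finset.mem_range] at hs
  have h1 : (X ^ s * C (2 : ℂ) ^ (m - s) * (m.choose s : ℂ[X])) * (X - C 2) ^ (l - k - m) =
      C (2 ^ (m - s) * (m.choose s : ℂ)) * ((X - C 2) ^ (l - k - m) * X ^ s) := by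
    simp only [C_mul, C_pow, C_eq_natCast]
    ring
  rw [h1, coeff_C_mul, coeff_mul_X_pow', sub_eq_add_neg X, ← C_neg]
  split_ifs with h
  · rw [coeff_X_add_C_pow]
    by_cases hle : l - j - s ≤ l - k - m
    · have h2 : (-2 : ℂ) ^ (l - k - m - (l - j - s)) * (-2) ^ (m - s) = (-2) ^ (j - k) := by
        rw [← pow_add]; congr 1; omega
      -- All powers of `2` are rewritten as powers of `-2`, so that they merge into `(-2)^{j-k}`;
      -- this is the origin of the signs `(-1)^{m-s}`.
      have h3 : (2 : ℂ) ^ (m - s) = (-2) ^ (m - s) * (-1) ^ (m - s) := by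
        rw [← mul_pow]; norm_num
      rw [← h2, h3]; ring
    · rw [Nat.choose_eq_zero_of_lt (show l - k - m < l - j - s by omega)]; simp
  · simp

end OrbitC

end

/-! ### Polynomial components in `θ`, and the admissible shifts. -/

noncomputable section

open Polynomial
open scoped ContDiff Topology Matrix

namespace OrbitC

open FlatPencil

variable {l k m : ℕ}

/-! ### The metric as a polynomial in `θ` -/

/-- The components of the contravariant connection as polynomials in `θ`. -/
def connPoly (l k : ℕ) (i j r : Fin (l + 1)) : MvPolynomial (Fin (l + 1)) ℂ :=
  ∑ a, MvPolynomial.X a * MvPolynomial.C (structConst l k r a i j)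

/-- The components of the metric as polynomials in `θ`. -/
def metricPoly (l k : ℕ) (i j : Fin (l + 1)) : MvPolynomial (Fin (l + 1)) ℂ :=
  ∑ r, MvPolynomial.X r * connPoly l k i j r

theorem eval_connPoly (θ : Fin (l + 1) → ℂ) (i j r : Fin (l + 1)) :
    MvPolynomial.eval θ (connPoly l k i j r) = thetaConn l k θ r i j := by
  simp [connPoly, thetaConn, Matrix.sum_apply]

theorem eval_metricPoly (θ : Fin (l + 1) → ℂ) (i j : Fin (l + 1)) :
    MvPolynomial.eval θ (metricPoly l k i j) = thetaMetric l k θ i j := by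
  simp [metricPoly, thetaMetric, Matrix.sum_apply, eval_connPoly]

/-- If `θ^0 = 0`, then `P` has degree at most `l - 1`, hence so has the generating function of the
metric in `u`, and the row of index `0` vanishes. The flat chart reaches only `θ^0 ≠ 0`; this covers
the complement. -/
theorem det_thetaMetric_of_zero (hk : 1 ≤ k) (hkl : k ≤ l) {θ : Fin (l + 1) → ℂ} (h0 : θ 0 = 0) :
    (thetaMetric l k θ).det = 0 := by
  set G := thetaMetric l k θ with hG
  set P := polyOf l θ with hP
  have hPd : P.natDegree ≤ l - 1 := by
    rw [natDegree_le_iff_coeff_eq_zero]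
    intro N hN
    rcases eq_or_ne N l with rfl | hNl
    · have := coeff_polyOf N θ 0
      rwa [Fin.val_zero, Nat.sub_zero, h0] at this
    · exact coeff_eq_zero_of_natDegree_lt (lt_of_le_of_lt (natDegree_polyOf_le l θ) (by omega))
  have hker : ∀ v : ℂ, (kernel l k P P (X : ℂ[X]) (C v)).natDegree ≤ l - 1 + 2 := by
    intro v
    rcases Nat.lt_or_ge 1 l with hl | hl
    · exact (natDegree_kernel_aux (by omega) hPd hPd v).2
    -- The degree estimate requires `1 ≤ l - 1`. For `l = k = 1` the polynomial is constant and the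
    -- kernel is zero.
    · obtain rfl : l = 1 := by omega
      obtain rfl : k = 1 := by omega
      rw [eq_C_of_natDegree_eq_zero (Nat.le_zero.mp hPd)]
      simp [kernel]
  have hrow : G 0 = 0 := by
    refine polyOf_injective l (polynomial_eq_of_eval_eq Set.finite_empty fun v _ => ?_)
    set q := polyOf l fun i => (polyOf l (G i)).eval v with hq
    have hqe : ∀ u, q.eval u = gen G u v := fun u => (gen_eq_eval G u v).symm
    have h1 : (X - C v) ^ 2 * q = kernel l k P P (X : ℂ[X]) (C v) := by
      refine Polynomial.funext fun u => ?_
      have h2 := map_kernel (aeval u) l k P P (X : ℂ[X]) (C v)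
      simp only [aeval_X, aeval_C, coe_aeval_eq_eval, Algebra.algebraMap_self_apply] at h2
      rw [h2, eval_mul, hqe, ← gen_thetaMetric (hk.trans hkl)]
      simp only [eval_pow, eval_sub, eval_X, eval_C]
      ring
    have h2 : q.natDegree ≤ l - 1 := natDegree_le_of_sq_mul (x := v) (by rw [h1]; exact hker v)
    have h3 := coeff_polyOf l (fun i => (polyOf l (G i)).eval v) 0
    rw [Fin.val_zero, Nat.sub_zero, ← hq, coeff_eq_zero_of_natDegree_lt (by omega)] at h3
    rw [← h3]
    simp [polyOf]
  exact Matrix.det_eq_zero_of_row_eq_zero 0 fun j => congrFun hrow j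

theorem exists_thetaChart_eq (hk : 1 ≤ k) {θ : Fin (l + 1) → ℂ} (h0 : θ 0 ≠ 0) :
    ∃ φ, thetaChart l k φ = θ := by
  have hk0 : (k : ℂ) ≠ 0 := by exact_mod_cast (by omega : k ≠ 0)
  obtain ⟨φ, hφ⟩ := phiChart_surjective l k (thetaInv l k θ (Complex.log (θ 0) / k))
  refine ⟨φ, ?_⟩
  rw [thetaChart, hφ, theta_thetaInv]
  rw [mul_div_cancel₀ _ hk0, Complex.exp_log h0]

theorem contraChristoffel_thetaMetric (hk : 1 ≤ k) (hkl : k ≤ l) {θ : Fin (l + 1) → ℂ}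
    (hd : (thetaMetric l k θ).det ≠ 0) (i j r : Fin (l + 1)) :
    contraChristoffel (thetaMetric l k) θ i j r = thetaConn l k θ r i j := by
  obtain ⟨φ, rfl⟩ := exists_thetaChart_eq (k := k) hk fun h0 =>
    hd (det_thetaMetric_of_zero hk hkl h0)
  exact ((isFlatChart_theta hk hkl).flatAt (contDiff_thetaChart l k) (Matrix.isSymm_diagonal _) φ
    (smoothAt_thetaMetric _) (smoothAt_thetaConn _) hd).contraChristoffel_eq
    (smoothAt_thetaMetric _) hd i j r

/-! ### The classification of the shifts -/

/-- A polynomial `C` with `(4 - X²) C' = C L` for a polynomial `L` has no roots besides `±2`. -/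
theorem eq_of_derivative_eq {P L : ℂ[X]} (h : (4 - X ^ 2) * derivative P = P * L) :
    ∃ (a : ℂ) (p q : ℕ), P = C a * ((X + C 2) ^ p * (X - C 2) ^ q) := by
  rcases eq_or_ne P 0 with rfl | hP
  · exact ⟨0, 0, 0, by simp⟩
  have hroot : ∀ r, P.IsRoot r → r = 2 ∨ r = -2 := by
    intro r hr
    by_contra! hne
    have h4 : (4 - X ^ 2 : ℂ[X]).rootMultiplicity r = 0 := by
      refine rootMultiplicity_eq_zero fun h0 => ?_
      have h1 : (r - 2) * (r + 2) = 0 := by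
        simp only [IsRoot.def, eval_sub, eval_ofNat, eval_pow, eval_X] at h0
        linear_combination -h0
      rcases mul_eq_zero.mp h1 with h1 | h1
      · exact hne.1 (sub_eq_zero.mp h1)
      · exact hne.2 (eq_neg_of_add_eq_zero_left h1)
    have hpos : 0 < P.rootMultiplicity r := (rootMultiplicity_pos hP).mpr hr
    have hd : derivative P ≠ 0 := by
      intro h0
      have hc := derivative_eq_zero.mp h0
      rw [eq_C_of_natDegree_eq_zero hc] at hr hP
      simp at hr
      exact hP (by simp [hr])
    have h4' : (4 - X ^ 2 : ℂ[X]) ≠ 0 := by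
      intro h0
      have := congrArg (eval 0) h0
      simp at this
    have hL : P * L ≠ 0 := by rw [← h]; exact mul_ne_zero h4' hd
    -- At a root `r ≠ ±2` of multiplicity `μ` the left side vanishes to order `μ - 1`, the right
    -- side at least to order `μ`.
    have h1 := congrArg (rootMultiplicity r) h
    rw [rootMultiplicity_mul (mul_ne_zero h4' hd), rootMultiplicity_mul hL, h4,
      derivative_rootMultiplicity_of_root hr] at h1
    omega
  have hs := (IsAlgClosed.splits P).eq_prod_roots
  have key : ∀ s : Multiset ℂ, (∀ r ∈ s, r = 2 ∨ r = -2) →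
      ∃ p q : ℕ, (s.map fun a => X - C a).prod = (X + C 2) ^ p * (X - C 2) ^ q := by
    intro s
    induction s using Multiset.induction_on with
    | empty => exact fun _ => ⟨0, 0, by simp⟩
    | cons a s ih =>
      intro hs
      obtain ⟨p, q, h⟩ := ih fun r hr => hs r (Multiset.mem_cons_of_mem hr)
      rw [Multiset.map_cons, Multiset.prod_cons, h]
      rcases hs a (Multiset.mem_cons_self a s) with rfl | rfl
      · exact ⟨p, q + 1, by ring⟩
      · exact ⟨p + 1, q, by rw [C_neg]; ring⟩
  obtain ⟨p, q, hpq⟩ := key P.roots fun r hr => hroot r (isRoot_of_mem_roots hr)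
  exact ⟨P.leadingCoeff, p, q, by rw [← hpq]; exact hs⟩

theorem thetaMetric_eq_zero_iff_kernel (hl : 1 ≤ l) (c : Fin (l + 1) → ℂ) :
    thetaMetric l k c = 0 ↔ ∀ u v : ℂ, kernel l k (polyOf l c) (polyOf l c) u v = 0 := by
  constructor
  · intro h u v
    rw [← gen_thetaMetric hl, h, gen_zero, mul_zero]
  · intro h
    refine eq_of_sq_mul_gen_eq Set.finite_empty fun u _ v _ _ => ?_
    rw [gen_thetaMetric hl, h, gen_zero, mul_zero]

/-- Freezing `v` at a point with `P(v) ≠ 0` turns the vanishing of the kernel into `(4 - u²) P' = P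
· L` with `L` affine of slope `k - l`. The equation confines the roots to `±2`, and the slope, equal
to minus the degree of `P`, fixes the degree. -/
theorem thetaMetric_eq_zero_iff (hk : 1 ≤ k) (hkl : k ≤ l) (c : Fin (l + 1) → ℂ) :
    thetaMetric l k c = 0 ↔
      ∃ (m : ℕ) (a : ℂ), m ≤ l - k ∧ polyOf l c = C a * shiftPoly l k m := by
  rw [thetaMetric_eq_zero_iff_kernel (hk.trans hkl)]
  constructor
  · intro h
    set P := polyOf l c with hP
    by_cases hP0 : P = 0
    · exact ⟨0, 0, Nat.zero_le _, by rw [hP0]; simp⟩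
    have hv : ∃ v, eval v P ≠ 0 := by
      by_contra! hv
      exact hP0 (Polynomial.funext fun v => by rw [hv, eval_zero])
    obtain ⟨v, hv⟩ := hv
    set b := (4 - v ^ 2) * eval v (derivative P) / eval v P with hb
    have hbv : b * eval v P = (4 - v ^ 2) * eval v (derivative P) := div_mul_cancel₀ _ hv
    have hL : (4 - X ^ 2) * derivative P = P * (C b - C ((k : ℂ) - l) * (C v - X)) := by
      refine polynomial_eq_of_eval_eq (Set.finite_singleton v) fun u hu => ?_
      have hu' : v - u ≠ 0 := sub_ne_zero.mpr (Ne.symm hu)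
      have h1 := h u v
      simp only [kernel, coe_aeval_eq_eval] at h1
      simp only [eval_mul, eval_sub, eval_ofNat, eval_pow, eval_X, eval_C]
      refine mul_right_cancel₀ (mul_ne_zero hv hu') ?_
      linear_combination h1 + eval u P * (v - u) * (-hbv)
    obtain ⟨a, p, q, hpq⟩ := eq_of_derivative_eq hL
    have ha : a ≠ 0 := by rintro rfl; exact hP0 (by rw [hpq]; simp)
    -- Both expressions for `(4 - X²) P' / P` are compared in degree one.
    have hdeg : p + q = l - k := by
      have h2 := shiftPoly_derivative (p + q) 0 p
      rw [shiftPoly, show p + q - 0 - p = q by omega] at h2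
      have h3 : P * (C (2 * ((p : ℂ) - q)) - C ((p : ℂ) + q) * X) =
          P * (C b - C ((k : ℂ) - l) * (C v - X)) := by
        rw [← hL, hpq, derivative_C_mul]
        linear_combination (-C a) * h2
      have h4 := congrArg (fun Q => coeff Q 1) (mul_left_cancel₀ hP0 h3)
      simp only [coeff_sub, coeff_C_mul, coeff_X_one, coeff_C_succ] at h4
      have h5 : ((p + q + k : ℕ) : ℂ) = l := by push_cast; linear_combination -h4
      have h6 : p + q + k = l := by exact_mod_cast h5
      omega
    refine ⟨p, a, by omega, ?_⟩
    rw [hpq, shiftPoly, show l - k - p = q by omega]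
  · rintro ⟨m, a, hm, h⟩ u v
    have h1 := kernel_shiftPoly hkl hm u v
    rw [h]
    simp only [kernel, coe_aeval_eq_eval, derivative_mul, derivative_C, zero_mul, zero_add,
      eval_mul, eval_C] at h1 ⊢
    linear_combination a ^ 2 * h1

/-- The connection is linear in `θ` and imposes no condition. The `t²` coefficient of the metric is
`thetaMetric l k c`, independent of the base point, so a second difference at `θ = 0` extracts it.
-/
theorem degree_le_one_iff (c : Fin (l + 1) → ℂ) :
    ((∀ θ i j, ∃ A B : ℂ, ∀ t : ℂ, MvPolynomial.eval (θ + t • c) (metricPoly l k i j) = A + t * B) ∧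
      (∀ θ i j r, ∃ A B : ℂ, ∀ t : ℂ,
        MvPolynomial.eval (θ + t • c) (connPoly l k i j r) = A + t * B)) ↔
      thetaMetric l k c = 0 := by
  simp only [eval_metricPoly, eval_connPoly, thetaMetric_add_smul, thetaConn_add_smul]
  constructor
  · rintro ⟨h, -⟩
    ext i j
    obtain ⟨A, B, hAB⟩ := h 0 i j
    have h0 := hAB 0
    have h1 := hAB 1
    have h2 := hAB (-1)
    simp only [Matrix.add_apply, Matrix.smul_apply, smul_eq_mul, Matrix.zero_apply] at h0 h1 h2 ⊢
    linear_combination (h1 + h2) / 2 - h0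
  · intro h
    refine ⟨fun θ i j => ⟨thetaMetric l k θ i j,
      (∑ r, c r • thetaConn l k θ r + ∑ r, θ r • thetaConn l k c r) i j, fun t => ?_⟩,
      fun θ i j r => ⟨_, _, fun t => rfl⟩⟩
    rw [h, smul_zero, add_zero]
    rfl

end OrbitC

end

theorem mainTheorem4 (l k : ℕ) (hk : 1 ≤ k) (hkl : k ≤ l) :
    -- `y^1, …, y^l, exp y^{l+1}` are coordinates on the orbit space,
    -- and the metric `g` is well defined on the covering with coordinates `y`
    (Function.Surjective (OrbitC.yCoord l k) ∧
      (∀ x x' : Fin (l + 1) → ℂ, (∃ w ∈ OrbitC.extAffineWeyl l k, w x = x') ↔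
        (∀ j : Fin l, OrbitC.yCoord l k x j.castSucc = OrbitC.yCoord l k x' j.castSucc) ∧
        Complex.exp (OrbitC.yCoord l k x (Fin.last l)) =
          Complex.exp (OrbitC.yCoord l k x' (Fin.last l))) ∧
      (∀ x, OrbitC.orbitMetric l k (OrbitC.yCoord l k x) =
        OrbitC.pushForm l k (OrbitC.yCoord l k) x) ∧
      (∀ y, OrbitC.orbitMetric l k
        (y + Pi.single (Fin.last l) (2 * Real.pi * Complex.I)) = OrbitC.orbitMetric l k y)) ∧
    -- for every `m`, the flat pencil
    (∀ m : ℕ, m ≤ l - k →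
      FlatPencil.IsFlatPencil {y | (OrbitC.orbitEta l k m y).det ≠ 0}
        (OrbitC.orbitMetric l k) (OrbitC.orbitEta l k m) ∧
      (∀ w ∈ OrbitC.extAffineWeyl l k, ∀ x,
        (OrbitC.orbitEta l k m (OrbitC.yCoord l k (w x))).det ≠ 0 ↔
          (OrbitC.orbitEta l k m (OrbitC.yCoord l k x)).det ≠ 0) ∧
      -- the vector field `e`
      (∀ (y : Fin (l + 1) → ℂ) (j : Fin (l + 1)),
        (FlatPencil.jacobian (OrbitC.theta l k) y).mulVec (OrbitC.unityField l k m) j =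
          (OrbitC.shiftPoly l k m).coeff (l - (j : ℕ))) ∧
      (∑ j ∈ Finset.Icc k l, Polynomial.C ((OrbitC.shiftPoly l k m).coeff (l - j)) *
        Polynomial.X ^ (l - j) = OrbitC.shiftPoly l k m) ∧
      (∀ j, k ≤ j → j ≤ l → (OrbitC.shiftPoly l k m).coeff (l - j) =
        (-2) ^ (j - k) * ∑ s ∈ Finset.range (m + 1), (-1) ^ (m - s) * (m.choose s : ℂ) *
          (if s ≤ l - j then ((l - k - m).choose (l - j - s) : ℂ) else 0)) ∧
      -- the coordinates `τ` and the determinant of `η` in these coordinates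
      (∃ τ : (Fin (l + 1) → ℂ) ≃ (Fin (l + 1) → ℂ),
        Differentiable ℂ τ ∧ Differentiable ℂ τ.symm ∧
        (∀ y t, τ y = t ↔ t (Fin.last l) = y (Fin.last l) ∧
          OrbitC.polyOf l (OrbitC.theta l k y) = OrbitC.polyTau l k m (OrbitC.theta l k t)) ∧
        ∀ y, (FlatPencil.jacobian τ y * OrbitC.orbitEta l k m y *
            (FlatPencil.jacobian τ y).transpose).det =
          (-1) ^ (1 + (k - 1).choose 2 + (l - k - m).choose 2 + m.choose 2) *
            (k : ℂ) ^ (k - 1) * 4 ^ (l - k) * (m : ℂ) ^ m *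
            ((l - k - m : ℕ) : ℂ) ^ (l - k - m) *
            (τ y ⟨l - m - 1, by omega⟩) ^ (l - k - m) * (τ y ⟨l - 1, by omega⟩) ^ m)) ∧
    -- the classification of the polynomial shifts
    (∃ (G : Fin (l + 1) → Fin (l + 1) → MvPolynomial (Fin (l + 1)) ℂ)
        (Γ : Fin (l + 1) → Fin (l + 1) → Fin (l + 1) → MvPolynomial (Fin (l + 1)) ℂ),
      (∀ x i j, MvPolynomial.eval (OrbitC.theta l k (OrbitC.yCoord l k x)) (G i j) =
        OrbitC.pushForm l k (fun z => OrbitC.theta l k (OrbitC.yCoord l k z)) x i j) ∧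
      (∀ θ, (Matrix.of fun i j => MvPolynomial.eval θ (G i j)).det ≠ 0 → ∀ i j r,
        FlatPencil.contraChristoffel
          (fun z => Matrix.of fun a b => MvPolynomial.eval z (G a b)) θ i j r =
          MvPolynomial.eval θ (Γ i j r)) ∧
      ∀ c : Fin (l + 1) → ℂ,
        ((∀ θ i j, ∃ A B : ℂ, ∀ t : ℂ, MvPolynomial.eval (θ + t • c) (G i j) = A + t * B) ∧
          (∀ θ i j r, ∃ A B : ℂ, ∀ t : ℂ, MvPolynomial.eval (θ + t • c) (Γ i j r) = A + t * B)) ↔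
        ∃ (m : ℕ) (a : ℂ), m ≤ l - k ∧
          OrbitC.polyOf l c = Polynomial.C a * OrbitC.shiftPoly l k m) := by
  refine ⟨⟨OrbitC.yCoord_surjective l k, OrbitC.orbit_iff hk hkl, OrbitC.orbitMetric_yCoord hk hkl,
    OrbitC.orbitMetric_periodic hk hkl⟩, fun m hm => ⟨?_, ?_, ?_, ?_, ?_, ?_⟩, OrbitC.metricPoly l k,
    OrbitC.connPoly l k, ?_, ?_, ?_⟩
  · exact OrbitC.isFlatPencil_orbit hk hkl hm (OrbitC.exists_det_orbitEta_ne_zero hk hkl hm)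
  · intro w hw x
    rw [OrbitC.orbitEta_invariant hk hkl hm hw x]
  · exact fun y j => OrbitC.mulVec_jacobian_theta_unityField hk hkl hm y j
  · exact OrbitC.sum_coeff_shiftPoly hkl hm
  · exact fun j hj hjl => OrbitC.coeff_shiftPoly hm hj hjl
  · exact ⟨OrbitC.tauEquiv hk hkl hm, OrbitC.differentiable_thetaInv _,
      OrbitC.differentiable_thetaInv _, OrbitC.tauEquiv_eq_iff hk hkl hm,
      OrbitC.det_eta_tau hk hkl hm⟩
  · intro x i j
    rw [OrbitC.eval_metricPoly, OrbitC.pushForm_theta_yCoord hk hkl]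
  · intro θ hd i j r
    have h : ∀ z, (Matrix.of fun a b => MvPolynomial.eval z (OrbitC.metricPoly l k a b)) =
        OrbitC.thetaMetric l k z := fun z => by
      ext a b; exact OrbitC.eval_metricPoly z a b
    simp only [h] at hd ⊢
    rw [OrbitC.eval_connPoly, OrbitC.contraChristoffel_thetaMetric hk hkl hd]
  · exact fun c => (OrbitC.degree_le_one_iff c).trans (OrbitC.thetaMetric_eq_zero_iff hk hkl c)
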